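/- Let $s>1$ and $\delta\in(0,1)$. For a mesh size $h>0$ put $x_j=jh$ ($j\in\mathbb Z$), and for sequences $U=(A_j,J_j)_{j\in\mathbb Z}\in\ell^2(\mathbb Z;\mathbb C^2)$ (averages and jumps of a piecewise linear discontinuous function at the nodes) let $M_h$ and $R_h^s$ be the block tridiagonal mass and stiffness matrices of the SIPG method, $$(M_hU)_j=\begin{pmatrix}\frac h6&-\frac h{12}\\ \frac h{12}&-\frac h{24}\end{pmatrix}U_{j-1}+\begin{pmatrix}\frac{2h}3&0\\0&\frac h6\end{pmatrix}U_j+\begin{pmatrix}\frac h6&\frac h{12}\\-\frac h{12}&-\frac h{24}\end{pmatrix}U_{j+1},$$ $$(R_h^sU)_j=\begin{pmatrix}-\frac1h&0\\0&-\frac1{4h}\end{pmatrix}(U_{j-1}+U_{j+1})+\begin{pmatrix}\frac2h&0\\0&\frac{2s-1}{2h}\end{pmatrix}U_j .$$ Given $U^0,U^1\in\ell^2(\mathbb Z;\mathbb C^2)$, let $U(t)$, $t\ge0$, be the $\ell^2$-valued solution of $M_hU''+R_h^sU=0$, $U(0)=U^0$, $U'(0)=U^1$. *Energies.* The total energy is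 $E_h^s(U^0,U^1)=\frac12\big(\langle R_h^sU^0,U^0\rangle+\langle M_hU^1,U^1\rangle\big)$, with the inner product of $\ell^2$. With the discrete gradient $$(D_h^sU)_j=h^{-1/2}\big(A_{j+1}-A_j,\ \sqrt{s-1}\,J_j,\ \tfrac12(J_{j+1}-J_j)\big)$$ one has $\langle R_h^sU,U\rangle=\langle D_h^sU,D_h^sU\rangle$. For $\Omega=\mathbb R\setminus(-1,1)$ the discrete energy concentrated in $\Omega$ at time $t$ is $$E_{\Omega,h}^s(t)=\tfrac12\,\mathrm{Re}\big(\langle D_h^sU(t),D_h^sU(t)\rangle_\Omega+\langle M_hU'(t),U'(t)\rangle_\Omega\big),$$ where $\langle\cdot,\cdot\rangle_\Omega$ is the inner product in $\ell^2(\{j:x_j\in\Omega\})$. *Physical mode.* For a sequence $f\in\ell^2(\mathbb Z)$ let $\widehat f(\xi)=h\sum_jf_je^{-i\xi x_j}\in L^2(\Pi_h)$, $\Pi_h=[-\pi/h,\pi/h]$, be its semi-discrete Fourier transform, taken componentwise for vector valued sequences. Let $S_h^s(\xi)=M_h(\xi)^{-1}R_h^s(\xi)$ with the symbols $$M_h(\xi)=\begin{pmatrix}\frac{2+\cos(\xi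 h)}3&\frac{i\sin(\xi h)}6\\-\frac{i\sin(\xi h)}6&\frac{2-\cos(\xi h)}{12}\end{pmatrix},\qquad R_h^s(\xi)=\begin{pmatrix}\frac4{h^2}\sin^2(\frac{\xi h}2)&0\\0&\frac{s-\cos^2(\xi h/2)}{h^2}\end{pmatrix}.$$ For $\xi\in\Pi_h$ let $\Lambda_{ph,h}^s(\xi)$ be the smaller one of the two (real) eigenvalues of $S_h^s(\xi)$, and let $P_{ph,h}^s(\xi)$ be a corresponding eigenvector (with any normalization). *Theorem.* There is a time $T_{ph}^{s,\delta}>0$, depending only on $s$ and $\delta$, such that for every $T>T_{ph}^{s,\delta}$ there is a constant $C>0$, independent of $h$ and of the data, such that for all $h\in(0,1]$ the observability inequality $$E_h^s(U^0,U^1)\le C\int_0^TE_{\Omega,h}^s(t)\,dt$$ holds for all initial data $U^0,U^1\in\ell^2(\mathbb Z;\mathbb C^2)$ of the form $\widehat{U^i}(\xi)=P_{ph,h}^s(\xi)\,\widehat{u^i}(\xi)$ for a.e. $\xi\in\Pi_h$, $i=0,1$, where $u^0,u^1\in\ell^2(\mathbb Z)$ satisfy $\mathrm{supp}\,\widehat{u^i}\subset[-\pi\delta/h,\pi\delta/h]$.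 -/

import Mathlib

open MeasureTheory Set
open scoped Matrix ENNReal

namespace SIPG

noncomputable section

/-! ### State space and block stencils

A state is a square-summable sequence of pairs `(A_j, J_j)`, where `A_j` (index `0`) is the average
and `J_j` (index `1`) is the jump of the numerical solution at the node `x_j = j h`. -/

/-- The space `ℓ²(ℤ; ℂ²)` of coefficient sequences `(A_j, J_j)_j`. -/
abbrev State : Type := lp (fun _ : ℤ => EuclideanSpace ℂ (Fin 2)) 2

/-- The coefficient pairs `j ↦ (A_j, J_j)` of a state. -/
def coeffs (U : State) : ℤ → Fin 2 → ℂ := fun j => (U j).ofLp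

/-- The sequence obtained by applying the infinite block tridiagonal matrix whose rows repeat the
stencil `(L | C | R)`. -/
def stencilApply (L C R : Matrix (Fin 2) (Fin 2) ℂ) (U : ℤ → Fin 2 → ℂ) : ℤ → Fin 2 → ℂ :=
  fun j => L *ᵥ U (j - 1) + C *ᵥ U j + R *ᵥ U (j + 1)

/-- The mass matrix `M_h`. -/
def massOp (h : ℝ) : (ℤ → Fin 2 → ℂ) → ℤ → Fin 2 → ℂ :=
  stencilApply
    !![(h : ℂ) / 6, -(h : ℂ) / 12; (h : ℂ) / 12, -(h : ℂ) / 24]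
    !![2 * (h : ℂ) / 3, 0; 0, (h : ℂ) / 6]
    !![(h : ℂ) / 6, (h : ℂ) / 12; -(h : ℂ) / 12, -(h : ℂ) / 24]

/-- The stiffness matrix `R_h^s`. -/
def stiffOp (h s : ℝ) : (ℤ → Fin 2 → ℂ) → ℤ → Fin 2 → ℂ :=
  stencilApply
    !![-1 / (h : ℂ), 0; 0, -1 / (4 * (h : ℂ))]
    !![2 / (h : ℂ), 0; 0, (2 * (s : ℂ) - 1) / (2 * (h : ℂ))]
    !![-1 / (h : ℂ), 0; 0, -1 / (4 * (h : ℂ))]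

/-! ### The semi-discrete wave equation -/

/-- `U` is the solution on `[0, ∞)`, with velocity `V`, of
`M_h U'' + R_h^s U = 0`, `U(0) = U₀`, `U'(0) = U₁` (derivatives in `ℓ²`). -/
structure IsSolution (h s : ℝ) (U₀ U₁ : State) (U V : ℝ → State) : Prop where
  init_pos : U 0 = U₀
  init_vel : V 0 = U₁
  deriv_pos : ∀ t, 0 ≤ t → HasDerivWithinAt U (V t) (Ici 0) t
  wave : ∀ t, 0 ≤ t → ∃ W : State, HasDerivWithinAt V W (Ici 0) t ∧
    ∀ j : ℤ, massOp h (coeffs W) j + stiffOp h s (coeffs (U t)) j = 0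

/-! ### Energies -/

/-- The inner product of `ℓ²(S)`, for a set of indices `S`, of two vector valued sequences. -/
def innerOn {n : ℕ} (S : Set ℤ) (F G : ℤ → Fin n → ℂ) : ℂ :=
  ∑' j : S, F j ⬝ᵥ star (G j)

/-- The indices `j` of the nodes `x_j = j h` in `Ω = ℝ \ (-1, 1)`. -/
def omegaNodes (h : ℝ) : Set ℤ := {j : ℤ | (j : ℝ) * h ∉ Ioo (-1 : ℝ) 1}

/-- The total energy `½ (⟨R_h^s U₀, U₀⟩ + ⟨M_h U₁, U₁⟩)`. -/
def energy (h s : ℝ) (U₀ U₁ : State) : ℝ :=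
  (1 / 2) * (innerOn univ (stiffOp h s (coeffs U₀)) (coeffs U₀)
    + innerOn univ (massOp h (coeffs U₁)) (coeffs U₁)).re

/-- The discrete gradient `D_h^s`, with
`(D_h^s U)_j = h^{-1/2} (A_{j+1} - A_j, √(s-1) J_j, (J_{j+1} - J_j)/2)`.
It satisfies `R_h^s = (D_h^s)^* D_h^s`, see `innerOn_gradOp`. -/
def gradOp (h s : ℝ) (U : ℤ → Fin 2 → ℂ) : ℤ → Fin 3 → ℂ := fun j =>
  ((1 / Real.sqrt h : ℝ) : ℂ) •
    ![U (j + 1) 0 - U j 0, (Real.sqrt (s - 1) : ℂ) * U j 1, (U (j + 1) 1 - U j 1) / 2]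

theorem summable_mul_coeffs (U : State) (a b : ℤ) (i : Fin 2) :
    Summable fun j : ℤ => coeffs U (j + a) i * star (coeffs U (j + b) i) := by
  have h0 : Summable fun j : ℤ => ‖coeffs U j i‖ ^ 2 := by
    have h1 : Summable fun j : ℤ => ‖U j‖ ^ 2 := by
      simpa using (lp.memℓp U).summable (by simp)
    refine h1.of_nonneg_of_le (fun j => by positivity) fun j => ?_
    rw [EuclideanSpace.norm_sq_eq (U j)]
    exact Finset.single_le_sum (f := fun k => ‖(U j).ofLp k‖ ^ 2) (fun _ _ => by positivity)
      (Finset.mem_univ i)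
  generalize coeffs U = c at h0 ⊢
  have hs : ∀ a : ℤ, Summable fun j : ℤ => ‖c (j + a) i‖ ^ 2 := fun a =>
    (Equiv.addRight a).summable_iff (f := fun j : ℤ => ‖c j i‖ ^ 2) |>.mpr h0
  refine Summable.of_norm_bounded ((hs a).add (hs b)) fun j => ?_
  rw [norm_mul, norm_star]
  nlinarith [sq_nonneg (‖c (j + a) i‖ - ‖c (j + b) i‖),
    sq_nonneg ‖c (j + a) i‖, sq_nonneg ‖c (j + b) i‖]

theorem innerOn_gradOp (h s : ℝ) (hh : 0 < h) (hs : 1 ≤ s) (U : State) :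
    innerOn univ (gradOp h s (coeffs U)) (gradOp h s (coeffs U))
      = innerOn univ (stiffOp h s (coeffs U)) (coeffs U) := by
  set c := coeffs U with hc
  let g : ℤ → ℂ := fun j => (1 / (h : ℂ)) *
    ((c (j + 0) 0 * star (c (j + 0) 0) - c (j + -1) 0 * star (c (j + 0) 0))
      + (1 / 4) * (c (j + 0) 1 * star (c (j + 0) 1) - c (j + -1) 1 * star (c (j + 0) 1)))
  let d : ℤ → ℂ := fun j => gradOp h s c j ⬝ᵥ star (gradOp h s c j)
  let r : ℤ → ℂ := fun j => stiffOp h s c j ⬝ᵥ star (c j)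
  have hg : Summable g := by
    refine Summable.mul_left _ (Summable.add (Summable.sub ?_ ?_)
      (Summable.mul_left _ (Summable.sub ?_ ?_))) <;> exact summable_mul_coeffs U _ _ _
  have hg1 : Summable fun j => g (j + 1) := (Equiv.addRight (1 : ℤ)).summable_iff.mpr hg
  have hr : Summable r := by
    have : r = fun j =>
        ((-1 / (h : ℂ)) * (c (j + -1) 0 * star (c (j + 0) 0))
          + (2 / (h : ℂ)) * (c (j + 0) 0 * star (c (j + 0) 0))
          + (-1 / (h : ℂ)) * (c (j + 1) 0 * star (c (j + 0) 0)))
        + ((-1 / (4 * (h : ℂ))) * (c (j + -1) 1 * star (c (j + 0) 1))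
          + ((2 * (s : ℂ) - 1) / (2 * (h : ℂ))) * (c (j + 0) 1 * star (c (j + 0) 1))
          + (-1 / (4 * (h : ℂ))) * (c (j + 1) 1 * star (c (j + 0) 1))) := by
      funext j
      simp only [r, stiffOp, stencilApply, dotProduct, Fin.sum_univ_two, Matrix.mulVec,
        Pi.add_apply, Pi.star_apply, Matrix.of_apply, Matrix.cons_val', Matrix.cons_val_zero,
        Matrix.cons_val_one, Matrix.cons_val_fin_one, add_zero, sub_eq_add_neg]
      ring
    rw [this]
    refine Summable.add (Summable.add (Summable.add ?_ ?_) ?_)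
      (Summable.add (Summable.add ?_ ?_) ?_) <;>
      exact Summable.mul_left _ (summable_mul_coeffs U _ _ _)
  have hd : d = fun j => r j + (g (j + 1) - g j) := by
    funext j
    have h1 : ((Real.sqrt h : ℝ) : ℂ) * (Real.sqrt h : ℝ) = (h : ℂ) := by
      rw [← Complex.ofReal_mul, Real.mul_self_sqrt hh.le]
    have h2 : ((Real.sqrt (s - 1) : ℝ) : ℂ) * (Real.sqrt (s - 1) : ℝ) = (s : ℂ) - 1 := by
      rw [← Complex.ofReal_mul, Real.mul_self_sqrt (by linarith)]
      push_cast
      ring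
    have h3 : (1 / ((Real.sqrt h : ℝ) : ℂ)) * (1 / ((Real.sqrt h : ℝ) : ℂ)) = 1 / (h : ℂ) := by
      rw [← h1]
      ring
    have hne : (h : ℂ) ≠ 0 := by exact_mod_cast hh.ne'
    have e1 : d j = (1 / ((Real.sqrt h : ℝ) : ℂ)) * (1 / ((Real.sqrt h : ℝ) : ℂ)) *
        ((c (j + 1) 0 - c j 0) * (star (c (j + 1) 0) - star (c j 0))
        + ((Real.sqrt (s - 1) : ℝ) : ℂ) * (Real.sqrt (s - 1) : ℝ) * (c j 1 * star (c j 1))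
        + (c (j + 1) 1 - c j 1) * (star (c (j + 1) 1) - star (c j 1)) / 4) := by
      simp only [d, gradOp, dotProduct, Fin.sum_univ_three, Pi.smul_apply, Pi.star_apply,
        smul_eq_mul, Matrix.cons_val_zero, Matrix.cons_val_one, Matrix.cons_val,
        star_mul', map_sub, map_mul, star_div₀, Complex.star_def, Complex.conj_ofReal, map_ofNat,
        Complex.ofReal_div, Complex.ofReal_one, map_div₀, map_one]
      ring
    rw [e1, h2, h3]
    simp only [r, g, stiffOp, stencilApply, dotProduct, Fin.sum_univ_two, Matrix.mulVec,
      Pi.add_apply, Pi.star_apply, Matrix.of_apply, Matrix.cons_val', Matrix.cons_val_zero,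
      Matrix.cons_val_one, Matrix.cons_val_fin_one, add_zero, sub_eq_add_neg,
      add_neg_cancel_right]
    field_simp
    ring
  have key : ∑' j, d j = ∑' j, r j := by
    rw [hd, hr.tsum_add (hg1.sub hg), hg1.tsum_sub hg]
    have : ∑' j, g (j + 1) = ∑' j, g j := (Equiv.addRight (1 : ℤ)).tsum_eq g
    rw [this]
    ring
  unfold innerOn
  rw [tsum_univ (f := d), tsum_univ (f := r)]
  exact key

/-- The energy in `Ω` of a state `U` with velocity `V`: the energy
`½ (⟨R_h^s U, U⟩ + ⟨M_h V, V⟩) = ½ (⟨D_h^s U, D_h^s U⟩ + ⟨M_h V, V⟩)`, the inner product being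
replaced by the one of `ℓ²({j : x_j ∈ Ω})`. -/
def localEnergy (h s : ℝ) (U V : State) : ℝ :=
  (1 / 2) * (innerOn (omegaNodes h) (gradOp h s (coeffs U)) (gradOp h s (coeffs U))
    + innerOn (omegaNodes h) (massOp h (coeffs V)) (coeffs V)).re

/-! ### Semi-discrete Fourier transform -/

/-- The frequency interval `Π_h^δ = [-πδ/h, πδ/h]`. -/
def freqInterval (h δ : ℝ) : Set ℝ := Icc (-(Real.pi * δ / h)) (Real.pi * δ / h)

/-- Lebesgue measure on `Π_h = [-π/h, π/h]`. -/
abbrev freqMeasure (h : ℝ) : Measure ℝ := volume.restrict (freqInterval h 1)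

/-- The function `ξ ↦ h f_j e^{-i ξ x_j}`. -/
def sdftTerm (h : ℝ) (f : ℤ → ℂ) (j : ℤ) (ξ : ℝ) : ℂ :=
  (h : ℂ) * f j * Complex.exp (-(Complex.I * (ξ : ℂ) * ((j : ℂ) * (h : ℂ))))

theorem memLp_sdftTerm (h : ℝ) (f : ℤ → ℂ) (j : ℤ) :
    MemLp (sdftTerm h f j) 2 (freqMeasure h) := by
  have : IsFiniteMeasure (freqMeasure h) :=
    ⟨by simp [freqMeasure, freqInterval]⟩
  refine MemLp.of_bound (C := ‖(h : ℂ) * f j‖) ?_ ?_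
  · apply Continuous.aestronglyMeasurable
    unfold sdftTerm
    fun_prop
  · refine Filter.Eventually.of_forall fun ξ => ?_
    unfold sdftTerm
    rw [norm_mul, Complex.norm_exp]
    simp

/-- The semi-discrete Fourier transform `f̂(ξ) = h ∑_j f_j e^{-i ξ x_j}`, the series converging
in `L²(Π_h)` for `f ∈ ℓ²`. -/
def sdft (h : ℝ) (f : ℤ → ℂ) : Lp ℂ 2 (freqMeasure h) :=
  ∑' j : ℤ, (memLp_sdftTerm h f j).toLp (sdftTerm h f j)

/-- The space `I_h^δ` of sequences in `ℓ²` with Fourier transform supported in `Π_h^δ`. -/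
def IsFiltered (h δ : ℝ) (f : lp (fun _ : ℤ => ℂ) 2) : Prop :=
  ∀ᵐ ξ ∂(freqMeasure h), ξ ∉ freqInterval h δ → sdft h f ξ = 0

/-! ### Symbols and the physical mode -/

/-- The symbol `M_h(ξ)` of the mass matrix. -/
def massSymbol (h ξ : ℝ) : Matrix (Fin 2) (Fin 2) ℂ :=
  !![((2 + Real.cos (ξ * h)) / 3 : ℝ), Complex.I * ((Real.sin (ξ * h) / 6 : ℝ) : ℂ);
    -(Complex.I * ((Real.sin (ξ * h) / 6 : ℝ) : ℂ)), ((2 - Real.cos (ξ * h)) / 12 : ℝ)]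

/-- The symbol `R_h^s(ξ)` of the stiffness matrix. -/
def stiffSymbol (h s ξ : ℝ) : Matrix (Fin 2) (Fin 2) ℂ :=
  !![(4 / h ^ 2 * Real.sin (ξ * h / 2) ^ 2 : ℝ), 0;
    0, ((s - Real.cos (ξ * h / 2) ^ 2) / h ^ 2 : ℝ)]

/-- `S_h^s(ξ) = M_h(ξ)⁻¹ R_h^s(ξ)`. -/
def waveSymbol (h s ξ : ℝ) : Matrix (Fin 2) (Fin 2) ℂ :=
  (massSymbol h ξ)⁻¹ * stiffSymbol h s ξ

/-- The physical eigenvalue `Λ_{ph,h}^s(ξ)`: the smaller one of the two (real) eigenvalues of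
`S_h^s(ξ)`. -/
def physEigenvalue (h s ξ : ℝ) : ℝ :=
  sInf {Λ : ℝ | Module.End.HasEigenvalue (Matrix.toLin' (waveSymbol h s ξ)) (Λ : ℂ)}

/-- `P` is a choice of physical eigenvectors `P_{ph,h}^s(ξ)`, `ξ ∈ Π_h`, with no restriction on
their normalization. -/
def IsPhysEigenvector (h s : ℝ) (P : ℝ → Fin 2 → ℂ) : Prop :=
  ∀ ξ ∈ freqInterval h 1, Module.End.HasEigenvector (Matrix.toLin' (waveSymbol h s ξ))
    (physEigenvalue h s ξ : ℂ) (P ξ)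

/-- `Û(ξ) = P(ξ) û(ξ)` for almost every `ξ ∈ Π_h`. -/
def IsPhysData (h : ℝ) (P : ℝ → Fin 2 → ℂ) (U : State) (u : lp (fun _ : ℤ => ℂ) 2) : Prop :=
  ∀ i : Fin 2, ∀ᵐ ξ ∂(freqMeasure h),
    sdft h (fun j => coeffs U j i) ξ = P ξ i * sdft h u ξ

end

end SIPG

open SIPG

/-! On the Fourier side a physical solution is a superposition of two half waves `exp(± i t w(ξ))`,
with `w(ξ) = phase s (ξ h) / h` the signed square root of the smaller eigenvalue. The value at a
fixed node is then an oscillatory integral in `ξ`. Wherever the group velocity `w'` is at least `c >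
0`, the square of such an integral has a time integral bounded by a constant times the squared `L²`
norm of its amplitude, uniformly in the length of the time interval
(`integral_norm_sq_oscillatory_le`, a Gaussian weight followed by a Schur test).

Filtering supplies the lower bound: `deriv_phase_pos` gives `phase' > 0` on `(-π, π)`, and
compactness of `[-πδ, πδ]` makes it uniform. The scaling of `w` makes the bound independent of `h`
(`exists_phase_expanding`).

The size of the solution is `ν`, the sum of the norms of the transformed velocities and of `w` times
the transformed positions (`waveSize`). The quantities in the energy, namely velocities, difference
quotients of averages and jumps divided by `h`, are bounded multipliers applied to these
(`exists_multipliers`). For jumps this uses the eigenvector relation: `fourierOp_jumpQuot` expresses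
jumps divided by `h` through `w û`.

Each node in `(-1, 1)` thus contributes `O(h ν²)` to the time-integrated energy. There are `O(1/h)`
such nodes, so the unobserved part is at most `N ν²` with `N` independent of `T`. The total energy
is at least `ν² / (4 A)` at every time, so the observed energy is at least `(T / (4 A) - N) ν²`,
which is positive once `T > 4 A N`. Finally `energy_le_waveSize_sq` bounds the initial energy by
`ν²`. -/

namespace SIPG

/-! ### Oscillatory integrals with expanding phase -/

/-- Expansion of the weighted square of an oscillatory integral into a double integral. -/
theorem integral_gaussian_mul_norm_sq_oscillatory {μ : Measure ℝ} [IsFiniteMeasure μ]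
    {ω : ℝ → ℝ} (hω : Continuous ω) {f : ℝ → ℂ} (hf : Integrable f μ) {ε : ℝ} (hε : 0 < ε) :
    ((∫ t : ℝ, Real.exp (-ε * t ^ 2) *
        ‖∫ ξ, Complex.exp (Complex.I * t * ω ξ) * f ξ ∂μ‖ ^ 2 : ℝ) : ℂ)
      = ∫ p : ℝ × ℝ, (f p.1 * star (f p.2)) *
          ((Real.sqrt (Real.pi / ε) * Real.exp (-(ω p.1 - ω p.2) ^ 2 / (4 * ε)) : ℝ) : ℂ)
          ∂(μ.prod μ) := by
  have hff : Integrable (fun p : ℝ × ℝ => f p.1 * star (f p.2)) (μ.prod μ) := by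
    have hs : Integrable (fun η => star (f η)) μ :=
      Complex.conjCLE.toContinuousLinearMap.integrable_comp hf
    exact hf.mul_prod hs
  have hg : Integrable (fun t : ℝ => (Real.exp (-ε * t ^ 2) : ℂ)) :=
    (integrable_exp_neg_mul_sq hε).ofReal
  -- The Gaussian weight makes the triple integral absolutely convergent, so that Fubini allows the
  -- time integral to be done first.
  have key : Integrable (Function.uncurry fun (t : ℝ) (p : ℝ × ℝ) =>
      Complex.exp (Complex.I * t * (ω p.1 - ω p.2 : ℝ)) *
        ((Real.exp (-ε * t ^ 2) : ℂ) * (f p.1 * star (f p.2)))) (volume.prod (μ.prod μ)) := by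
    refine Integrable.bdd_mul (c := 1) (hg.mul_prod hff) ?_ ?_
    · apply Continuous.aestronglyMeasurable
      fun_prop
    · refine Filter.Eventually.of_forall fun p => ?_
      rw [Complex.norm_exp]
      simp
  have h1 : ((∫ t : ℝ, Real.exp (-ε * t ^ 2) *
        ‖∫ ξ, Complex.exp (Complex.I * t * ω ξ) * f ξ ∂μ‖ ^ 2 : ℝ) : ℂ)
      = ∫ t : ℝ, ∫ p : ℝ × ℝ, Complex.exp (Complex.I * t * (ω p.1 - ω p.2 : ℝ)) *
        ((Real.exp (-ε * t ^ 2) : ℂ) * (f p.1 * star (f p.2))) ∂(μ.prod μ) := by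
    rw [← integral_complex_ofReal]
    congr 1
    ext t
    have e1 : ∀ z : ℂ, ((‖z‖ ^ 2 : ℝ) : ℂ) = z * star z := fun z => by
      rw [Complex.star_def, Complex.mul_conj, Complex.normSq_eq_norm_sq]
    rw [Complex.ofReal_mul, e1]
    have e2 : star (∫ ξ, Complex.exp (Complex.I * t * ω ξ) * f ξ ∂μ)
        = ∫ ξ, Complex.exp (-(Complex.I * t * ω ξ)) * star (f ξ) ∂μ := by
      rw [Complex.star_def, ← integral_conj]
      congr 1
      ext ξ
      simp [← Complex.exp_conj]
    rw [e2, ← integral_prod_mul, ← integral_const_mul]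
    congr 1
    ext p
    have : Complex.exp (Complex.I * t * (ω p.1 - ω p.2 : ℝ))
        = Complex.exp (Complex.I * t * ω p.1) * Complex.exp (-(Complex.I * t * ω p.2)) := by
      rw [← Complex.exp_add]
      congr 1
      push_cast
      ring
    rw [this]
    ring
  rw [h1, integral_integral_swap key]
  congr 1
  ext p
  have h2 := fourierIntegral_gaussian (b := (ε : ℂ)) (by simpa using hε)
    ((ω p.1 - ω p.2 : ℝ) : ℂ)
  have h3 : ((Real.pi : ℂ) / ε) ^ (1 / 2 : ℂ) = (Real.sqrt (Real.pi / ε) : ℂ) := by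
    rw [Real.sqrt_eq_rpow, Complex.ofReal_cpow (by positivity)]
    push_cast
    rfl
  rw [h3] at h2
  calc _ = ∫ t : ℝ, (f p.1 * star (f p.2)) *
        (Complex.exp (Complex.I * (ω p.1 - ω p.2 : ℝ) * t) * Complex.exp (-(ε : ℂ) * t ^ 2)) := by
        congr 1
        ext t
        push_cast
        rw [show Complex.I * t * ((ω p.1 : ℂ) - ω p.2) = Complex.I * ((ω p.1 : ℂ) - ω p.2) * t by
          ring]
        ring
    _ = _ := by
        rw [integral_const_mul, h2]
        push_cast
        rfl

theorem continuous_oscillatory {μ : Measure ℝ} {ω : ℝ → ℝ} (hω : Continuous ω) {f : ℝ → ℂ}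
    (hf : Integrable f μ) :
    Continuous fun t : ℝ => ∫ ξ, Complex.exp (Complex.I * t * ω ξ) * f ξ ∂μ := by
  refine continuous_of_dominated (bound := fun ξ => ‖f ξ‖) ?_ ?_ hf.norm ?_
  · intro t
    refine AEStronglyMeasurable.mul ?_ hf.aestronglyMeasurable
    apply Continuous.aestronglyMeasurable
    fun_prop
  · refine fun t => Filter.Eventually.of_forall fun ξ => ?_
    rw [norm_mul, Complex.norm_exp]
    simp
  · exact Filter.Eventually.of_forall fun ξ => by fun_prop

/-- **Gaussian large sieve**: an oscillatory integral whose phase is expanding is square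
integrable in time, uniformly on time intervals. -/
theorem integral_norm_sq_oscillatory_le {I : Set ℝ} (hI : MeasurableSet I)
    [IsFiniteMeasure (volume.restrict I)] {ω : ℝ → ℝ} (hω : Continuous ω) {c : ℝ} (hc : 0 < c)
    (hexp : ∀ ξ ∈ I, ∀ η ∈ I, c * |ξ - η| ≤ |ω ξ - ω η|)
    {f : ℝ → ℂ} (hf : MemLp f 2 (volume.restrict I)) {T : ℝ} (hT : 0 < T) :
    ∫ t in (0 : ℝ)..T, ‖∫ ξ in I, Complex.exp (Complex.I * t * ω ξ) * f ξ‖ ^ 2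
      ≤ 2 * Real.pi * Real.exp 1 / c * ∫ ξ in I, ‖f ξ‖ ^ 2 := by
  set μ : Measure ℝ := volume.restrict I with hμ
  have hf1 : Integrable f μ := hf.integrable (by norm_num)
  have hf2 : Integrable (fun ξ => ‖f ξ‖ ^ 2) μ := hf.integrable_norm_pow (by norm_num)
  -- With this width the weight is at least `exp (-1)` on `[0, T]`. The powers of `T` it creates
  -- cancel in `hAb`.
  set ε : ℝ := 1 / T ^ 2 with hε
  have hε0 : 0 < ε := by positivity
  set F : ℝ → ℂ := fun t => ∫ ξ, Complex.exp (Complex.I * t * ω ξ) * f ξ ∂μ with hF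
  have hnorm : ∀ t ξ : ℝ, ‖Complex.exp (Complex.I * t * ω ξ) * f ξ‖ = ‖f ξ‖ := fun t ξ => by
    rw [norm_mul, Complex.norm_exp]
    simp
  have hFc : Continuous F := continuous_oscillatory hω hf1
  have hFb : ∀ t, ‖F t‖ ≤ ∫ ξ, ‖f ξ‖ ∂μ := fun t => by
    refine (norm_integral_le_integral_norm _).trans_eq ?_
    simp_rw [hnorm]
  have hgF : Integrable fun t : ℝ => Real.exp (-ε * t ^ 2) * ‖F t‖ ^ 2 := by
    refine Integrable.mul_bdd (c := (∫ ξ, ‖f ξ‖ ∂μ) ^ 2) (integrable_exp_neg_mul_sq hε0)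
      (by apply Continuous.aestronglyMeasurable; fun_prop)
      (Filter.Eventually.of_forall fun t => ?_)
    rw [norm_pow, norm_norm]
    gcongr
    exact hFb t
  have step1 : ∫ t in (0 : ℝ)..T, ‖F t‖ ^ 2
      ≤ Real.exp 1 * ∫ t : ℝ, Real.exp (-ε * t ^ 2) * ‖F t‖ ^ 2 := by
    rw [intervalIntegral.integral_of_le hT.le, ← integral_const_mul]
    refine le_trans (setIntegral_mono_on (f := fun t => ‖F t‖ ^ 2)
      (g := fun t => Real.exp 1 * (Real.exp (-ε * t ^ 2) * ‖F t‖ ^ 2)) ?_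
      (hgF.const_mul _).integrableOn measurableSet_Ioc ?_)
      (setIntegral_le_integral (hgF.const_mul _)
        (Filter.Eventually.of_forall fun t => by simp only [Pi.zero_apply]; positivity))
    · exact (Continuous.integrableOn_Icc (by fun_prop)).mono_set Ioc_subset_Icc_self
    · intro t ht
      rw [← mul_assoc, ← Real.exp_add]
      refine le_mul_of_one_le_left (by positivity) (Real.one_le_exp ?_)
      have : t ^ 2 ≤ T ^ 2 := by nlinarith [ht.1, ht.2]
      have h2 : ε * t ^ 2 ≤ 1 := by
        rw [hε, one_div, inv_mul_le_iff₀ (by positivity)]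
        linarith
      linarith
  have hexpand := integral_gaussian_mul_norm_sq_oscillatory (μ := μ) hω hf1 hε0
  set A : ℝ := Real.sqrt (Real.pi / ε) with hA
  -- The expansion hypothesis bounds the kernel in `ω ξ - ω η` by a Gaussian in `ξ - η` with this
  -- rate, a convolution kernel to which the Schur test applies.
  set b : ℝ := c ^ 2 / (4 * ε) with hb
  have hb0 : 0 < b := by positivity
  let G : ℝ → ℝ := fun u => Real.exp (-b * u ^ 2)
  have hG1 : ∀ u, G u ≤ 1 := fun u => Real.exp_le_one_iff.mpr (by nlinarith [sq_nonneg u])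
  have hG : Integrable G := integrable_exp_neg_mul_sq hb0
  have hGc : Continuous G := by fun_prop
  have hk1 : Integrable (fun p : ℝ × ℝ => ‖f p.1‖ ^ 2 * G (p.1 - p.2)) (μ.prod μ) := by
    have := hf2.mul_prod (integrable_const (1 : ℝ) (μ := μ))
    simp only [mul_one] at this
    refine this.mul_bdd (c := 1) (by apply Continuous.aestronglyMeasurable; fun_prop)
      (Filter.Eventually.of_forall fun p => ?_)
    rw [Real.norm_of_nonneg (Real.exp_pos _).le]
    exact hG1 _
  have hk2 : Integrable (fun p : ℝ × ℝ => ‖f p.2‖ ^ 2 * G (p.1 - p.2)) (μ.prod μ) := by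
    have := (integrable_const (1 : ℝ) (μ := μ)).mul_prod hf2
    simp only [one_mul] at this
    refine this.mul_bdd (c := 1) (by apply Continuous.aestronglyMeasurable; fun_prop)
      (Filter.Eventually.of_forall fun p => ?_)
    rw [Real.norm_of_nonneg (Real.exp_pos _).le]
    exact hG1 _
  have hGint : ∫ u, G u = Real.sqrt (Real.pi / b) := integral_gaussian b
  -- Half of the Schur test: the free variable is integrated over all of `ℝ` instead of `I`.
  have hi1 : ∫ p : ℝ × ℝ, ‖f p.1‖ ^ 2 * G (p.1 - p.2) ∂(μ.prod μ)
      ≤ Real.sqrt (Real.pi / b) * ∫ ξ, ‖f ξ‖ ^ 2 ∂μ := by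
    rw [integral_prod _ hk1, ← integral_const_mul]
    refine integral_mono hk1.integral_prod_left (hf2.const_mul _) fun ξ => ?_
    simp only
    rw [integral_const_mul, mul_comm]
    gcongr
    rw [← hGint, ← integral_sub_left_eq_self G volume ξ]
    exact setIntegral_le_integral ((integrable_comp_sub_left G ξ).mpr hG)
      (Filter.Eventually.of_forall fun u => (Real.exp_pos _).le)
  have hi2 : ∫ p : ℝ × ℝ, ‖f p.2‖ ^ 2 * G (p.1 - p.2) ∂(μ.prod μ)
      ≤ Real.sqrt (Real.pi / b) * ∫ ξ, ‖f ξ‖ ^ 2 ∂μ := by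
    rw [integral_prod_symm _ hk2, ← integral_const_mul]
    refine integral_mono hk2.integral_prod_right (hf2.const_mul _) fun ξ => ?_
    simp only
    rw [integral_const_mul, mul_comm]
    gcongr
    rw [← hGint, ← integral_sub_right_eq_self G ξ]
    exact setIntegral_le_integral (hG.comp_sub_right ξ)
      (Filter.Eventually.of_forall fun u => (Real.exp_pos _).le)
  have step2 : ∫ t : ℝ, Real.exp (-ε * t ^ 2) * ‖F t‖ ^ 2
      ≤ A * (Real.sqrt (Real.pi / b) * ∫ ξ, ‖f ξ‖ ^ 2 ∂μ) := by
    have h0 : 0 ≤ ∫ t : ℝ, Real.exp (-ε * t ^ 2) * ‖F t‖ ^ 2 :=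
      integral_nonneg fun t => by positivity
    have hae : ∀ᵐ p ∂(μ.prod μ), p ∈ I ×ˢ I := by
      rw [hμ, Measure.prod_restrict]
      exact ae_restrict_mem (hI.prod hI)
    calc ∫ t : ℝ, Real.exp (-ε * t ^ 2) * ‖F t‖ ^ 2
        = ‖((∫ t : ℝ, Real.exp (-ε * t ^ 2) * ‖F t‖ ^ 2 : ℝ) : ℂ)‖ := by
          rw [Complex.norm_real, Real.norm_of_nonneg h0]
      _ ≤ ∫ p : ℝ × ℝ, A * ((‖f p.1‖ ^ 2 * G (p.1 - p.2)
            + ‖f p.2‖ ^ 2 * G (p.1 - p.2)) / 2) ∂(μ.prod μ) := by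
          rw [hexpand]
          refine norm_integral_le_of_norm_le (((hk1.add hk2).div_const 2).const_mul A) ?_
          filter_upwards [hae] with p hp
          rw [norm_mul, norm_mul, norm_star, Complex.norm_real, Real.norm_of_nonneg (by positivity)]
          have h1 : Real.exp (-(ω p.1 - ω p.2) ^ 2 / (4 * ε)) ≤ G (p.1 - p.2) := by
            refine Real.exp_le_exp.mpr ?_
            have := hexp p.1 hp.1 p.2 hp.2
            have h2 : c ^ 2 * (p.1 - p.2) ^ 2 ≤ (ω p.1 - ω p.2) ^ 2 := by
              rw [← sq_abs (p.1 - p.2), ← sq_abs (ω p.1 - ω p.2), ← mul_pow]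
              gcongr
            rw [hb, neg_div, neg_mul, neg_le_neg_iff, div_mul_eq_mul_div]
            gcongr
          have h3 : ‖f p.1‖ * ‖f p.2‖ ≤ (‖f p.1‖ ^ 2 + ‖f p.2‖ ^ 2) / 2 := by
            nlinarith [sq_nonneg (‖f p.1‖ - ‖f p.2‖)]
          calc ‖f p.1‖ * ‖f p.2‖ * (A * Real.exp (-(ω p.1 - ω p.2) ^ 2 / (4 * ε)))
              ≤ ((‖f p.1‖ ^ 2 + ‖f p.2‖ ^ 2) / 2) * (A * G (p.1 - p.2)) := by gcongr
            _ = _ := by ring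
      _ ≤ _ := by
          rw [integral_const_mul, integral_div, integral_add hk1 hk2]
          gcongr
          linarith
  have hAb : A * Real.sqrt (Real.pi / b) = 2 * Real.pi / c := by
    rw [hA, hb, ← Real.sqrt_mul (by positivity)]
    rw [show Real.pi / ε * (Real.pi / (c ^ 2 / (4 * ε))) = (2 * Real.pi / c) ^ 2 by
      field_simp
      ring]
    exact Real.sqrt_sq (by positivity)
  calc _ ≤ Real.exp 1 * (A * (Real.sqrt (Real.pi / b) * ∫ ξ, ‖f ξ‖ ^ 2 ∂μ)) :=
        step1.trans (by gcongr)
    _ = _ := by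
        rw [← mul_assoc A, hAb]
        ring

end SIPG

namespace SIPG
open scoped BoundedContinuousFunction InnerProductSpace

/-! ### Multiplication operators -/

section Multiplication

variable {μ : Measure ℝ}

theorem memLp_boundedContinuous_mul (a : ℝ →ᵇ ℂ) (f : Lp ℂ 2 μ) :
    MemLp (fun ξ => a ξ * f ξ) 2 μ := by
  refine MemLp.of_le_mul (c := ‖a‖) (Lp.memLp f)
    (a.continuous.aestronglyMeasurable.mul (Lp.aestronglyMeasurable f))
    (Filter.Eventually.of_forall fun ξ => ?_)
  rw [norm_mul]
  gcongr
  exact a.norm_coe_le_norm ξ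

/-- The multiplication operator by a bounded continuous function on `L²(μ)`. -/
noncomputable def mulCLM (μ : Measure ℝ) (a : ℝ →ᵇ ℂ) : Lp ℂ 2 μ →L[ℂ] Lp ℂ 2 μ :=
  LinearMap.mkContinuous
    { toFun := fun f => (memLp_boundedContinuous_mul a f).toLp _
      map_add' := fun f g => by
        rw [← MemLp.toLp_add]
        refine MemLp.toLp_congr _ _ ?_
        filter_upwards [Lp.coeFn_add f g] with ξ h
        simp only [h, Pi.add_apply, mul_add]
      map_smul' := fun c f => by
        rw [RingHom.id_apply, ← MemLp.toLp_const_smul]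
        refine MemLp.toLp_congr _ _ ?_
        filter_upwards [Lp.coeFn_smul c f] with ξ h
        simp only [h, Pi.smul_apply, smul_eq_mul, mul_left_comm] } ‖a‖ (fun f => by
    refine Lp.norm_le_mul_norm_of_ae_le_mul ?_
    filter_upwards [(memLp_boundedContinuous_mul a f).coeFn_toLp] with ξ h
    simp only [LinearMap.coe_mk, AddHom.coe_mk, h, norm_mul]
    gcongr
    exact a.norm_coe_le_norm ξ)

theorem mulCLM_ae (a : ℝ →ᵇ ℂ) (f : Lp ℂ 2 μ) : mulCLM μ a f =ᵐ[μ] fun ξ => a ξ * f ξ :=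
  (memLp_boundedContinuous_mul a f).coeFn_toLp

/-- Multiplication operators form an algebra of operators on `L²(μ)`. -/
noncomputable def mulOp (μ : Measure ℝ) : (ℝ →ᵇ ℂ) →ₐ[ℂ] (Lp ℂ 2 μ →L[ℂ] Lp ℂ 2 μ) where
  toFun := mulCLM μ
  map_one' := by
    ext1 f
    refine Lp.ext ?_
    filter_upwards [mulCLM_ae 1 f] with ξ h
    simp [h]
  map_mul' a b := by
    ext1 f
    refine Lp.ext ?_
    filter_upwards [mulCLM_ae (a * b) f, mulCLM_ae a (mulCLM μ b f), mulCLM_ae b f]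
      with ξ h1 h2 h3
    simp [h1, h2, h3, mul_assoc]
  map_zero' := by
    ext1 f
    refine Lp.ext ?_
    filter_upwards [mulCLM_ae 0 f, Lp.coeFn_zero ℂ 2 μ] with ξ h h0
    rw [h, BoundedContinuousFunction.coe_zero, Pi.zero_apply, zero_mul]
    exact h0.symm
  map_add' a b := by
    ext1 f
    refine Lp.ext ?_
    filter_upwards [mulCLM_ae (a + b) f, mulCLM_ae a f, mulCLM_ae b f,
      Lp.coeFn_add (mulCLM μ a f) (mulCLM μ b f)] with ξ h1 h2 h3 h4
    rw [h1, BoundedContinuousFunction.coe_add, Pi.add_apply, add_mul, ← h2, ← h3]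
    exact h4.symm
  commutes' c := by
    ext1 f
    refine Lp.ext ?_
    filter_upwards [mulCLM_ae (algebraMap ℂ (ℝ →ᵇ ℂ) c) f, Lp.coeFn_smul c f] with ξ h1 h2
    rw [h1, Algebra.algebraMap_eq_smul_one]
    simp [Algebra.algebraMap_eq_smul_one, h2]

theorem norm_mulCLM_apply_le (a : ℝ →ᵇ ℂ) {C : ℝ} (hC : ∀ ξ, ‖a ξ‖ ≤ C)
    (f : Lp ℂ 2 μ) : ‖mulCLM μ a f‖ ≤ C * ‖f‖ := by
  refine Lp.norm_le_mul_norm_of_ae_le_mul ?_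
  filter_upwards [mulCLM_ae a f] with ξ h
  rw [h, norm_mul]
  gcongr
  exact hC ξ

/-- Needed to carry the exponential series of a multiplier to that of its operator in
`half_wave_eq`. -/
theorem continuous_mulOp (μ : Measure ℝ) : Continuous (mulOp μ) :=
  (LinearMap.mkContinuous (mulOp μ).toLinearMap 1 fun a => by
    rw [one_mul]
    exact ContinuousLinearMap.opNorm_le_bound _ (norm_nonneg a)
      fun f => norm_mulCLM_apply_le a a.norm_coe_le_norm f).continuous

/-- With multipliers as scalars, identities between operators on `L²` become linear algebra over a
commutative ring, within reach of `module` and `linear_combination`. -/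
noncomputable instance : Module (ℝ →ᵇ ℂ) (Lp ℂ 2 μ) := Module.compHom _ (mulOp μ).toRingHom

theorem mulOp_apply (a : ℝ →ᵇ ℂ) (f : Lp ℂ 2 μ) : mulOp μ a f = a • f := rfl

theorem bcf_smul_ae (a : ℝ →ᵇ ℂ) (f : Lp ℂ 2 μ) :
    (a • f : Lp ℂ 2 μ) =ᵐ[μ] fun ξ => a ξ * f ξ := mulCLM_ae a f

theorem norm_bcf_smul_le (a : ℝ →ᵇ ℂ) {C : ℝ} (hC : ∀ ξ, ‖a ξ‖ ≤ C) (f : Lp ℂ 2 μ) :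
    ‖a • f‖ ≤ C * ‖f‖ := norm_mulCLM_apply_le a hC f

instance : IsScalarTower ℂ (ℝ →ᵇ ℂ) (Lp ℂ 2 μ) where
  smul_assoc c a f := by
    rw [← mulOp_apply, ← mulOp_apply, map_smul]
    rfl

/-- Evaluation at a point is a continuous ring homomorphism, so it commutes with the exponential
series. -/
theorem exp_bcf_apply (a : ℝ →ᵇ ℂ) (ξ : ℝ) : NormedSpace.exp a ξ = Complex.exp (a ξ) := by
  let e : (ℝ →ᵇ ℂ) →+* ℂ :=
    { toFun := fun a => a ξ
      map_one' := rfl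
      map_mul' := fun _ _ => rfl
      map_zero' := rfl
      map_add' := fun _ _ => rfl }
  let _ : NormedAlgebra ℚ (ℝ →ᵇ ℂ) := NormedAlgebra.restrictScalars ℚ ℂ _
  have := NormedSpace.map_exp e (continuous_eval_const ξ) a
  rw [Complex.exp_eq_exp_ℂ]
  exact this

end Multiplication

/-! ### Fourier transform of square summable sequences -/

/-- Scalar square summable sequences. -/
abbrev Seq : Type := lp (fun _ : ℤ => ℂ) 2

/-- The space `L²(Π_h)`. -/
abbrev FreqSpace (h : ℝ) : Type := Lp ℂ 2 (freqMeasure h)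

instance (h : ℝ) : IsFiniteMeasure (freqMeasure h) :=
  ⟨by simp [freqMeasure, freqInterval]⟩

theorem memℓp_shift (n : ℤ) (f : Seq) : Memℓp (fun j : ℤ => f (j + n)) 2 := by
  refine memℓp_gen ?_
  have := (lp.memℓp f).summable (by simp)
  exact (Equiv.addRight n).summable_iff (f := fun j : ℤ => ‖f j‖ ^ (2 : ℝ≥0∞).toReal) |>.mpr this

/-- The shift `(τ_n f)_j = f_{j+n}`. -/
noncomputable def shift (n : ℤ) : Seq →ₗᵢ[ℂ] Seq where
  toFun f := ⟨fun j => f (j + n), memℓp_shift n f⟩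
  map_add' f g := rfl
  map_smul' c f := rfl
  norm_map' f := by
    have h2 : 0 < (2 : ℝ≥0∞).toReal := by simp
    rw [lp.norm_eq_tsum_rpow h2, lp.norm_eq_tsum_rpow h2]
    congr 1
    exact (Equiv.addRight n).tsum_eq (fun j : ℤ => ‖f j‖ ^ (2 : ℝ≥0∞).toReal)

theorem shift_apply (n : ℤ) (f : Seq) (j : ℤ) : shift n f j = f (j + n) := rfl

/-- The exponential `ξ ↦ e^{i n ξ h}`. -/
noncomputable def wave (h : ℝ) (n : ℤ) : ℝ →ᵇ ℂ :=
  BoundedContinuousFunction.ofNormedAddCommGroup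
    (fun ξ : ℝ => Complex.exp (Complex.I * ((n * (ξ * h) : ℝ) : ℂ))) (by fun_prop) 1
    (fun ξ => by rw [Complex.norm_exp]; simp)

theorem wave_apply (h : ℝ) (n : ℤ) (ξ : ℝ) :
    wave h n ξ = Complex.exp (Complex.I * ((n * (ξ * h) : ℝ) : ℂ)) := rfl

theorem wave_mul (h : ℝ) (m n : ℤ) : wave h m * wave h n = wave h (m + n) := by
  ext ξ
  simp only [BoundedContinuousFunction.mul_apply, wave_apply, ← Complex.exp_add]
  congr 1
  push_cast
  ring

theorem wave_zero (h : ℝ) : wave h 0 = 1 := by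
  ext ξ
  simp [wave_apply]

/-- The function `ξ ↦ h e^{-i ξ x_j}` as an element of `L²(Π_h)`. -/
noncomputable def mode (h : ℝ) (j : ℤ) : FreqSpace h :=
  (memLp_sdftTerm h (fun _ => 1) j).toLp (sdftTerm h (fun _ => 1) j)

theorem mode_ae (h : ℝ) (j : ℤ) : mode h j =ᵐ[freqMeasure h] fun ξ => h * wave h (-j) ξ := by
  filter_upwards [(memLp_sdftTerm h (fun _ => 1) j).coeFn_toLp] with ξ hξ
  rw [mode, hξ, sdftTerm, wave_apply, mul_one]
  congr 2
  push_cast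
  ring

theorem integral_wave {h : ℝ} (hh : 0 < h) (n : ℤ) :
    ∫ ξ, wave h n ξ ∂(freqMeasure h) = if n = 0 then ((2 * Real.pi / h : ℝ) : ℂ) else 0 := by
  have hle : -(Real.pi * 1 / h) ≤ Real.pi * 1 / h := by
    have : 0 ≤ Real.pi * 1 / h := by positivity
    linarith
  rw [freqMeasure, freqInterval, integral_Icc_eq_integral_Ioc,
    ← intervalIntegral.integral_of_le hle]
  split_ifs with hn
  · subst hn
    simp only [wave_zero, BoundedContinuousFunction.coe_one, Pi.one_apply,
      intervalIntegral.integral_const, Complex.real_smul, mul_one]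
    congr 1
    ring
  · have hc : Complex.I * (n * h : ℂ) ≠ 0 := by
      refine mul_ne_zero Complex.I_ne_zero (mul_ne_zero ?_ ?_)
      · exact_mod_cast hn
      · exact_mod_cast hh.ne'
    have e : ∀ ξ : ℝ, wave h n ξ = Complex.exp (Complex.I * (n * h : ℂ) * ξ) := fun ξ => by
      rw [wave_apply]
      congr 1
      push_cast
      ring
    simp_rw [e]
    rw [integral_exp_mul_complex hc, div_eq_zero_iff]
    left
    rw [sub_eq_zero, Complex.exp_eq_exp_iff_exists_int]
    -- The exponents at the endpoints `± π / h` differ by `2 π i n`.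
    refine ⟨n, ?_⟩
    have hne : (h : ℂ) ≠ 0 := by exact_mod_cast hh.ne'
    push_cast
    field_simp
    ring

theorem inner_mode {h : ℝ} (hh : 0 < h) (j k : ℤ) :
    ⟪mode h j, mode h k⟫_ℂ = if j = k then ((2 * Real.pi * h : ℝ) : ℂ) else 0 := by
  have : ⟪mode h j, mode h k⟫_ℂ = ∫ ξ, (h : ℂ) ^ 2 * wave h (j - k) ξ ∂(freqMeasure h) := by
    rw [L2.inner_def]
    refine integral_congr_ae ?_
    filter_upwards [mode_ae h j, mode_ae h k] with ξ h1 h2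
    rw [h1, h2, sub_eq_add_neg, ← wave_mul]
    simp only [BoundedContinuousFunction.mul_apply, RCLike.inner_apply, map_mul,
      Complex.conj_ofReal, wave_apply, ← Complex.exp_conj, Complex.conj_I]
    push_cast
    ring_nf
  rw [this, integral_const_mul, integral_wave hh]
  have hne : (h : ℂ) ≠ 0 := by exact_mod_cast hh.ne'
  by_cases hjk : j = k
  · simp only [hjk, sub_self, if_true]
    push_cast
    field_simp
  · simp [hjk, sub_ne_zero]

/-- Each mode has modulus `h` on an interval of length `2 π / h`, hence squared norm `2 π h`. -/
theorem orthonormal_mode {h : ℝ} (hh : 0 < h) :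
    Orthonormal ℂ fun j : ℤ => (((Real.sqrt (2 * Real.pi * h))⁻¹ : ℝ) : ℂ) • mode h j := by
  rw [orthonormal_iff_ite]
  intro j k
  have hp : 0 < 2 * Real.pi * h := by positivity
  rw [inner_smul_left, inner_smul_right, inner_mode hh, Complex.conj_ofReal]
  split_ifs
  · rw [← Complex.ofReal_mul, ← Complex.ofReal_mul, ← mul_assoc, ← mul_inv,
      Real.mul_self_sqrt hp.le, inv_mul_cancel₀ hp.ne', Complex.ofReal_one]
  · simp

/-- The semi-discrete Fourier transform as a bounded operator from `ℓ²` to `L²(Π_h)`. -/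
noncomputable def fourierOp {h : ℝ} (hh : 0 < h) : Seq →L[ℂ] FreqSpace h :=
  ((Real.sqrt (2 * Real.pi * h) : ℝ) : ℂ) •
    (orthonormal_mode hh).orthogonalFamily.linearIsometry.toContinuousLinearMap

theorem hasSum_fourierOp {h : ℝ} (hh : 0 < h) (f : Seq) :
    HasSum (fun j : ℤ => f j • mode h j) (fourierOp hh f) := by
  have hp : 0 < 2 * Real.pi * h := by positivity
  have hs : Real.sqrt (2 * Real.pi * h) ≠ 0 := (Real.sqrt_pos.mpr hp).ne'
  have := ((orthonormal_mode hh).orthogonalFamily.hasSum_linearIsometry f).const_smul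
    ((Real.sqrt (2 * Real.pi * h) : ℝ) : ℂ)
  convert! this using 2 with j
  have e : ((Real.sqrt (2 * Real.pi * h) : ℝ) : ℂ) * f j *
      (((Real.sqrt (2 * Real.pi * h))⁻¹ : ℝ) : ℂ) = f j := by
    rw [mul_right_comm, mul_comm, ← Complex.ofReal_mul, mul_inv_cancel₀ hs, Complex.ofReal_one, mul_one]
  rw [LinearIsometry.toSpanSingleton_apply, smul_smul, smul_smul, e]

/-- The `tsum` in `sdft` is a genuine sum by `hasSum_fourierOp`; from here on the transform can be
handled as a bounded linear operator. -/
theorem sdft_eq_fourierOp {h : ℝ} (hh : 0 < h) (f : Seq) : sdft h f = fourierOp hh f := by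
  rw [← (hasSum_fourierOp hh f).tsum_eq, sdft]
  congr 1
  ext1 j
  rw [mode, ← MemLp.toLp_const_smul]
  refine MemLp.toLp_congr _ _ (Filter.Eventually.of_forall fun ξ => ?_)
  simp only [sdftTerm, Pi.smul_apply, smul_eq_mul]
  ring

theorem inner_fourierOp {h : ℝ} (hh : 0 < h) (f g : Seq) :
    ⟪fourierOp hh f, fourierOp hh g⟫_ℂ = (2 * Real.pi * h : ℝ) * ⟪f, g⟫_ℂ := by
  have hp : 0 < 2 * Real.pi * h := by positivity
  simp only [fourierOp, smul_apply, LinearIsometry.coe_toContinuousLinearMap]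
  rw [inner_smul_left, inner_smul_right, LinearIsometry.inner_map_map, Complex.conj_ofReal,
    ← mul_assoc, ← Complex.ofReal_mul, Real.mul_self_sqrt hp.le]

theorem norm_fourierOp_sq {h : ℝ} (hh : 0 < h) (f : Seq) :
    ‖fourierOp hh f‖ ^ 2 = 2 * Real.pi * h * ‖f‖ ^ 2 := by
  have h1 := inner_fourierOp hh f f
  rw [inner_self_eq_norm_sq_to_K, inner_self_eq_norm_sq_to_K] at h1
  apply Complex.ofReal_injective
  push_cast at h1 ⊢
  exact h1

/-- Fourier inversion. -/
theorem fourierOp_inversion {h : ℝ} (hh : 0 < h) (f : Seq) (j : ℤ) :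
    ((2 * Real.pi : ℝ) : ℂ) * f j = ∫ ξ, wave h j ξ * fourierOp hh f ξ ∂(freqMeasure h) := by
  have hne : (h : ℂ) ≠ 0 := by exact_mod_cast hh.ne'
  -- A mode is the transform of a unit sequence, so Parseval against it reads off one coefficient.
  have h1 : mode h j = fourierOp hh (lp.single 2 j 1) := by
    refine HasSum.unique ?_ (hasSum_fourierOp hh (lp.single 2 j 1))
    have := hasSum_ite_eq j (mode h j)
    convert! this using 2 with k
    by_cases hk : k = j
    · subst hk
      simp
    · simp [lp.single_apply, hk]
  have h2 : ⟪mode h j, fourierOp hh f⟫_ℂ = (2 * Real.pi * h : ℝ) * f j := by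
    rw [h1, inner_fourierOp, lp.inner_single_left]
    simp
  have h3 : ⟪mode h j, fourierOp hh f⟫_ℂ
      = h * ∫ ξ, wave h j ξ * fourierOp hh f ξ ∂(freqMeasure h) := by
    rw [L2.inner_def, ← integral_const_mul]
    refine integral_congr_ae ?_
    filter_upwards [mode_ae h j] with ξ h1
    rw [h1]
    simp only [RCLike.inner_apply, map_mul, Complex.conj_ofReal, wave_apply, ← Complex.exp_conj,
      Complex.conj_I]
    push_cast
    ring_nf
  refine mul_left_cancel₀ hne ?_
  rw [← h3, h2]
  push_cast
  ring

theorem wave_smul_mode (h : ℝ) (n j : ℤ) : wave h n • mode h j = mode h (j - n) := by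
  refine Lp.ext ?_
  filter_upwards [bcf_smul_ae (wave h n) (mode h j), mode_ae h j, mode_ae h (j - n)]
    with ξ h1 h2 h3
  rw [h1, h2, h3, show -(j - n) = n + -j by ring, ← wave_mul, BoundedContinuousFunction.mul_apply]
  ring

/-- The Fourier transform turns shifts into multiplications. -/
theorem fourierOp_shift {h : ℝ} (hh : 0 < h) (n : ℤ) (f : Seq) :
    fourierOp hh (shift n f) = wave h n • fourierOp hh f := by
  have h1 := (hasSum_fourierOp hh f).mapL (mulOp (freqMeasure h) (wave h n))
  have h2 : (fun j => mulOp (freqMeasure h) (wave h n) (f j • mode h j))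
      = fun j => f j • mode h (j - n) := by
    ext1 j
    rw [map_smul, mulOp_apply, wave_smul_mode]
  rw [h2, mulOp_apply] at h1
  refine HasSum.unique (hasSum_fourierOp hh (shift n f)) ?_
  rw [← (Equiv.addRight n).hasSum_iff] at h1
  convert! h1 using 2 with j
  simp [shift_apply]

theorem norm_coeffs_le (U : State) (j : ℤ) (i : Fin 2) : ‖coeffs U j i‖ ≤ ‖U j‖ :=
  PiLp.norm_apply_le (U j) i

/-- The averages (`i = 0`) and the jumps (`i = 1`) of a state. -/
noncomputable def comp (i : Fin 2) : State →L[ℂ] Seq :=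
  LinearMap.mkContinuous
    { toFun := fun U => ⟨fun j => coeffs U j i, by
        exact (lp.memℓp U).norm.mono fun j => norm_coeffs_le U j i⟩
      map_add' := fun U V => rfl
      map_smul' := fun c U => rfl } 1 (fun U => by
    rw [one_mul]
    exact lp.norm_mono (by simp) fun j => norm_coeffs_le U j i)

theorem comp_apply (i : Fin 2) (U : State) (j : ℤ) : comp i U j = coeffs U j i := rfl

end SIPG

namespace SIPG
open scoped BoundedContinuousFunction InnerProductSpace

/-! ### Linear evolution equations -/

/-- Grönwall: the derivative is bounded by `‖A‖ ‖z‖`. One-sided derivatives suffice. -/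
theorem eq_zero_of_hasDerivWithinAt_clm {E : Type*} [NormedAddCommGroup E] [NormedSpace ℝ E]
    (A : E →L[ℝ] E) {z : ℝ → E} (hz : ∀ t, 0 ≤ t → HasDerivWithinAt z (A (z t)) (Ici 0) t)
    (h0 : z 0 = 0) {t : ℝ} (ht : 0 ≤ t) : z t = 0 := by
  refine eq_zero_of_abs_deriv_le_mul_abs_self_of_eq_zero_right (f' := fun t => A (z t)) (K := ‖A‖)
    (a := 0) (b := t) ?_ ?_ h0 (fun x _ => A.le_opNorm _) t ⟨ht, le_rfl⟩
  · exact fun x hx => (hz x hx.1).continuousWithinAt.mono Icc_subset_Ici_self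
  · exact fun x hx => (hz x hx.1).mono (Ici_subset_Ici.mpr hx.1)

theorem eq_exp_smul_of_hasDerivWithinAt {E : Type*} [NormedAddCommGroup E] [NormedSpace ℂ E]
    [CompleteSpace E] (A : E →L[ℂ] E) {z : ℝ → E}
    (hz : ∀ t, 0 ≤ t → HasDerivWithinAt z (A (z t)) (Ici 0) t) {t : ℝ} (ht : 0 ≤ t) :
    z t = NormedSpace.exp (t • A) (z 0) := by
  have hd : ∀ t : ℝ, HasDerivAt (fun t : ℝ => NormedSpace.exp (t • A) (z 0))
      (A (NormedSpace.exp (t • A) (z 0))) t := fun t => by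
    have h1 := hasDerivAt_exp_smul_const' (𝕂 := ℝ) A t
    exact (((ContinuousLinearMap.apply ℂ E (z 0)).restrictScalars ℝ).hasFDerivAt.comp_hasDerivAt
      t h1)
  have := eq_zero_of_hasDerivWithinAt_clm (A.restrictScalars ℝ)
    (z := fun t => z t - NormedSpace.exp (t • A) (z 0)) (fun t ht => by
      have h1 := (hz t ht).sub (hd t).hasDerivWithinAt
      rw [← map_sub] at h1
      exact h1) (by simp) ht
  exact sub_eq_zero.mp this

/-- Since `D` commutes with `S`, the pair `(D u, D v)` solves the same first-order system with zero
initial data. In the application `D = S - w²`, so that being an eigenmode propagates in time. -/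
theorem eq_zero_of_commute_wave {E : Type*} [NormedAddCommGroup E] [NormedSpace ℝ E]
    {S D : E →L[ℝ] E} (hSD : ∀ x, D (S x) = S (D x)) {u v : ℝ → E}
    (hu : ∀ t, 0 ≤ t → HasDerivWithinAt u (v t) (Ici 0) t)
    (hv : ∀ t, 0 ≤ t → HasDerivWithinAt v (-S (u t)) (Ici 0) t)
    (hu0 : D (u 0) = 0) (hv0 : D (v 0) = 0) {t : ℝ} (ht : 0 ≤ t) : D (u t) = 0 := by
  let G : E × E →L[ℝ] E × E :=
    (ContinuousLinearMap.snd ℝ E E).prod (-(S.comp (ContinuousLinearMap.fst ℝ E E)))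
  have := eq_zero_of_hasDerivWithinAt_clm G (z := fun t => (D (u t), D (v t))) (fun t ht => by
    have h1 := D.hasFDerivAt.comp_hasDerivWithinAt t (hu t ht)
    have h2 := D.hasFDerivAt.comp_hasDerivWithinAt t (hv t ht)
    have h3 := h1.prodMk h2
    rw [map_neg, hSD] at h3
    exact h3) (by simp [hu0, hv0]) ht
  exact (Prod.ext_iff.mp this).1

/-! ### Wave equations with multiplier coefficients -/

section Waves

variable {μ : Measure ℝ}

/-- The operator on `L²(μ)²` with matrix symbol `(a, b; c, d)`. -/
noncomputable def matrixOp (μ : Measure ℝ) (a b c d : ℝ →ᵇ ℂ) :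
    Lp ℂ 2 μ × Lp ℂ 2 μ →L[ℂ] Lp ℂ 2 μ × Lp ℂ 2 μ :=
  ((mulOp μ a).comp (.fst ℂ _ _) + (mulOp μ b).comp (.snd ℂ _ _)).prod
    ((mulOp μ c).comp (.fst ℂ _ _) + (mulOp μ d).comp (.snd ℂ _ _))

/-- Eigenmodes of the symbol of a wave equation evolve independently. -/
theorem wave_system_eigen {a b c d w : ℝ →ᵇ ℂ} {u₀ u₁ v₀ v₁ : ℝ → Lp ℂ 2 μ}
    (hu₀ : ∀ t, 0 ≤ t → HasDerivWithinAt u₀ (v₀ t) (Ici 0) t)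
    (hu₁ : ∀ t, 0 ≤ t → HasDerivWithinAt u₁ (v₁ t) (Ici 0) t)
    (hv₀ : ∀ t, 0 ≤ t → HasDerivWithinAt v₀ (-(a • u₀ t + b • u₁ t)) (Ici 0) t)
    (hv₁ : ∀ t, 0 ≤ t → HasDerivWithinAt v₁ (-(c • u₀ t + d • u₁ t)) (Ici 0) t)
    (iu₀ : a • u₀ 0 + b • u₁ 0 = w ^ 2 • u₀ 0) (iu₁ : c • u₀ 0 + d • u₁ 0 = w ^ 2 • u₁ 0)
    (iv₀ : a • v₀ 0 + b • v₁ 0 = w ^ 2 • v₀ 0) (iv₁ : c • v₀ 0 + d • v₁ 0 = w ^ 2 • v₁ 0)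
    {t : ℝ} (ht : 0 ≤ t) :
    a • u₀ t + b • u₁ t = w ^ 2 • u₀ t ∧ c • u₀ t + d • u₁ t = w ^ 2 • u₁ t := by
  let S := (matrixOp μ a b c d).restrictScalars ℝ
  let D := (matrixOp μ (a - w ^ 2) b c (d - w ^ 2)).restrictScalars ℝ
  have hD : ∀ x, D x = ((a - w ^ 2) • x.1 + b • x.2, c • x.1 + (d - w ^ 2) • x.2) := fun _ => rfl
  have hS : ∀ x, S x = (a • x.1 + b • x.2, c • x.1 + d • x.2) := fun _ => rfl
  have := eq_zero_of_commute_wave (S := S) (D := D) (u := fun t => (u₀ t, u₁ t))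
    (v := fun t => (v₀ t, v₁ t))
    (fun x => by
      rw [hD, hS, hS, hD]
      ext1 <;> simp only <;> module)
    (fun t ht => (hu₀ t ht).prodMk (hu₁ t ht)) (fun t ht => (hv₀ t ht).prodMk (hv₁ t ht))
    (by
      rw [hD, sub_smul, sub_smul]
      ext1
      · simp only [Prod.fst_zero]
        linear_combination (norm := module) (1 : ℝ →ᵇ ℂ) • iu₀
      · simp only [Prod.snd_zero]
        linear_combination (norm := module) (1 : ℝ →ᵇ ℂ) • iu₁)
    (by
      rw [hD, sub_smul, sub_smul]
      ext1
      · simp only [Prod.fst_zero]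
        linear_combination (norm := module) (1 : ℝ →ᵇ ℂ) • iv₀
      · simp only [Prod.snd_zero]
        linear_combination (norm := module) (1 : ℝ →ᵇ ℂ) • iv₁) ht
  rw [hD, Prod.ext_iff] at this
  obtain ⟨h1, h2⟩ := this
  simp only [Prod.fst_zero, Prod.snd_zero, sub_smul] at h1 h2
  constructor
  · linear_combination (norm := module) (1 : ℝ →ᵇ ℂ) • h1
  · linear_combination (norm := module) (1 : ℝ →ᵇ ℂ) • h2

theorem hasDerivWithinAt_bcf_smul (a : ℝ →ᵇ ℂ) {u : ℝ → Lp ℂ 2 μ} {u' : Lp ℂ 2 μ} {s : Set ℝ}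
    {t : ℝ} (hu : HasDerivWithinAt u u' s t) :
    HasDerivWithinAt (fun t => a • u t) (a • u') s t :=
  ((mulOp μ a).restrictScalars ℝ).hasFDerivAt.comp_hasDerivWithinAt t hu

/-- The factorization `∂ₜ² + w² = (∂ₜ - i w)(∂ₜ + i w)`: the combination `v + i w u` solves the
first-order equation `z' = i w z`. -/
theorem half_wave_eq {w : ℝ →ᵇ ℂ} {u v : ℝ → Lp ℂ 2 μ}
    (hu : ∀ t, 0 ≤ t → HasDerivWithinAt u (v t) (Ici 0) t)
    (hv : ∀ t, 0 ≤ t → HasDerivWithinAt v (-(w ^ 2 • u t)) (Ici 0) t) {t : ℝ} (ht : 0 ≤ t) :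
    v t + (Complex.I • w) • u t
      = NormedSpace.exp (t • (Complex.I • w)) • (v 0 + (Complex.I • w) • u 0) := by
  have hI : (Complex.I • w) * (Complex.I • w) = -w ^ 2 := by
    rw [smul_mul_smul_comm, Complex.I_mul_I, neg_one_smul, sq]
  have h := eq_exp_smul_of_hasDerivWithinAt (mulOp μ (Complex.I • w))
    (z := fun t => v t + (Complex.I • w) • u t) (fun t ht => by
      have h1 := (hv t ht).add (hasDerivWithinAt_bcf_smul (Complex.I • w) (hu t ht))
      convert! h1 using 1
      rw [mulOp_apply, smul_add, smul_smul, hI]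
      module) ht
  rw [h]
  let _ : NormedAlgebra ℚ (ℝ →ᵇ ℂ) := NormedAlgebra.restrictScalars ℚ ℂ _
  let _ : Algebra ℚ (Lp ℂ 2 μ →L[ℂ] Lp ℂ 2 μ) := Algebra.restrictScalars ℚ ℂ _
  have h2 := NormedSpace.map_exp (mulOp μ) (continuous_mulOp μ) (t • (Complex.I • w))
  have h3 : mulOp μ (t • (Complex.I • w)) = t • mulOp μ (Complex.I • w) :=
    map_real_smul (mulOp μ).toLinearMap (continuous_mulOp μ) t _
  rw [h3] at h2
  exact congrArg (fun A => A (v 0 + (Complex.I • w) • u 0)) h2.symm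

end Waves

end SIPG

namespace SIPG
open scoped BoundedContinuousFunction InnerProductSpace

/-! ### The dispersion relation, as a function of `c = cos (ξ h)` -/

/-- Half the sum of the two eigenvalues of `h² S_h^s(ξ)` is `2 (2 s + (s - 3) c)`. -/
noncomputable def dispTrace (s c : ℝ) : ℝ := 2 * s + (s - 3) * c

/-- The discriminant of the dispersion relation. -/
noncomputable def dispDisc (s c : ℝ) : ℝ :=
  dispTrace s c ^ 2 - 3 * (1 - c) * (2 * s - 1 - c)

/-- The smaller root of the dispersion relation is `2 (1 - c) * dispRatio s c`. -/
noncomputable def dispRatio (s c : ℝ) : ℝ :=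
  3 * (2 * s - 1 - c) / (dispTrace s c + Real.sqrt (dispDisc s c))

variable {s c : ℝ}

theorem dispTrace_pos (hs : 1 < s) (hc : c ∈ Icc (-1 : ℝ) 1) : 0 < dispTrace s c := by
  unfold dispTrace
  nlinarith [hc.1, hc.2, mul_nonneg (sub_nonneg.mpr hs.le) (by linarith [hc.1] : 0 ≤ c + 1)]

/-- For `s > 1` and `c ∈ [-1, 1]` both summands on the right are nonnegative, which gives the sign
of the discriminant directly. -/
theorem dispDisc_eq (s c : ℝ) : dispDisc s c
    = (2 * s - 2 + s * c - c ^ 2) ^ 2 + (1 - c) ^ 2 * ((1 + c) * (2 * s - 1 - c)) := by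
  unfold dispDisc dispTrace
  ring

theorem dispDisc_nonneg (hs : 1 < s) (hc : c ∈ Icc (-1 : ℝ) 1) : 0 ≤ dispDisc s c := by
  rw [dispDisc_eq]
  have h1 : 0 ≤ 1 + c := by linarith [hc.1]
  have h2 : 0 ≤ 2 * s - 1 - c := by linarith [hc.2]
  positivity

/-- The endpoint `c = -1` must be excluded: the discriminant there equals `(s - 3) ^ 2`, so the two
branches meet when `s = 3`. Strict positivity makes the square root smooth. -/
theorem dispDisc_pos (hs : 1 < s) (hc : c ∈ Ioc (-1 : ℝ) 1) : 0 < dispDisc s c := by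
  rw [dispDisc_eq]
  have h1 : 0 < 1 + c := by linarith [hc.1]
  have h2 : 0 < 2 * s - 1 - c := by linarith [hc.2]
  rcases eq_or_lt_of_le hc.2 with h | h
  · subst h
    have : 0 < 2 * s - 2 + s * 1 - 1 ^ 2 := by linarith
    positivity
  · have : 0 < 1 - c := by linarith
    positivity

theorem dispRatio_denom_pos (hs : 1 < s) (hc : c ∈ Icc (-1 : ℝ) 1) :
    0 < dispTrace s c + Real.sqrt (dispDisc s c) :=
  add_pos_of_pos_of_nonneg (dispTrace_pos hs hc) (Real.sqrt_nonneg _)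

theorem dispRatio_pos (hs : 1 < s) (hc : c ∈ Icc (-1 : ℝ) 1) : 0 < dispRatio s c :=
  div_pos (by linarith [hc.2]) (dispRatio_denom_pos hs hc)

/-- Rationalization of the quadratic formula. It isolates the factor `1 - c`, whose square root in
`θ` is a multiple of `sin (θ / 2)`; this keeps the phase smooth at `θ = 0`. -/
theorem dispRatio_eq (hs : 1 < s) (hc : c ∈ Icc (-1 : ℝ) 1) :
    2 * (1 - c) * dispRatio s c = 2 * dispTrace s c - 2 * Real.sqrt (dispDisc s c) := by
  have hd := (dispRatio_denom_pos hs hc).ne'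
  have hq := Real.sq_sqrt (dispDisc_nonneg hs hc)
  rw [dispRatio, mul_div_assoc', div_eq_iff hd]
  have : dispDisc s c = dispTrace s c ^ 2 - 3 * (1 - c) * (2 * s - 1 - c) := rfl
  linear_combination 2 * hq + 2 * this

theorem exists_dispRatio_bounds (hs : 1 < s) :
    ∃ m M : ℝ, 0 < m ∧ 0 < M ∧ ∀ c ∈ Icc (-1 : ℝ) 1, m ≤ dispRatio s c ∧ dispRatio s c ≤ M := by
  have hcont : ContinuousOn (dispRatio s) (Icc (-1 : ℝ) 1) := by
    unfold dispRatio
    refine ContinuousOn.div (by fun_prop) ?_ fun c hc => (dispRatio_denom_pos hs hc).ne'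
    unfold dispDisc dispTrace
    fun_prop
  have hne : (Icc (-1 : ℝ) 1).Nonempty := ⟨0, by norm_num, by norm_num⟩
  obtain ⟨a, ha, hmin⟩ := isCompact_Icc.exists_isMinOn hne hcont
  obtain ⟨b, hb, hmax⟩ := isCompact_Icc.exists_isMaxOn hne hcont
  exact ⟨dispRatio s a, dispRatio s b, dispRatio_pos hs ha, dispRatio_pos hs hb,
    fun c hc => ⟨hmin hc, hmax hc⟩⟩

/-- A monic quadratic is nonpositive only between its roots. Serves both for trial points and for
actual eigenvalues. -/
theorem smaller_root_le {x : ℝ} (hx : x ^ 2 - 4 * dispTrace s c * x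
    + 12 * (1 - c) * (2 * s - 1 - c) ≤ 0) :
    2 * dispTrace s c - 2 * Real.sqrt (dispDisc s c) ≤ x := by
  have h1 : ((2 * dispTrace s c - x) / 2) ^ 2 ≤ dispDisc s c := by
    unfold dispDisc
    linarith
  have := (Real.abs_le_sqrt h1)
  linarith [(abs_le.mp this).2]

/-- The derivative of the smaller root of the dispersion relation is negative. -/
theorem smaller_root_deriv_neg (hs : 1 < s) (hc : c ∈ Ioo (-1 : ℝ) 1) :
    0 < (s - 3) * (2 * dispTrace s c - 2 * Real.sqrt (dispDisc s c)) + 6 * (s - c) := by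
  obtain ⟨hc1, hc2⟩ := hc
  have hcI : c ∈ Icc (-1 : ℝ) 1 := ⟨hc1.le, hc2.le⟩
  set l := 2 * dispTrace s c - 2 * Real.sqrt (dispDisc s c) with hl
  have hl0 : 0 ≤ l := by
    rw [hl, ← dispRatio_eq hs hcI]
    have := dispRatio_pos hs hcI
    have : 0 ≤ 1 - c := by linarith
    positivity
  rcases le_or_gt 3 s with h3 | h3
  · have : 0 ≤ (s - 3) * l := mul_nonneg (by linarith) hl0
    linarith
  -- For `s < 3` an upper bound on `l` is needed. The two trial points are the Rayleigh quotients
  -- `h² R₁₁ / M₁₁` and `h² R₂₂ / M₂₂` of the coordinate vectors. The first one yields, after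
  -- multiplication by `2 + c`, six times exactly the quantity tested here.
  by_cases h : 0 < 3 * (s - 1) + c * (1 - c)
  · have hp : 0 < 2 + c := by linarith
    have hx : l ≤ 6 * (1 - c) / (2 + c) := smaller_root_le (by
      have : (6 * (1 - c) / (2 + c)) ^ 2 - 4 * dispTrace s c * (6 * (1 - c) / (2 + c))
          + 12 * (1 - c) * (2 * s - 1 - c)
          = -((6 * (1 - c) / (2 + c)) ^ 2 * ((1 - c) * (1 + c)) / 3) := by
        unfold dispTrace
        field_simp
        ring
      rw [this, neg_nonpos]
      have : 0 ≤ (1 - c) * (1 + c) := mul_nonneg (by linarith) (by linarith)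
      positivity)
    rw [le_div_iff₀ hp] at hx
    have h4 : 0 < ((s - 3) * l + 6 * (s - c)) * (2 + c) := by
      nlinarith [mul_le_mul_of_nonneg_left hx (by linarith : 0 ≤ 3 - s)]
    exact (mul_pos_iff_of_pos_right hp).mp h4
  · have hp : 0 < 2 - c := by linarith
    have hx : l ≤ 6 * (2 * s - 1 - c) / (2 - c) := smaller_root_le (by
      have : (6 * (2 * s - 1 - c) / (2 - c)) ^ 2
          - 4 * dispTrace s c * (6 * (2 * s - 1 - c) / (2 - c)) + 12 * (1 - c) * (2 * s - 1 - c)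
          = -((6 * (2 * s - 1 - c) / (2 - c)) ^ 2 * ((1 - c) * (1 + c)) / 3) := by
        unfold dispTrace
        field_simp
        ring
      rw [this, neg_nonpos]
      have : 0 ≤ (1 - c) * (1 + c) := mul_nonneg (by linarith) (by linarith)
      positivity)
    rw [le_div_iff₀ hp] at hx
    -- When the test fails, `c² ≥ 3 (s - 1) + c`; inserting this leaves at least `12 (s - 1)(s -
    -- c)`, which is positive.
    have h5 : 0 < (s - 1) * (1 - c) := mul_pos (by linarith) (by linarith)
    have h4 : 0 < ((s - 3) * l + 6 * (s - c)) * (2 - c) := by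
      nlinarith [mul_le_mul_of_nonneg_left hx (by linarith : 0 ≤ 3 - s), sq_nonneg (s - 1)]
    exact (mul_pos_iff_of_pos_right hp).mp h4

/-- The derivative is minus the expression of `smaller_root_deriv_neg` divided by the square root of
the discriminant. -/
theorem hasDerivAt_smaller_root (hs : 1 < s) (hc : c ∈ Ioo (-1 : ℝ) 1) :
    ∃ d < 0, HasDerivAt
      (fun c => 2 * dispTrace s c - 2 * Real.sqrt (dispDisc s c)) d c := by
  have hD := dispDisc_pos hs ⟨hc.1, hc.2.le⟩
  have hq := Real.sqrt_pos.mpr hD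
  have hB : HasDerivAt (dispTrace s) (s - 3) c := by
    have h1 := ((hasDerivAt_id c).const_mul (s - 3)).const_add (2 * s)
    rw [mul_one] at h1
    exact h1
  have hE : HasDerivAt (dispDisc s) (2 * dispTrace s c * (s - 3) + 6 * (s - c)) c := by
    have h1 := (hB.pow 2).sub ((((hasDerivAt_id c).const_sub 1).const_mul 3).mul
      ((hasDerivAt_id c).const_sub (2 * s - 1)))
    convert! h1 using 1
    simp
    ring
  refine ⟨_, ?_, (hB.const_mul 2).sub ((hE.sqrt hD.ne').const_mul 2)⟩
  have := smaller_root_deriv_neg hs hc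
  rw [mul_div_assoc', mul_div_mul_left _ _ two_ne_zero, sub_neg, lt_div_iff₀ hq]
  linarith

/-! ### The phase -/

/-- The signed square root of the smaller root of the dispersion relation at `c = cos θ`. -/
noncomputable def phase (s θ : ℝ) : ℝ := 2 * Real.sin (θ / 2) * Real.sqrt (dispRatio s (Real.cos θ))

theorem two_mul_sin_half_sq (θ : ℝ) : 4 * Real.sin (θ / 2) ^ 2 = 2 * (1 - Real.cos θ) := by
  rw [Real.sin_sq_eq_half_sub, mul_div_cancel₀ _ two_ne_zero]
  ring

theorem phase_sq (hs : 1 < s) (θ : ℝ) : phase s θ ^ 2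
    = 2 * dispTrace s (Real.cos θ) - 2 * Real.sqrt (dispDisc s (Real.cos θ)) := by
  rw [← dispRatio_eq hs (Real.cos_mem_Icc θ), phase, mul_pow, mul_pow,
    Real.sq_sqrt (dispRatio_pos hs (Real.cos_mem_Icc θ)).le, ← two_mul_sin_half_sq]
  ring

theorem continuous_dispRatio_cos (hs : 1 < s) : Continuous fun θ => dispRatio s (Real.cos θ) := by
  unfold dispRatio
  refine Continuous.div (by fun_prop) ?_ fun θ =>
    (dispRatio_denom_pos hs (Real.cos_mem_Icc θ)).ne'
  unfold dispDisc dispTrace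
  fun_prop

theorem continuous_phase (hs : 1 < s) : Continuous (phase s) := by
  have := continuous_dispRatio_cos hs
  unfold phase
  fun_prop

theorem neg_one_lt_cos {θ : ℝ} (hθ : θ ∈ Ioo (-Real.pi) Real.pi) : -1 < Real.cos θ := by
  have h1 : |θ| < Real.pi := abs_lt.mpr hθ
  have := Real.cos_lt_cos_of_nonneg_of_le_pi (abs_nonneg θ) le_rfl h1
  rwa [Real.cos_pi, Real.cos_abs] at this

theorem contDiffAt_sqrt_dispRatio_cos (hs : 1 < s) {θ : ℝ} (hθ : θ ∈ Ioo (-Real.pi) Real.pi) :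
    ContDiffAt ℝ 1 (fun θ => Real.sqrt (dispRatio s (Real.cos θ))) θ := by
  have hD := dispDisc_pos hs ⟨neg_one_lt_cos hθ, Real.cos_le_one θ⟩
  refine ContDiffAt.sqrt ?_ (dispRatio_pos hs (Real.cos_mem_Icc θ)).ne'
  unfold dispRatio
  refine ContDiffAt.div (by fun_prop) ?_ (dispRatio_denom_pos hs (Real.cos_mem_Icc θ)).ne'
  refine ContDiffAt.add (by unfold dispTrace; fun_prop) (ContDiffAt.sqrt ?_ hD.ne')
  unfold dispDisc dispTrace
  fun_prop

theorem contDiffAt_phase (hs : 1 < s) {θ : ℝ} (hθ : θ ∈ Ioo (-Real.pi) Real.pi) :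
    ContDiffAt ℝ 1 (phase s) θ := by
  unfold phase
  exact ContDiffAt.mul (by fun_prop) (contDiffAt_sqrt_dispRatio_cos hs hθ)

/-- Away from zero, differentiating `phase²` as the smaller root at `cos θ` and cancelling `2 sin (θ
/ 2)` leaves `2 √ρ · phase' = -d cos (θ / 2)`, where `ρ` is `dispRatio` and `d < 0` the derivative
of the root. At `θ = 0` the cancellation is impossible and the product rule is used instead. -/
theorem deriv_phase_pos (hs : 1 < s) {θ : ℝ} (hθ : θ ∈ Ioo (-Real.pi) Real.pi) :
    0 < deriv (phase s) θ := by
  have hd := ((contDiffAt_phase hs hθ).differentiableAt one_ne_zero).hasDerivAt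
  have hρ : ∀ θ, 0 < Real.sqrt (dispRatio s (Real.cos θ)) := fun θ =>
    Real.sqrt_pos.mpr (dispRatio_pos hs (Real.cos_mem_Icc θ))
  by_cases h0 : θ = 0
  · subst h0
    have h1 := ((contDiffAt_sqrt_dispRatio_cos hs hθ).differentiableAt one_ne_zero).hasDerivAt
    have h2 : HasDerivAt (fun θ : ℝ => 2 * Real.sin (θ / 2)) 1 0 := by
      have := (((hasDerivAt_id (0 : ℝ)).div_const 2).sin).const_mul 2
      simpa using this
    have h3 := (h2.mul h1).deriv
    have h4 : deriv (phase s) 0 = Real.sqrt (dispRatio s (Real.cos 0)) := by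
      refine Eq.trans ?_ (h3.trans ?_)
      · rfl
      · simp
    rw [h4]
    exact hρ 0
  · have hc : Real.cos θ ∈ Ioo (-1 : ℝ) 1 := by
      refine ⟨neg_one_lt_cos hθ, lt_of_le_of_ne (Real.cos_le_one θ) fun h => h0 ?_⟩
      exact (Real.cos_eq_one_iff_of_lt_of_lt (by linarith [hθ.1, Real.pi_pos])
        (by linarith [hθ.2, Real.pi_pos])).mp h
    obtain ⟨d, hd0, hl⟩ := hasDerivAt_smaller_root hs hc
    have h1 := hl.comp θ (Real.hasDerivAt_cos θ)
    have h2 : HasDerivAt (fun θ => phase s θ ^ 2) (d * -Real.sin θ) θ := by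
      have e : (fun θ => phase s θ ^ 2) = (fun c => 2 * dispTrace s c
          - 2 * Real.sqrt (dispDisc s c)) ∘ Real.cos := funext fun θ => phase_sq hs θ
      rw [e]
      exact h1
    have h3 := (hd.pow 2).unique h2
    have hsin : Real.sin θ = 2 * Real.sin (θ / 2) * Real.cos (θ / 2) := by
      rw [← Real.sin_two_mul, mul_div_cancel₀ _ two_ne_zero]
    have hcos : 0 < Real.cos (θ / 2) :=
      Real.cos_pos_of_mem_Ioo ⟨by linarith [hθ.1], by linarith [hθ.2]⟩
    have hsn : Real.sin (θ / 2) ≠ 0 := fun h => by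
      rw [h, mul_zero, zero_mul] at hsin
      have := (Real.sin_eq_zero_iff_of_lt_of_lt (x := θ) hθ.1 hθ.2).mp hsin
      exact h0 this
    have h4 : 2 * Real.sin (θ / 2) * (2 * Real.sqrt (dispRatio s (Real.cos θ)) *
        deriv (phase s) θ) = 2 * Real.sin (θ / 2) * (-d * Real.cos (θ / 2)) := by
      rw [hsin] at h3
      simp only [phase] at h3 ⊢
      norm_num at h3
      linarith
    have h5 := mul_left_cancel₀ (mul_ne_zero two_ne_zero hsn) h4
    have h6 : 0 < -d * Real.cos (θ / 2) := mul_pos (by linarith) hcos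
    rw [← h5] at h6
    exact (mul_pos_iff_of_pos_left (mul_pos two_pos (hρ θ))).mp h6

/-- The group velocity is bounded from below for filtered frequencies. -/
theorem exists_phase_expanding (hs : 1 < s) {δ : ℝ} (hδ₀ : 0 < δ) (hδ₁ : δ < 1) :
    ∃ κ > 0, ∀ θ ∈ Icc (-(Real.pi * δ)) (Real.pi * δ), ∀ η ∈ Icc (-(Real.pi * δ)) (Real.pi * δ),
      κ * |θ - η| ≤ |phase s θ - phase s η| := by
  have hpi := Real.pi_pos
  have hlt : Real.pi * δ < Real.pi := by nlinarith
  have hpos : 0 < Real.pi * δ := by positivity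
  have hsub : Icc (-(Real.pi * δ)) (Real.pi * δ) ⊆ Ioo (-Real.pi) Real.pi := fun θ hθ =>
    ⟨by linarith [hθ.1], by linarith [hθ.2]⟩
  have hcd : ContDiffOn ℝ 1 (phase s) (Ioo (-Real.pi) Real.pi) := fun θ hθ =>
    (contDiffAt_phase hs hθ).contDiffWithinAt
  have hcont := (hcd.continuousOn_deriv_of_isOpen isOpen_Ioo le_rfl).mono hsub
  -- Since `δ < 1`, the compact interval stays inside the open one where the derivative is
  -- continuous and positive.
  obtain ⟨a, ha, hmin⟩ := isCompact_Icc.exists_isMinOn ⟨0, by linarith, by linarith⟩ hcont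
  refine ⟨deriv (phase s) a, deriv_phase_pos hs (hsub ha), ?_⟩
  have key := (convex_Icc (-(Real.pi * δ)) (Real.pi * δ)).mul_sub_le_image_sub_of_le_deriv
    (f := phase s) (C := deriv (phase s) a) (continuous_phase hs).continuousOn
    (fun θ hθ => ((contDiffAt_phase hs (hsub (interior_subset hθ))).differentiableAt
      one_ne_zero).differentiableWithinAt)
    (fun θ hθ => hmin (interior_subset hθ))
  intro θ hθ η hη
  rcases le_total θ η with h | h
  · rw [abs_sub_comm, abs_of_nonneg (sub_nonneg.mpr h), abs_sub_comm]
    exact (key θ hθ η hη h).trans (le_abs_self _)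
  · rw [abs_of_nonneg (sub_nonneg.mpr h)]
    exact (key η hη θ hθ h).trans (le_abs_self _)

/-! ### The physical eigenvalue -/

theorem mulVec_inv_mul_eq_smul_iff {n : Type*} [Fintype n] [DecidableEq n]
    {M R : Matrix n n ℂ} (hM : IsUnit M.det) (Λ : ℂ) (v : n → ℂ) :
    (M⁻¹ * R) *ᵥ v = Λ • v ↔ R *ᵥ v = Λ • M *ᵥ v := by
  constructor
  · intro h
    rw [← Matrix.mulVec_smul, ← h, Matrix.mulVec_mulVec, ← mul_assoc,
      Matrix.mul_nonsing_inv M hM, one_mul]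
  · intro h
    rw [← Matrix.mulVec_mulVec, h, Matrix.mulVec_smul, Matrix.mulVec_mulVec,
      Matrix.nonsing_inv_mul M hM, Matrix.one_mulVec]

/-- The determinant does not depend on the frequency, so the inverse mass symbol is 12 times its
adjugate, again a trigonometric polynomial. -/
theorem det_massSymbol (h ξ : ℝ) : (massSymbol h ξ).det = 1 / 12 := by
  rw [massSymbol, Matrix.det_fin_two_of]
  have h1 : ((Real.sin (ξ * h) : ℝ) : ℂ) ^ 2 + (Real.cos (ξ * h) : ℝ) ^ 2 = 1 := by
    exact_mod_cast Real.sin_sq_add_cos_sq (ξ * h)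
  push_cast at h1 ⊢
  linear_combination (-1 / 36 : ℂ) * h1 + (Complex.sin (ξ * h)) ^ 2 / 36 * Complex.I_sq

theorem isUnit_det_massSymbol (h ξ : ℝ) : IsUnit (massSymbol h ξ).det := by
  rw [det_massSymbol]
  exact IsUnit.mk0 _ (by norm_num)

/-- Eigenvalues are the zeros of `det (R - Λ M)`; multiplied by `12 h⁴` this becomes a quadratic in
`h² Λ` depending on `ξ h` only through its cosine. -/
theorem hasEigenvalue_waveSymbol_iff {h : ℝ} (hh : 0 < h) (s ξ Λ : ℝ) :
    Module.End.HasEigenvalue (Matrix.toLin' (waveSymbol h s ξ)) (Λ : ℂ) ↔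
      (h ^ 2 * Λ) ^ 2 - 4 * dispTrace s (Real.cos (ξ * h)) * (h ^ 2 * Λ)
        + 12 * (1 - Real.cos (ξ * h)) * (2 * s - 1 - Real.cos (ξ * h)) = 0 := by
  have h1 : Module.End.HasEigenvalue (Matrix.toLin' (waveSymbol h s ξ)) (Λ : ℂ) ↔
      ∃ v ≠ 0, (stiffSymbol h s ξ - (Λ : ℂ) • massSymbol h ξ) *ᵥ v = 0 := by
    have e : ∀ v, (stiffSymbol h s ξ - (Λ : ℂ) • massSymbol h ξ) *ᵥ v = 0 ↔
        Matrix.toLin' (waveSymbol h s ξ) v = (Λ : ℂ) • v := fun v => by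
      rw [Matrix.toLin'_apply, waveSymbol,
        mulVec_inv_mul_eq_smul_iff (isUnit_det_massSymbol h ξ), Matrix.sub_mulVec,
        Matrix.smul_mulVec, sub_eq_zero]
    constructor
    · intro H
      obtain ⟨v, hv⟩ := H.exists_hasEigenvector
      exact ⟨v, hv.2, (e v).mpr hv.apply_eq_smul⟩
    · rintro ⟨v, hv0, hv⟩
      exact Module.End.hasEigenvalue_of_hasEigenvector (x := v)
        (Module.End.hasEigenvector_iff.mpr ⟨Module.End.mem_eigenspace_iff.mpr ((e v).mp hv), hv0⟩)
  rw [h1, Matrix.exists_mulVec_eq_zero_iff]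
  have h2 : (stiffSymbol h s ξ - (Λ : ℂ) • massSymbol h ξ).det
      = (((4 / h ^ 2 * Real.sin (ξ * h / 2) ^ 2 - Λ * ((2 + Real.cos (ξ * h)) / 3)) *
        ((s - Real.cos (ξ * h / 2) ^ 2) / h ^ 2 - Λ * ((2 - Real.cos (ξ * h)) / 12))
        - Λ ^ 2 * Real.sin (ξ * h) ^ 2 / 36 : ℝ) : ℂ) := by
    rw [Matrix.det_fin_two]
    simp only [stiffSymbol, massSymbol, Matrix.sub_apply, Matrix.smul_apply, Matrix.of_apply,
      Matrix.cons_val', Matrix.cons_val_zero, Matrix.cons_val_one, Matrix.cons_val_fin_one,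
      smul_eq_mul]
    push_cast
    linear_combination ((Λ : ℂ) ^ 2 * Complex.sin (ξ * h) ^ 2 / 36) * Complex.I_sq
  rw [h2, Complex.ofReal_eq_zero]
  have e1 := Real.sin_sq_add_cos_sq (ξ * h)
  have e2 : Real.sin (ξ * h / 2) ^ 2 = (1 - Real.cos (ξ * h)) / 2 := by
    linarith [two_mul_sin_half_sq (ξ * h)]
  have e3 : Real.cos (ξ * h / 2) ^ 2 = (1 + Real.cos (ξ * h)) / 2 := by
    linarith [Real.sin_sq_add_cos_sq (ξ * h / 2)]
  have e4 : Real.sin (ξ * h) ^ 2 = 1 - Real.cos (ξ * h) ^ 2 := by linarith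
  rw [e2, e3, e4]
  generalize Real.cos (ξ * h) = c
  have e5 : (4 / h ^ 2 * ((1 - c) / 2) - Λ * ((2 + c) / 3)) *
        ((s - (1 + c) / 2) / h ^ 2 - Λ * ((2 - c) / 12)) - Λ ^ 2 * (1 - c ^ 2) / 36
      = ((h ^ 2 * Λ) ^ 2 - 4 * dispTrace s c * (h ^ 2 * Λ)
        + 12 * (1 - c) * (2 * s - 1 - c)) / (12 * h ^ 4) := by
    unfold dispTrace
    field_simp
    ring
  rw [e5, div_eq_zero_iff]
  simp [hh.ne']

/-- The infimum is attained: the smaller root is an eigenvalue, and `smaller_root_le` bounds every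
other one from below. -/
theorem physEigenvalue_eq {h : ℝ} (hh : 0 < h) (hs : 1 < s) (ξ : ℝ) :
    physEigenvalue h s ξ = (phase s (ξ * h) / h) ^ 2 := by
  have hD := Real.sq_sqrt (dispDisc_nonneg hs (Real.cos_mem_Icc (ξ * h)))
  have hp := phase_sq hs (ξ * h)
  have hne : h ^ 2 ≠ 0 := by positivity
  have e : ∀ Λ : ℝ, (h ^ 2 * Λ) ^ 2 - 4 * dispTrace s (Real.cos (ξ * h)) * (h ^ 2 * Λ)
        + 12 * (1 - Real.cos (ξ * h)) * (2 * s - 1 - Real.cos (ξ * h))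
      = (h ^ 2 * Λ - 2 * dispTrace s (Real.cos (ξ * h))) ^ 2
        - 4 * dispDisc s (Real.cos (ξ * h)) := fun Λ => by
    unfold dispDisc
    ring
  have hm : h ^ 2 * (phase s (ξ * h) / h) ^ 2 = phase s (ξ * h) ^ 2 := by
    field_simp
  refine IsLeast.csInf_eq ⟨?_, fun Λ hΛ => ?_⟩
  · rw [mem_ofPred_eq, hasEigenvalue_waveSymbol_iff hh, e, hm, hp]
    linear_combination 4 * hD
  · rw [mem_ofPred_eq, hasEigenvalue_waveSymbol_iff hh] at hΛ
    have := smaller_root_le hΛ.le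
    rw [← hp, ← hm] at this
    exact le_of_mul_le_mul_left this (by positivity)

theorem stiffSymbol_mulVec_eigenvector {h : ℝ} (hh : 0 < h) (hs : 1 < s) {P : ℝ → Fin 2 → ℂ}
    (hP : IsPhysEigenvector h s P) {ξ : ℝ} (hξ : ξ ∈ freqInterval h 1) :
    stiffSymbol h s ξ *ᵥ P ξ
      = (((phase s (ξ * h) / h) ^ 2 : ℝ) : ℂ) • massSymbol h ξ *ᵥ P ξ := by
  have h1 := (hP ξ hξ).apply_eq_smul
  rw [Matrix.toLin'_apply, waveSymbol, physEigenvalue_eq hh hs,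
    mulVec_inv_mul_eq_smul_iff (isUnit_det_massSymbol h ξ)] at h1
  exact h1

end SIPG

namespace SIPG
open scoped BoundedContinuousFunction InnerProductSpace

/-! ### Symbols as multipliers -/

/-- The upper diagonal entry of the symbol of the mass matrix. -/
noncomputable def mulM₁₁ (h : ℝ) : ℝ →ᵇ ℂ := (1 / 6 : ℂ) • (wave h 1 + wave h (-1)) + (2 / 3 : ℂ) • 1

/-- The upper off-diagonal entry of the symbol of the mass matrix. -/
noncomputable def mulM₁₂ (h : ℝ) : ℝ →ᵇ ℂ := (1 / 12 : ℂ) • (wave h 1 - wave h (-1))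

/-- The lower diagonal entry of the symbol of the mass matrix. -/
noncomputable def mulM₂₂ (h : ℝ) : ℝ →ᵇ ℂ := (1 / 6 : ℂ) • 1 - (1 / 24 : ℂ) • (wave h 1 + wave h (-1))

/-- The upper diagonal entry of the symbol of the stiffness matrix. -/
noncomputable def mulR₁₁ (h : ℝ) : ℝ →ᵇ ℂ :=
  (1 / (h : ℂ) ^ 2) • ((2 : ℂ) • 1 - (wave h 1 + wave h (-1)))

/-- The lower diagonal entry of the symbol of the stiffness matrix. -/
noncomputable def mulR₂₂ (h s : ℝ) : ℝ →ᵇ ℂ :=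
  (1 / (h : ℂ) ^ 2) • (((2 * s - 1) / 2 : ℂ) • 1 - (1 / 4 : ℂ) • (wave h 1 + wave h (-1)))

theorem wave_one_mul_wave_neg_one (h : ℝ) : wave h 1 * wave h (-1) = 1 := by
  rw [wave_mul]
  exact wave_zero h

/-- The plus sign comes from the lower left entry of the mass symbol being `-mulM₁₂`. -/
theorem mulM_det (h : ℝ) :
    12 * (mulM₁₁ h * mulM₂₂ h + mulM₁₂ h * mulM₁₂ h) = 1 := by
  ext ξ
  have := congrArg (fun a : ℝ →ᵇ ℂ => a ξ) (wave_one_mul_wave_neg_one h)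
  simp only [BoundedContinuousFunction.mul_apply, BoundedContinuousFunction.coe_one,
    Pi.one_apply] at this
  have h12 : (12 : ℝ →ᵇ ℂ) ξ = 12 := rfl
  simp only [mulM₁₁, mulM₁₂, mulM₂₂, BoundedContinuousFunction.mul_apply,
    BoundedContinuousFunction.add_apply, BoundedContinuousFunction.sub_apply,
    BoundedContinuousFunction.smul_apply, BoundedContinuousFunction.coe_one, Pi.one_apply,
    smul_eq_mul, h12]
  linear_combination (-1 / 3 : ℂ) * this

theorem wave_one_apply (h ξ : ℝ) :
    wave h 1 ξ = Real.cos (ξ * h) + Complex.I * Real.sin (ξ * h) := by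
  rw [wave_apply, mul_comm, Complex.exp_mul_I]
  push_cast
  rw [one_mul]
  ring

theorem wave_neg_one_apply (h ξ : ℝ) :
    wave h (-1) ξ = Real.cos (ξ * h) - Complex.I * Real.sin (ξ * h) := by
  rw [wave_apply, mul_comm, Complex.exp_mul_I]
  push_cast
  rw [neg_one_mul, Complex.cos_neg, Complex.sin_neg]
  ring

theorem mulM₁₁_apply (h ξ : ℝ) : mulM₁₁ h ξ = massSymbol h ξ 0 0 := by
  simp [mulM₁₁, massSymbol, wave_one_apply, wave_neg_one_apply]
  ring

theorem mulM₁₂_apply (h ξ : ℝ) : mulM₁₂ h ξ = massSymbol h ξ 0 1 := by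
  simp [mulM₁₂, massSymbol, wave_one_apply, wave_neg_one_apply]
  ring

theorem mulM₁₂_apply' (h ξ : ℝ) : -mulM₁₂ h ξ = massSymbol h ξ 1 0 := by
  simp [mulM₁₂, massSymbol, wave_one_apply, wave_neg_one_apply]
  ring

theorem mulM₂₂_apply (h ξ : ℝ) : mulM₂₂ h ξ = massSymbol h ξ 1 1 := by
  simp [mulM₂₂, massSymbol, wave_one_apply, wave_neg_one_apply]
  ring

theorem mulR₁₁_apply (h s ξ : ℝ) : mulR₁₁ h ξ = stiffSymbol h s ξ 0 0 := by
  have e2 : (Real.sin (ξ * h / 2) : ℂ) ^ 2 = (1 - Real.cos (ξ * h)) / 2 := by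
    exact_mod_cast (by linarith [two_mul_sin_half_sq (ξ * h)] :
      Real.sin (ξ * h / 2) ^ 2 = (1 - Real.cos (ξ * h)) / 2)
  simp [mulR₁₁, stiffSymbol, wave_one_apply, wave_neg_one_apply] at e2 ⊢
  rw [e2]
  ring

theorem cos_half_sq (θ : ℝ) : Real.cos (θ / 2) ^ 2 = (1 + Real.cos θ) / 2 := by
  linarith [two_mul_sin_half_sq θ, Real.sin_sq_add_cos_sq (θ / 2)]

theorem mulR₂₂_apply (h s ξ : ℝ) : mulR₂₂ h s ξ = stiffSymbol h s ξ 1 1 := by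
  have e2 : (Real.cos (ξ * h / 2) : ℂ) ^ 2 = (1 + Real.cos (ξ * h)) / 2 := by
    exact_mod_cast cos_half_sq (ξ * h)
  simp [mulR₂₂, stiffSymbol, wave_one_apply, wave_neg_one_apply] at e2 ⊢
  rw [e2]
  ring

/-! ### The Fourier transform of a state -/

/-- The Fourier transform of a component of a state. -/
noncomputable def hat {h : ℝ} (hh : 0 < h) (i : Fin 2) : State →L[ℂ] FreqSpace h :=
  (fourierOp hh).comp (comp i)

theorem hat_apply {h : ℝ} (hh : 0 < h) (i : Fin 2) (U : State) :
    hat hh i U = fourierOp hh (comp i U) := rfl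

theorem hasDerivWithinAt_hat {h : ℝ} (hh : 0 < h) (i : Fin 2) {U : ℝ → State} {V : State}
    {S : Set ℝ} {t : ℝ} (hU : HasDerivWithinAt U V S t) :
    HasDerivWithinAt (fun t => hat hh i (U t)) (hat hh i V) S t :=
  ((hat hh i).restrictScalars ℝ).hasFDerivAt.comp_hasDerivWithinAt t hU

/-! ### The mass and stiffness matrices under the Fourier transform -/

theorem seq_add_apply (f g : Seq) (j : ℤ) : (f + g) j = f j + g j := rfl

theorem seq_sub_apply (f g : Seq) (j : ℤ) : (f - g) j = f j - g j := rfl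

theorem seq_smul_apply (c : ℂ) (f : Seq) (j : ℤ) : (c • f) j = c * f j := rfl

/-- The mass matrix applied to a pair of sequences. -/
noncomputable def massSeq (h : ℝ) (U : State) : Fin 2 → Seq :=
  ![(h : ℂ) • ((1 / 6 : ℂ) • (shift 1 (comp 0 U) + shift (-1) (comp 0 U)) + (2 / 3 : ℂ) • comp 0 U
      + (1 / 12 : ℂ) • (shift 1 (comp 1 U) - shift (-1) (comp 1 U))),
    (h : ℂ) • ((1 / 6 : ℂ) • comp 1 U
      - (1 / 24 : ℂ) • (shift 1 (comp 1 U) + shift (-1) (comp 1 U))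
      - (1 / 12 : ℂ) • (shift 1 (comp 0 U) - shift (-1) (comp 0 U)))]

theorem massOp_coeffs (h : ℝ) (U : State) (i : Fin 2) (j : ℤ) :
    massOp h (coeffs U) j i = massSeq h U i j := by
  revert i
  refine Fin.forall_fin_two.mpr ⟨?_, ?_⟩
  all_goals
    simp only [massSeq, Matrix.cons_val_zero, Matrix.cons_val_one, seq_add_apply, seq_sub_apply,
      seq_smul_apply, shift_apply, comp_apply]
    simp [massOp, stencilApply, dotProduct, Fin.sum_univ_two, sub_eq_add_neg]
    ring

/-- The stiffness matrix applied to a pair of sequences. -/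
noncomputable def stiffSeq (h s : ℝ) (U : State) : Fin 2 → Seq :=
  ![(1 / (h : ℂ)) • ((2 : ℂ) • comp 0 U - (shift 1 (comp 0 U) + shift (-1) (comp 0 U))),
    (1 / (h : ℂ)) • (((2 * s - 1) / 2 : ℂ) • comp 1 U
      - (1 / 4 : ℂ) • (shift 1 (comp 1 U) + shift (-1) (comp 1 U)))]

theorem stiffOp_coeffs (h s : ℝ) (U : State) (i : Fin 2) (j : ℤ) :
    stiffOp h s (coeffs U) j i = stiffSeq h s U i j := by
  revert i
  refine Fin.forall_fin_two.mpr ⟨?_, ?_⟩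
  all_goals
    simp only [stiffSeq, Matrix.cons_val_zero, Matrix.cons_val_one, seq_add_apply, seq_sub_apply,
      seq_smul_apply, shift_apply, comp_apply]
    simp [stiffOp, stencilApply, dotProduct, Fin.sum_univ_two, sub_eq_add_neg]
    ring

/-- The factor `h` is the ratio of the stencils to their symbols. It is the same for the stiffness
matrix and drops out of the wave equation. -/
theorem fourierOp_massSeq {h : ℝ} (hh : 0 < h) (U : State) :
    fourierOp hh (massSeq h U 0) = (h : ℂ) • (mulM₁₁ h • hat hh 0 U + mulM₁₂ h • hat hh 1 U) ∧
    fourierOp hh (massSeq h U 1)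
      = (h : ℂ) • (-mulM₁₂ h • hat hh 0 U + mulM₂₂ h • hat hh 1 U) := by
  simp only [massSeq, Matrix.cons_val_zero, Matrix.cons_val_one, map_add, map_sub, map_smul,
    fourierOp_shift, ← hat_apply, mulM₁₁, mulM₁₂, mulM₂₂, add_smul, sub_smul, smul_assoc, one_smul,
    neg_smul]
  refine ⟨trivial, ?_⟩
  congr 1
  module

theorem fourierOp_stiffSeq {h : ℝ} (hh : 0 < h) (s : ℝ) (U : State) :
    fourierOp hh (stiffSeq h s U 0) = (h : ℂ) • (mulR₁₁ h • hat hh 0 U) ∧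
    fourierOp hh (stiffSeq h s U 1) = (h : ℂ) • (mulR₂₂ h s • hat hh 1 U) := by
  have hne : (h : ℂ) ≠ 0 := by exact_mod_cast hh.ne'
  have e : (h : ℂ) * (1 / (h : ℂ) ^ 2) = 1 / h := by field_simp
  simp only [stiffSeq, Matrix.cons_val_zero, Matrix.cons_val_one, map_add, map_sub, map_smul,
    fourierOp_shift, ← hat_apply, mulR₁₁, mulR₂₂, add_smul, sub_smul, smul_assoc, one_smul]
  rw [smul_smul, smul_smul, e]
  exact ⟨rfl, rfl⟩

/-- The wave equation on the Fourier side. -/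
theorem hat_wave {h : ℝ} (hh : 0 < h) {s : ℝ} {U W : State}
    (H : ∀ j : ℤ, massOp h (coeffs W) j + stiffOp h s (coeffs U) j = 0) :
    hat hh 0 W = -((12 * mulM₂₂ h * mulR₁₁ h) • hat hh 0 U
      + (-12 * mulM₁₂ h * mulR₂₂ h s) • hat hh 1 U) ∧
    hat hh 1 W = -((12 * mulM₁₂ h * mulR₁₁ h) • hat hh 0 U
      + (12 * mulM₁₁ h * mulR₂₂ h s) • hat hh 1 U) := by
  have hne : (h : ℂ) ≠ 0 := by exact_mod_cast hh.ne'
  have H' : ∀ i, massSeq h W i + stiffSeq h s U i = 0 := fun i => by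
    ext j
    have := congrFun (H j) i
    rw [Pi.add_apply, massOp_coeffs, stiffOp_coeffs] at this
    exact this
  have h0 := congrArg (fourierOp hh) (H' 0)
  have h1 := congrArg (fourierOp hh) (H' 1)
  rw [map_add, map_zero, (fourierOp_massSeq hh W).1, (fourierOp_stiffSeq hh s U).1, ← smul_add,
    smul_eq_zero_iff_right hne] at h0
  rw [map_add, map_zero, (fourierOp_massSeq hh W).2, (fourierOp_stiffSeq hh s U).2, ← smul_add,
    smul_eq_zero_iff_right hne] at h1
  have hd := mulM_det h
  constructor
  · have e : hat hh 0 W = (12 * (mulM₁₁ h * mulM₂₂ h + mulM₁₂ h * mulM₁₂ h)) • hat hh 0 W := by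
      rw [hd, one_smul]
    rw [e]
    -- Cramer's rule: the coefficients are the rows of 12 times the adjugate of the mass symbol.
    linear_combination (norm := module) (12 * mulM₂₂ h) • h0 - (12 * mulM₁₂ h) • h1
  · have e : hat hh 1 W = (12 * (mulM₁₁ h * mulM₂₂ h + mulM₁₂ h * mulM₁₂ h)) • hat hh 1 W := by
      rw [hd, one_smul]
    rw [e]
    linear_combination (norm := module) (12 * mulM₁₂ h) • h0 + (12 * mulM₁₁ h) • h1

/-! ### Physical data and solutions on the Fourier side -/

theorem hat_ae_eq {h : ℝ} (hh : 0 < h) {P : ℝ → Fin 2 → ℂ} {U : State} {u : Seq}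
    (hU : IsPhysData h P U u) (i : Fin 2) :
    ∀ᵐ ξ ∂(freqMeasure h), hat hh i U ξ = P ξ i * sdft h u ξ := by
  have := hU i
  rwa [show (fun j => coeffs U j i) = comp i U from rfl, sdft_eq_fourierOp hh] at this

/-- Physical data are eigenmodes of the stiffness symbol with respect to the mass symbol. -/
theorem hat_physData {h : ℝ} (hh : 0 < h) {s : ℝ} (hs : 1 < s) {P : ℝ → Fin 2 → ℂ}
    (hP : IsPhysEigenvector h s P) {w : ℝ →ᵇ ℂ} (hw : ∀ ξ, w ξ = ((phase s (ξ * h) / h : ℝ) : ℂ))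
    {U : State} {u : Seq} (hU : IsPhysData h P U u) :
    mulR₁₁ h • hat hh 0 U = w ^ 2 • (mulM₁₁ h • hat hh 0 U + mulM₁₂ h • hat hh 1 U) ∧
    mulR₂₂ h s • hat hh 1 U = w ^ 2 • (-mulM₁₂ h • hat hh 0 U + mulM₂₂ h • hat hh 1 U) := by
  have hmem : ∀ᵐ ξ ∂(freqMeasure h), ξ ∈ freqInterval h 1 := ae_restrict_mem measurableSet_Icc
  rw [smul_add, smul_add, smul_smul, smul_smul, smul_smul, smul_smul]
  constructor
  · refine Lp.ext ?_
    filter_upwards [hat_ae_eq hh hU 0, hat_ae_eq hh hU 1, hmem, bcf_smul_ae (mulR₁₁ h) (hat hh 0 U),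
      Lp.coeFn_add ((w ^ 2 * mulM₁₁ h) • hat hh 0 U) ((w ^ 2 * mulM₁₂ h) • hat hh 1 U),
      bcf_smul_ae (w ^ 2 * mulM₁₁ h) (hat hh 0 U), bcf_smul_ae (w ^ 2 * mulM₁₂ h) (hat hh 1 U)]
      with ξ h0 h1 hm e1 e2 e3 e4
    have := congrFun (stiffSymbol_mulVec_eigenvector hh hs hP hm) 0
    simp only [Matrix.mulVec, dotProduct, Fin.sum_univ_two, Pi.smul_apply, smul_eq_mul,
      ← mulM₁₁_apply, ← mulM₁₂_apply, ← mulR₁₁_apply] at this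
    have hz : stiffSymbol h s ξ 0 1 = 0 := rfl
    rw [hz, Complex.ofReal_pow, ← hw] at this
    rw [e1, e2, Pi.add_apply, e3, e4, h0, h1]
    simp only [BoundedContinuousFunction.mul_apply, BoundedContinuousFunction.pow_apply]
    linear_combination sdft h u ξ * this
  · refine Lp.ext ?_
    filter_upwards [hat_ae_eq hh hU 0, hat_ae_eq hh hU 1, hmem,
      bcf_smul_ae (mulR₂₂ h s) (hat hh 1 U),
      Lp.coeFn_add ((w ^ 2 * -mulM₁₂ h) • hat hh 0 U) ((w ^ 2 * mulM₂₂ h) • hat hh 1 U),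
      bcf_smul_ae (w ^ 2 * -mulM₁₂ h) (hat hh 0 U), bcf_smul_ae (w ^ 2 * mulM₂₂ h) (hat hh 1 U)]
      with ξ h0 h1 hm e1 e2 e3 e4
    have := congrFun (stiffSymbol_mulVec_eigenvector hh hs hP hm) 1
    simp only [Matrix.mulVec, dotProduct, Fin.sum_univ_two, Pi.smul_apply, smul_eq_mul,
      ← mulM₁₂_apply', ← mulM₂₂_apply, ← mulR₂₂_apply] at this
    have hz : stiffSymbol h s ξ 1 0 = 0 := rfl
    rw [hz, Complex.ofReal_pow, ← hw] at this
    rw [e1, e2, Pi.add_apply, e3, e4, h0, h1]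
    simp only [BoundedContinuousFunction.mul_apply, BoundedContinuousFunction.pow_apply,
      BoundedContinuousFunction.neg_apply]
    linear_combination sdft h u ξ * this

/-- Passing from `R u = w² M u` to `M⁻¹ R u = w² u` and back. -/
theorem symbol_eigen_iff {h s : ℝ} {w : ℝ →ᵇ ℂ} {μ : Measure ℝ} (x y : Lp ℂ 2 μ) :
    (mulR₁₁ h • x = w ^ 2 • (mulM₁₁ h • x + mulM₁₂ h • y) ∧
      mulR₂₂ h s • y = w ^ 2 • (-mulM₁₂ h • x + mulM₂₂ h • y)) ↔
    ((12 * mulM₂₂ h * mulR₁₁ h) • x + (-12 * mulM₁₂ h * mulR₂₂ h s) • y = w ^ 2 • x ∧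
      (12 * mulM₁₂ h * mulR₁₁ h) • x + (12 * mulM₁₁ h * mulR₂₂ h s) • y = w ^ 2 • y) := by
  have hd := mulM_det h
  have e : ∀ z : Lp ℂ 2 μ, (12 * (mulM₁₁ h * mulM₂₂ h + mulM₁₂ h * mulM₁₂ h)) • z = z := fun z => by
    rw [hd, one_smul]
  constructor
  · rintro ⟨h0, h1⟩
    constructor
    · linear_combination (norm := module) (12 * mulM₂₂ h) • h0 - (12 * mulM₁₂ h) • h1 + w ^ 2 • e x
    · linear_combination (norm := module) (12 * mulM₁₂ h) • h0 + (12 * mulM₁₁ h) • h1 + w ^ 2 • e y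
  · rintro ⟨h0, h1⟩
    constructor
    · linear_combination (norm := module) mulM₁₁ h • h0 + mulM₁₂ h • h1 - mulR₁₁ h • e x
    · linear_combination (norm := module) -mulM₁₂ h • h0 + mulM₂₂ h • h1 - mulR₂₂ h s • e y

/-- The Fourier transform of a physical solution: it stays physical, and the two half waves evolve
by multiplication by `e^{± i t w}`. -/
theorem hat_solution {h : ℝ} (hh : 0 < h) {s : ℝ} (hs : 1 < s) {P : ℝ → Fin 2 → ℂ}
    (hP : IsPhysEigenvector h s P) {w : ℝ →ᵇ ℂ} (hw : ∀ ξ, w ξ = ((phase s (ξ * h) / h : ℝ) : ℂ))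
    {U₀ U₁ : State} {u₀ u₁ : Seq} (hU₀ : IsPhysData h P U₀ u₀) (hU₁ : IsPhysData h P U₁ u₁)
    {U V : ℝ → State} (hUV : IsSolution h s U₀ U₁ U V) {t : ℝ} (ht : 0 ≤ t) :
    mulR₂₂ h s • hat hh 1 (U t)
      = w ^ 2 • (-mulM₁₂ h • hat hh 0 (U t) + mulM₂₂ h • hat hh 1 (U t)) ∧
    ∀ i, hat hh i (V t) + (Complex.I • w) • hat hh i (U t)
        = NormedSpace.exp (t • (Complex.I • w)) • (hat hh i U₁ + (Complex.I • w) • hat hh i U₀) ∧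
      hat hh i (V t) + (Complex.I • -w) • hat hh i (U t)
        = NormedSpace.exp (t • (Complex.I • -w)) •
          (hat hh i U₁ + (Complex.I • -w) • hat hh i U₀) := by
  have hu : ∀ i t, 0 ≤ t →
      HasDerivWithinAt (fun t => hat hh i (U t)) (hat hh i (V t)) (Ici 0) t := fun i t ht =>
    hasDerivWithinAt_hat hh i (hUV.deriv_pos t ht)
  have hv : ∀ t, 0 ≤ t →
      HasDerivWithinAt (fun t => hat hh 0 (V t)) (-((12 * mulM₂₂ h * mulR₁₁ h) • hat hh 0 (U t)
      + (-12 * mulM₁₂ h * mulR₂₂ h s) • hat hh 1 (U t))) (Ici 0) t ∧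
      HasDerivWithinAt (fun t => hat hh 1 (V t)) (-((12 * mulM₁₂ h * mulR₁₁ h) • hat hh 0 (U t)
      + (12 * mulM₁₁ h * mulR₂₂ h s) • hat hh 1 (U t))) (Ici 0) t := fun t ht => by
    obtain ⟨W, hW, hW2⟩ := hUV.wave t ht
    have h1 := hasDerivWithinAt_hat hh 0 hW
    have h2 := hasDerivWithinAt_hat hh 1 hW
    rw [(hat_wave hh hW2).1] at h1
    rw [(hat_wave hh hW2).2] at h2
    exact ⟨h1, h2⟩
  have i0 := (symbol_eigen_iff _ _).mp (hat_physData hh hs hP hw hU₀)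
  have i1 := (symbol_eigen_iff _ _).mp (hat_physData hh hs hP hw hU₁)
  rw [← hUV.init_pos] at i0
  rw [← hUV.init_vel] at i1
  have key : ∀ t : ℝ, 0 ≤ t → _ ∧ _ := fun t ht => wave_system_eigen (hu 0) (hu 1)
    (fun t ht => (hv t ht).1) (fun t ht => (hv t ht).2) i0.1 i0.2 i1.1 i1.2 ht
  refine ⟨((symbol_eigen_iff _ _).mpr (key t ht)).2, fun i => ?_⟩
  have hv' : ∀ t, 0 ≤ t →
      HasDerivWithinAt (fun t => hat hh i (V t)) (-(w ^ 2 • hat hh i (U t))) (Ici 0) t := by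
    intro t ht
    fin_cases i
    · have := (hv t ht).1
      rwa [(key t ht).1] at this
    · have := (hv t ht).2
      rwa [(key t ht).2] at this
  rw [← hUV.init_pos, ← hUV.init_vel]
  -- Only `w²` enters the scalar wave equation, so the second half wave is the first one with `-w`.
  refine ⟨half_wave_eq (hu i) hv' ht, half_wave_eq (hu i) ?_ ht⟩
  rwa [neg_sq]

end SIPG

namespace SIPG
open scoped BoundedContinuousFunction InnerProductSpace

/-! ### Energies in physical space -/

theorem gradOp_dot (h s : ℝ) (hh : 0 < h) (hs : 1 ≤ s) (c : ℤ → Fin 2 → ℂ) (j : ℤ) :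
    gradOp h s c j ⬝ᵥ star (gradOp h s c j)
      = (((1 / h) * (‖c (j + 1) 0 - c j 0‖ ^ 2 + (s - 1) * ‖c j 1‖ ^ 2
        + (1 / 4) * ‖c (j + 1) 1 - c j 1‖ ^ 2) : ℝ) : ℂ) := by
  have h3 : (1 / Real.sqrt h) ^ 2 = 1 / h := by rw [div_pow, one_pow, Real.sq_sqrt hh.le]
  have h2 : Real.sqrt (s - 1) ^ 2 = s - 1 := Real.sq_sqrt (by linarith)
  have e : ∀ z : ℂ, z * star z = ((‖z‖ ^ 2 : ℝ) : ℂ) := fun z => by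
    rw [Complex.star_def, Complex.mul_conj, Complex.normSq_eq_norm_sq]
  simp only [dotProduct, Fin.sum_univ_three, Pi.star_apply, e, gradOp, Pi.smul_apply, smul_eq_mul,
    Matrix.cons_val_zero, Matrix.cons_val_one, Matrix.cons_val]
  rw [← Complex.ofReal_add, ← Complex.ofReal_add]
  congr 1
  simp only [norm_mul, mul_pow, Complex.norm_real, Real.norm_eq_abs, sq_abs, h2,
    abs_of_nonneg (show 0 ≤ 1 / Real.sqrt h by positivity), h3]
  norm_num [div_pow]
  ring

theorem hasSum_norm_sq (f : Seq) : HasSum (fun j => ‖f j‖ ^ 2) (‖f‖ ^ 2) := by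
  have h1 := lp.hasSum_norm (p := 2) (by simp) f
  simpa using h1

theorem hasSum_gradOp {h s : ℝ} (hh : 0 < h) (hs : 1 ≤ s) (U : State) :
    HasSum (fun j => gradOp h s (coeffs U) j ⬝ᵥ star (gradOp h s (coeffs U) j))
      (((1 / h) * (‖shift 1 (comp 0 U) - comp 0 U‖ ^ 2 + (s - 1) * ‖comp 1 U‖ ^ 2
        + (1 / 4) * ‖shift 1 (comp 1 U) - comp 1 U‖ ^ 2) : ℝ) : ℂ) := by
  simp only [gradOp_dot h s hh hs]
  exact Complex.hasSum_ofReal.mpr (((((hasSum_norm_sq (shift 1 (comp 0 U) - comp 0 U)).add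
    ((hasSum_norm_sq (comp 1 U)).mul_left (s - 1))).add
    ((hasSum_norm_sq (shift 1 (comp 1 U) - comp 1 U)).mul_left (1 / 4)))).mul_left (1 / h))

theorem hasSum_massOp (h : ℝ) (V : State) :
    HasSum (fun j => massOp h (coeffs V) j ⬝ᵥ star (coeffs V j))
      (⟪comp 0 V, massSeq h V 0⟫_ℂ + ⟪comp 1 V, massSeq h V 1⟫_ℂ) := by
  have h0 := lp.hasSum_inner (𝕜 := ℂ) (comp 0 V) (massSeq h V 0)
  have h1 := lp.hasSum_inner (𝕜 := ℂ) (comp 1 V) (massSeq h V 1)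
  convert! h0.add h1 using 2 with j
  rw [dotProduct, Fin.sum_univ_two, massOp_coeffs, massOp_coeffs]
  rfl

/-- The element-wise form of the mass matrix: `A_j - J_j / 2` and `A_{j+1} + J_{j+1} / 2` are the
endpoint values on one cell, and the summand is the usual mass form of a linear function there. -/
theorem re_inner_massSeq (h : ℝ) (V : State) :
    (⟪comp 0 V, massSeq h V 0⟫_ℂ + ⟪comp 1 V, massSeq h V 1⟫_ℂ).re
      = h / 3 * (2 * ‖comp 0 V‖ ^ 2 + ‖comp 1 V‖ ^ 2 / 2
        + (⟪comp 0 V - (1 / 2 : ℂ) • comp 1 V,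
            shift 1 (comp 0 V + (1 / 2 : ℂ) • comp 1 V)⟫_ℂ).re) := by
  have hsh : ∀ f g : Seq, ⟪f, shift (-1) g⟫_ℂ = star ⟪g, shift 1 f⟫_ℂ := fun f g => by
    have h1 : shift 1 (shift (-1) g) = g := by
      ext j
      simp [shift_apply]
    rw [← (shift 1).inner_map_map f (shift (-1) g), h1]
    exact (inner_conj_symm _ _).symm
  have hs : ∀ f : Seq, ⟪f, f⟫_ℂ = ((‖f‖ ^ 2 : ℝ) : ℂ) := fun f => by
    rw [inner_self_eq_norm_sq_to_K]
    push_cast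
    rfl
  have hh : ((1 / 2 : ℂ)) = ((1 / 2 : ℝ) : ℂ) := by push_cast; rfl
  simp only [massSeq, Matrix.cons_val_zero, Matrix.cons_val_one, map_add, map_smul,
    inner_add_right, inner_sub_right, inner_sub_left, inner_smul_left, inner_smul_right, hsh, hs,
    hh, Complex.conj_ofReal]
  rw [show (1 / 6 : ℂ) = ((1 / 6 : ℝ) : ℂ) by push_cast; rfl,
    show (1 / 12 : ℂ) = ((1 / 12 : ℝ) : ℂ) by push_cast; rfl,
    show (1 / 24 : ℂ) = ((1 / 24 : ℝ) : ℂ) by push_cast; rfl,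
    show (2 / 3 : ℂ) = ((2 / 3 : ℝ) : ℂ) by push_cast; rfl]
  simp only [Complex.add_re, Complex.sub_re, Complex.re_ofReal_mul, Complex.ofReal_re,
    Complex.star_def, Complex.conj_re]
  ring

/-- The total energy in terms of `ℓ²` norms. -/
theorem energy_eq {h s : ℝ} (hh : 0 < h) (hs : 1 ≤ s) (U V : State) :
    energy h s U V = (1 / 2) * ((1 / h) * (‖shift 1 (comp 0 U) - comp 0 U‖ ^ 2
        + (s - 1) * ‖comp 1 U‖ ^ 2 + (1 / 4) * ‖shift 1 (comp 1 U) - comp 1 U‖ ^ 2)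
      + h / 3 * (2 * ‖comp 0 V‖ ^ 2 + ‖comp 1 V‖ ^ 2 / 2
        + (⟪comp 0 V - (1 / 2 : ℂ) • comp 1 V,
            shift 1 (comp 0 V + (1 / 2 : ℂ) • comp 1 V)⟫_ℂ).re)) := by
  rw [energy, ← innerOn_gradOp h s hh hs]
  unfold innerOn
  rw [tsum_univ (f := fun j => gradOp h s (coeffs U) j ⬝ᵥ star (gradOp h s (coeffs U) j)),
    tsum_univ (f := fun j => massOp h (coeffs V) j ⬝ᵥ star (coeffs V j)),
    (hasSum_gradOp hh hs U).tsum_eq, (hasSum_massOp h V).tsum_eq, Complex.add_re,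
    Complex.ofReal_re, re_inner_massSeq]

/-- Cauchy–Schwarz, the inequality between geometric and arithmetic means, and the parallelogram
law. The bound is exactly half of the diagonal part of the mass form, whence coercivity in
`le_energy`. -/
theorem abs_re_inner_le (f g : Seq) :
    |(⟪f - (1 / 2 : ℂ) • g, shift 1 (f + (1 / 2 : ℂ) • g)⟫_ℂ).re|
      ≤ ‖f‖ ^ 2 + ‖g‖ ^ 2 / 4 := by
  have h1 := (Complex.abs_re_le_norm _).trans
    (norm_inner_le_norm (𝕜 := ℂ) (f - (1 / 2 : ℂ) • g) (shift 1 (f + (1 / 2 : ℂ) • g)))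
  rw [LinearIsometry.norm_map] at h1
  have h2 := parallelogram_law_with_norm ℂ f ((1 / 2 : ℂ) • g)
  rw [norm_smul] at h2
  norm_num at h2
  nlinarith [sq_nonneg (‖f - (1 / 2 : ℂ) • g‖ - ‖f + (1 / 2 : ℂ) • g‖)]

theorem le_energy {h s : ℝ} (hh : 0 < h) (hs : 1 ≤ s) (U V : State) :
    (1 / 2) * ((1 / h) * (‖shift 1 (comp 0 U) - comp 0 U‖ ^ 2 + (s - 1) * ‖comp 1 U‖ ^ 2)
      + h / 3 * (‖comp 0 V‖ ^ 2 + ‖comp 1 V‖ ^ 2 / 4)) ≤ energy h s U V := by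
  rw [energy_eq hh hs]
  have h1 := (abs_le.mp (abs_re_inner_le (comp 0 V) (comp 1 V))).1
  refine mul_le_mul_of_nonneg_left (add_le_add
    (mul_le_mul_of_nonneg_left ?_ (by positivity))
    (mul_le_mul_of_nonneg_left ?_ (by positivity))) (by norm_num)
  · have := sq_nonneg ‖shift 1 (comp 1 U) - comp 1 U‖
    linarith
  · linarith

/-- A jump difference has squared norm at most `4 ‖J‖²`; a quarter of it turns the coefficient `s -
1` into `s`. -/
theorem energy_le {h s : ℝ} (hh : 0 < h) (hs : 1 ≤ s) (U V : State) :
    energy h s U V ≤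
    (1 / 2) * ((1 / h) * (‖shift 1 (comp 0 U) - comp 0 U‖ ^ 2 + s * ‖comp 1 U‖ ^ 2)
      + h * (‖comp 0 V‖ ^ 2 + ‖comp 1 V‖ ^ 2)) := by
  rw [energy_eq hh hs]
  have h1 := (abs_le.mp (abs_re_inner_le (comp 0 V) (comp 1 V))).2
  have h2 : ‖shift 1 (comp 1 U) - comp 1 U‖ ≤ 2 * ‖comp 1 U‖ := by
    refine (norm_sub_le _ _).trans ?_
    rw [LinearIsometry.norm_map]
    linarith
  have h3 : ‖shift 1 (comp 1 U) - comp 1 U‖ ^ 2 ≤ (2 * ‖comp 1 U‖) ^ 2 := by gcongr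
  refine mul_le_mul_of_nonneg_left (add_le_add
    (mul_le_mul_of_nonneg_left ?_ (by positivity)) ?_) (by norm_num)
  · linarith
  · rw [div_mul_eq_mul_div, mul_div_assoc]
    refine mul_le_mul_of_nonneg_left ?_ hh.le
    have := sq_nonneg ‖comp 1 V‖
    linarith

theorem continuousOn_energy {h s : ℝ} (hh : 0 < h) (hs : 1 ≤ s) {U V : ℝ → State} {S : Set ℝ}
    (hU : ContinuousOn U S) (hV : ContinuousOn V S) :
    ContinuousOn (fun t => energy h s (U t) (V t)) S := by
  simp only [energy_eq hh hs]
  have hc : ∀ i, ∀ {X : ℝ → State}, ContinuousOn X S → ContinuousOn (fun t => comp i (X t)) S :=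
    fun i X hX => (comp i).continuous.comp_continuousOn hX
  have hsh : ∀ {X : ℝ → Seq}, ContinuousOn X S → ContinuousOn (fun t => shift 1 (X t)) S :=
    fun hX => (shift 1).continuous.comp_continuousOn hX
  have h0 := hc 0 hU
  have h1 := hc 1 hU
  have h2 := hc 0 hV
  have h3 := hc 1 hV
  have h4 := hsh h0
  have h5 := hsh h1
  have h6 := hsh (h2.add (h3.const_smul (1 / 2 : ℂ)))
  have h7 : ContinuousOn (fun t => (⟪comp 0 (V t) - (1 / 2 : ℂ) • comp 1 (V t),
            shift 1 (comp 0 (V t) + (1 / 2 : ℂ) • comp 1 (V t))⟫_ℂ).re) S :=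
    Complex.continuous_re.comp_continuousOn (ContinuousOn.inner (𝕜 := ℂ) (h2.sub (h3.const_smul (1 / 2 : ℂ))) h6)
  fun_prop

/-! ### The energy outside `Ω` -/

theorem finite_compl_omegaNodes {h : ℝ} (hh : 0 < h) : (omegaNodes h)ᶜ.Finite := by
  refine (Set.finite_Icc (-⌈1 / h⌉) ⌈1 / h⌉).subset fun j hj => ?_
  have hj' : (j : ℝ) * h ∈ Ioo (-1 : ℝ) 1 := by simpa [omegaNodes] using hj
  have h1 : (j : ℝ) ≤ 1 / h := by
    rw [le_div_iff₀ hh]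
    exact hj'.2.le
  have h2 : ((-j : ℤ) : ℝ) ≤ 1 / h := by
    rw [le_div_iff₀ hh]
    push_cast
    linarith [hj'.1]
  have h3 : j ≤ ⌈1 / h⌉ := by exact_mod_cast h1.trans (Int.le_ceil _)
  have h4 : -j ≤ ⌈1 / h⌉ := by exact_mod_cast h2.trans (Int.le_ceil _)
  exact ⟨by linarith, h3⟩

/-- The indices of the nodes in `(-1, 1)`. -/
noncomputable def innerNodes {h : ℝ} (hh : 0 < h) : Finset ℤ := (finite_compl_omegaNodes hh).toFinset

/-- There are at most `2 / h + 1` nodes. The restriction `h ≤ 1` serves to absorb the additional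
node. -/
theorem card_innerNodes_le {h : ℝ} (hh : 0 < h) (h1 : h ≤ 1) :
    h * (innerNodes hh).card ≤ 3 := by
  have hsub : innerNodes hh ⊆ Finset.Icc (-⌊1 / h⌋) ⌊1 / h⌋ := fun j hj => by
    have hj' : (j : ℝ) * h ∈ Ioo (-1 : ℝ) 1 := by
      simpa [innerNodes, omegaNodes] using hj
    have h2 : (j : ℝ) ≤ 1 / h := by
      rw [le_div_iff₀ hh]
      exact hj'.2.le
    have h3 : ((-j : ℤ) : ℝ) ≤ 1 / h := by
      rw [le_div_iff₀ hh]
      push_cast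
      linarith [hj'.1]
    have h4 := Int.le_floor.mpr h2
    have h5 := Int.le_floor.mpr h3
    exact Finset.mem_Icc.mpr ⟨by linarith, h4⟩
  have hcard := Finset.card_le_card hsub
  rw [Int.card_Icc] at hcard
  have hf : 0 ≤ ⌊1 / h⌋ := Int.floor_nonneg.mpr (by positivity)
  have h2 : ((innerNodes hh).card : ℤ) ≤ 2 * ⌊1 / h⌋ + 1 := by omega
  have h3 : ((innerNodes hh).card : ℝ) ≤ 2 * (⌊1 / h⌋ : ℝ) + 1 := by exact_mod_cast h2
  have h4 : ((innerNodes hh).card : ℝ) ≤ 2 * (1 / h) + 1 := by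
    linarith [Int.floor_le (1 / h)]
  calc h * (innerNodes hh).card ≤ h * (2 * (1 / h) + 1) := by gcongr
    _ = 2 + h := by field_simp
    _ ≤ 3 := by linarith

/-- The energy at a node. -/
noncomputable def nodeEnergy (h s : ℝ) (U V : State) (j : ℤ) : ℝ :=
  (1 / 2) * (gradOp h s (coeffs U) j ⬝ᵥ star (gradOp h s (coeffs U) j)
    + massOp h (coeffs V) j ⬝ᵥ star (coeffs V j)).re

/-- Only finitely many nodes lie outside `Ω`. Since the mass part of a node energy need not have a
sign, the observed energy is bounded below by bounding the removed sum from above. -/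
theorem localEnergy_eq {h s : ℝ} (hh : 0 < h) (hs : 1 ≤ s) (U V : State) :
    localEnergy h s U V = energy h s U V - ∑ j ∈ innerNodes hh, nodeEnergy h s U V j := by
  have hset : omegaNodes h = ((innerNodes hh : Finset ℤ) : Set ℤ)ᶜ := by
    simp [innerNodes]
  have key : ∀ {n : ℕ} (F G : ℤ → Fin n → ℂ), Summable (fun j => F j ⬝ᵥ star (G j)) →
      innerOn (omegaNodes h) F G
        = innerOn univ F G - ∑ j ∈ innerNodes hh, F j ⬝ᵥ star (G j) := fun F G hFG => by
    unfold innerOn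
    rw [tsum_univ (f := fun j => F j ⬝ᵥ star (G j)), hset, ← hFG.sum_add_tsum_compl
      (s := innerNodes hh), add_sub_cancel_left]
  rw [localEnergy, energy, ← innerOn_gradOp h s hh hs, key _ _ (hasSum_gradOp hh hs U).summable,
    key _ _ (hasSum_massOp h V).summable]
  simp only [nodeEnergy]
  rw [← Finset.mul_sum, ← mul_sub, ← Complex.re_sum, Finset.sum_add_distrib, ← Complex.sub_re]
  congr 2
  ring

theorem norm_massSeq_apply_le {h : ℝ} (hh : 0 < h) (V : State) (i : Fin 2) (j : ℤ) :
    ‖massSeq h V i j‖ ≤ h * (‖comp 0 V (j - 1)‖ + ‖comp 1 V (j - 1)‖ + ‖comp 0 V j‖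
      + ‖comp 1 V j‖ + ‖comp 0 V (j + 1)‖ + ‖comp 1 V (j + 1)‖) := by
  have hsmul : ∀ {α : ℝ} (z : ℂ), 0 ≤ α → α ≤ 1 → ‖(α : ℂ) * z‖ ≤ ‖z‖ := fun z h0 h1 => by
    rw [norm_mul, Complex.norm_real, Real.norm_of_nonneg h0]
    exact mul_le_of_le_one_left (norm_nonneg z) h1
  have key : ∀ {α β γ : ℝ} (p q r : ℂ), 0 ≤ α → α ≤ 1 → 0 ≤ β → β ≤ 1 → 0 ≤ γ → γ ≤ 1 →
      ‖(α : ℂ) * p‖ + ‖(β : ℂ) * q‖ + ‖(γ : ℂ) * r‖ ≤ ‖p‖ + ‖q‖ + ‖r‖ :=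
    fun p q r h1 h2 h3 h4 h5 h6 =>
    add_le_add (add_le_add (hsmul p h1 h2) (hsmul q h3 h4)) (hsmul r h5 h6)
  have e : ∀ (a b c d : ℂ), ‖a + b‖ ≤ ‖a‖ + ‖b‖ ∧ ‖c - d‖ ≤ ‖c‖ + ‖d‖ := fun a b c d =>
    ⟨norm_add_le a b, norm_sub_le c d⟩
  have c6 : (1 / 6 : ℂ) = ((1 / 6 : ℝ) : ℂ) := by push_cast; rfl
  have c12 : (1 / 12 : ℂ) = ((1 / 12 : ℝ) : ℂ) := by push_cast; rfl
  have c24 : (1 / 24 : ℂ) = ((1 / 24 : ℝ) : ℂ) := by push_cast; rfl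
  have c23 : (2 / 3 : ℂ) = ((2 / 3 : ℝ) : ℂ) := by push_cast; rfl
  revert i
  refine Fin.forall_fin_two.mpr ⟨?_, ?_⟩
  · simp only [massSeq, Matrix.cons_val_zero, seq_add_apply, seq_sub_apply, seq_smul_apply,
      shift_apply, ← sub_eq_add_neg, c6, c12, c23]
    rw [norm_mul, Complex.norm_real, Real.norm_of_nonneg hh.le]
    refine mul_le_mul_of_nonneg_left ?_ hh.le
    refine (norm_add₃_le).trans ((key _ _ _ (by norm_num) (by norm_num) (by norm_num)
      (by norm_num) (by norm_num) (by norm_num)).trans ?_)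
    have := e (comp 0 V (j + 1)) (comp 0 V (j - 1)) (comp 1 V (j + 1)) (comp 1 V (j - 1))
    linarith [this.1, this.2, norm_nonneg (comp 1 V j)]
  · simp only [massSeq, Matrix.cons_val_one, Matrix.cons_val_zero, seq_add_apply, seq_sub_apply, seq_smul_apply,
      shift_apply, ← sub_eq_add_neg, c6, c12, c24]
    rw [norm_mul, Complex.norm_real, Real.norm_of_nonneg hh.le]
    refine mul_le_mul_of_nonneg_left ?_ hh.le
    refine (norm_sub_le _ _).trans ((add_le_add_left (norm_sub_le _ _) _).trans
      ((key _ _ _ (by norm_num) (by norm_num) (by norm_num)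
      (by norm_num) (by norm_num) (by norm_num)).trans ?_))
    have := e (comp 1 V (j + 1)) (comp 1 V (j - 1)) (comp 0 V (j + 1)) (comp 0 V (j - 1))
    linarith [this.1, this.2, norm_nonneg (comp 0 V j)]

theorem re_massOp_dot_le {h : ℝ} (hh : 0 < h) (V : State) (j : ℤ) :
    (massOp h (coeffs V) j ⬝ᵥ star (coeffs V j)).re
      ≤ 6 * h * (‖comp 0 V (j - 1)‖ ^ 2 + ‖comp 1 V (j - 1)‖ ^ 2 + ‖comp 0 V j‖ ^ 2
        + ‖comp 1 V j‖ ^ 2 + ‖comp 0 V (j + 1)‖ ^ 2 + ‖comp 1 V (j + 1)‖ ^ 2) := by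
  have h0 := norm_massSeq_apply_le hh V 0 j
  have h1 := norm_massSeq_apply_le hh V 1 j
  have h2 : (massOp h (coeffs V) j ⬝ᵥ star (coeffs V j)).re
      ≤ ‖massSeq h V 0 j‖ * ‖comp 0 V j‖ + ‖massSeq h V 1 j‖ * ‖comp 1 V j‖ := by
    refine (Complex.re_le_norm _).trans ?_
    rw [dotProduct, Fin.sum_univ_two, massOp_coeffs, massOp_coeffs]
    refine (norm_add_le _ _).trans_eq ?_
    rw [norm_mul, norm_mul, Pi.star_apply, Pi.star_apply, norm_star, norm_star]
    rfl
  refine h2.trans ?_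
  generalize ‖massSeq h V 0 j‖ = m₀ at *
  generalize ‖massSeq h V 1 j‖ = m₁ at *
  have p1 := norm_nonneg (comp 0 V (j - 1))
  have p2 := norm_nonneg (comp 1 V (j - 1))
  have p3 := norm_nonneg (comp 0 V j)
  have p4 := norm_nonneg (comp 1 V j)
  have p5 := norm_nonneg (comp 0 V (j + 1))
  have p6 := norm_nonneg (comp 1 V (j + 1))
  generalize ‖comp 0 V (j - 1)‖ = a at *
  generalize ‖comp 1 V (j - 1)‖ = b at *
  generalize ‖comp 0 V j‖ = c at *
  generalize ‖comp 1 V j‖ = d at *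
  generalize ‖comp 0 V (j + 1)‖ = x at *
  generalize ‖comp 1 V (j + 1)‖ = y at *
  calc m₀ * c + m₁ * d ≤ h * (a + b + c + d + x + y) * c + h * (a + b + c + d + x + y) * d := by
        gcongr
    _ = h * ((a + b + c + d + x + y) * (c + d)) := by ring
    _ ≤ h * (6 * (a ^ 2 + b ^ 2 + c ^ 2 + d ^ 2 + x ^ 2 + y ^ 2)) := by
        refine mul_le_mul_of_nonneg_left ?_ hh.le
        have h3 : (a + b + c + d + x + y) * (c + d) ≤ (a + b + c + d + x + y) ^ 2 := by
          rw [sq]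
          exact mul_le_mul_of_nonneg_left (by linarith) (by positivity)
        have h4 : (a + b + c + d + x + y) ^ 2
            ≤ 6 * (a ^ 2 + b ^ 2 + c ^ 2 + d ^ 2 + x ^ 2 + y ^ 2) := by
          have := sq_sum_le_card_mul_sum_sq (s := Finset.univ) (f := ![a, b, c, d, x, y])
          simp [Fin.sum_univ_six] at this
          linarith
        linarith
    _ = _ := by ring

/-- The energy at a node is controlled by the discrete gradient and the velocity nearby. -/
theorem nodeEnergy_le {h s : ℝ} (hh : 0 < h) (hs : 1 ≤ s) (U V : State) (j : ℤ) :
    nodeEnergy h s U V j ≤ (1 / (2 * h)) * (‖(shift 1 (comp 0 U) - comp 0 U) j‖ ^ 2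
        + s * ‖comp 1 U j‖ ^ 2 + ‖comp 1 U (j + 1)‖ ^ 2)
      + 3 * h * (‖comp 0 V (j - 1)‖ ^ 2 + ‖comp 1 V (j - 1)‖ ^ 2 + ‖comp 0 V j‖ ^ 2
        + ‖comp 1 V j‖ ^ 2 + ‖comp 0 V (j + 1)‖ ^ 2 + ‖comp 1 V (j + 1)‖ ^ 2) := by
  have hg : (gradOp h s (coeffs U) j ⬝ᵥ star (gradOp h s (coeffs U) j)).re
      ≤ (1 / h) * (‖(shift 1 (comp 0 U) - comp 0 U) j‖ ^ 2
        + s * ‖comp 1 U j‖ ^ 2 + ‖comp 1 U (j + 1)‖ ^ 2) := by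
    rw [gradOp_dot h s hh hs, Complex.ofReal_re, seq_sub_apply, shift_apply]
    simp only [comp_apply]
    have h1 := norm_sub_le (coeffs U (j + 1) 1) (coeffs U j 1)
    have h2 : ‖coeffs U (j + 1) 1 - coeffs U j 1‖ ^ 2
        ≤ (‖coeffs U (j + 1) 1‖ + ‖coeffs U j 1‖) ^ 2 := by gcongr
    refine mul_le_mul_of_nonneg_left ?_ (by positivity)
    nlinarith [sq_nonneg (‖coeffs U (j + 1) 1‖ - ‖coeffs U j 1‖), sq_nonneg ‖coeffs U j 1‖,
      sq_nonneg ‖coeffs U (j + 1) 1‖]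
  have hm := re_massOp_dot_le hh V j
  rw [nodeEnergy, Complex.add_re]
  calc _ ≤ (1 / 2) * ((1 / h) * (‖(shift 1 (comp 0 U) - comp 0 U) j‖ ^ 2
        + s * ‖comp 1 U j‖ ^ 2 + ‖comp 1 U (j + 1)‖ ^ 2) + 6 * h * (‖comp 0 V (j - 1)‖ ^ 2 +
        ‖comp 1 V (j - 1)‖ ^ 2 + ‖comp 0 V j‖ ^ 2
        + ‖comp 1 V j‖ ^ 2 + ‖comp 0 V (j + 1)‖ ^ 2 + ‖comp 1 V (j + 1)‖ ^ 2)) := by gcongr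
    _ = _ := by
        field_simp
        ring

end SIPG

namespace SIPG
open scoped BoundedContinuousFunction InnerProductSpace

/-! ### Multipliers relating positions, velocities and half waves -/

/-- The difference symbol carries the same factor `2 sin (ξ h / 2)` as `phase`; their quotient is
therefore bounded above and below, which is why `b` and `b'` in `exists_multipliers` exist. -/
theorem wave_one_sub_one (h ξ : ℝ) : wave h 1 ξ - 1
    = 2 * Real.sin (ξ * h / 2) * (Complex.I * Complex.exp (Complex.I * ((ξ * h / 2 : ℝ) : ℂ))) := by
  have e1 : wave h 1 ξ = Complex.exp (Complex.I * ((ξ * h / 2 : ℝ) : ℂ)) ^ 2 := by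
    rw [wave_apply, ← Complex.exp_nat_mul]
    congr 1
    push_cast
    ring
  have h1 : ((Real.sin (ξ * h / 2) : ℝ) : ℂ) ^ 2 + (Real.cos (ξ * h / 2) : ℝ) ^ 2 = 1 := by
    exact_mod_cast Real.sin_sq_add_cos_sq (ξ * h / 2)
  have e2 : Complex.exp (Complex.I * ((ξ * h / 2 : ℝ) : ℂ))
      = (Real.cos (ξ * h / 2) : ℝ) + (Real.sin (ξ * h / 2) : ℝ) * Complex.I := by
    rw [mul_comm, Complex.exp_mul_I]
    push_cast
    rfl
  rw [e1, e2]
  generalize ((Real.sin (ξ * h / 2) : ℝ) : ℂ) = x at *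
  generalize ((Real.cos (ξ * h / 2) : ℝ) : ℂ) = y at *
  linear_combination h1 - x ^ 2 * Complex.I_sq

theorem norm_exp_I_mul (x : ℝ) : ‖Complex.exp (Complex.I * (x : ℂ))‖ = 1 := by
  rw [Complex.norm_exp]
  simp

/-- The frequency `w` and the multipliers that recover the discrete gradient from `w û`, with
bounds that do not depend on `h`. -/
theorem exists_multipliers {s : ℝ} (hs : 1 < s) : ∃ K : ℝ, 0 < K ∧ ∀ h : ℝ, 0 < h →
    ∃ w b b' g : ℝ →ᵇ ℂ, (∀ ξ, w ξ = ((phase s (ξ * h) / h : ℝ) : ℂ)) ∧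
      (∀ ξ, ‖w ξ‖ ≤ K / h) ∧ (∀ ξ, ‖b ξ‖ ≤ K) ∧ (∀ ξ, ‖b' ξ‖ ≤ K) ∧ (∀ ξ, ‖(g * w) ξ‖ ≤ K) ∧
      (1 / h : ℂ) • (wave h 1 - 1) = b * w ∧ w = b' * ((1 / h : ℂ) • (wave h 1 - 1)) ∧
      g * mulR₂₂ h s = (1 / h : ℂ) • 1 := by
  obtain ⟨m, M, hm, hM, hb⟩ := exists_dispRatio_bounds hs
  have hsM := Real.sqrt_pos.mpr hM
  have hsm := Real.sqrt_pos.mpr hm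
  have hs1 : 0 < s - 1 := by linarith
  have hphase : ∀ θ, |phase s θ| ≤ 2 * Real.sqrt M := fun θ => by
    rw [phase, abs_mul, abs_mul, abs_two, abs_of_nonneg (Real.sqrt_nonneg _)]
    have h1 := Real.abs_sin_le_one (θ / 2)
    have h2 := Real.sqrt_le_sqrt (hb _ (Real.cos_mem_Icc θ)).2
    have := mul_le_mul h1 h2 (Real.sqrt_nonneg _) zero_le_one
    linarith
  have hlow : ∀ θ, Real.sqrt m ≤ Real.sqrt (dispRatio s (Real.cos θ)) := fun θ =>
    Real.sqrt_le_sqrt (hb _ (Real.cos_mem_Icc θ)).1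
  have hup : ∀ θ, Real.sqrt (dispRatio s (Real.cos θ)) ≤ Real.sqrt M := fun θ =>
    Real.sqrt_le_sqrt (hb _ (Real.cos_mem_Icc θ)).2
  have hcos : ∀ θ, s - 1 ≤ s - Real.cos θ ^ 2 := fun θ => by linarith [Real.cos_sq_le_one θ]
  have hcont := continuous_dispRatio_cos hs
  have hcp := continuous_phase hs
  -- The first term bounds `h w` and `b'`, the second `b`, the third `g w`.
  refine ⟨2 * Real.sqrt M + 1 / Real.sqrt m + 2 * Real.sqrt M / (s - 1), by positivity,
    fun h hh => ?_⟩
  have hp1 : 0 < 1 / Real.sqrt m := by positivity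
  have hp2 : 0 < 2 * Real.sqrt M / (s - 1) := by positivity
  set K := 2 * Real.sqrt M + 1 / Real.sqrt m + 2 * Real.sqrt M / (s - 1) with hK
  have hne : (h : ℂ) ≠ 0 := by exact_mod_cast hh.ne'
  have hρ0 : ∀ θ, Real.sqrt (dispRatio s (Real.cos θ)) ≠ 0 := fun θ =>
    (lt_of_lt_of_le hsm (hlow θ)).ne'
  have hwb : ∀ ξ : ℝ, ‖((phase s (ξ * h) / h : ℝ) : ℂ)‖ ≤ K / h := fun ξ => by
    rw [Complex.norm_real, Real.norm_eq_abs, abs_div, abs_of_pos hh]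
    gcongr
    linarith [hphase (ξ * h)]
  have hbb : ∀ ξ : ℝ, ‖Complex.I * Complex.exp (Complex.I * ((ξ * h / 2 : ℝ) : ℂ)) /
      (Real.sqrt (dispRatio s (Real.cos (ξ * h))) : ℝ)‖ ≤ K := fun ξ => by
    rw [norm_div, norm_mul, norm_exp_I_mul, Complex.norm_I, Complex.norm_real,
      Real.norm_of_nonneg (Real.sqrt_nonneg _), one_mul]
    have : 1 / Real.sqrt (dispRatio s (Real.cos (ξ * h))) ≤ 1 / Real.sqrt m :=
      one_div_le_one_div_of_le hsm (hlow _)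
    linarith
  have hbb' : ∀ ξ : ℝ, ‖(Real.sqrt (dispRatio s (Real.cos (ξ * h))) : ℝ) /
      (Complex.I * Complex.exp (Complex.I * ((ξ * h / 2 : ℝ) : ℂ)))‖ ≤ K := fun ξ => by
    rw [norm_div, norm_mul, norm_exp_I_mul, Complex.norm_I, Complex.norm_real,
      Real.norm_of_nonneg (Real.sqrt_nonneg _), one_mul, div_one]
    linarith [hup (ξ * h)]
  have hgb : ∀ ξ : ℝ, ‖((h / (s - Real.cos (ξ * h / 2) ^ 2) : ℝ) : ℂ)‖ ≤ h / (s - 1) := fun ξ => by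
    have := hcos (ξ * h / 2)
    rw [Complex.norm_real, Real.norm_of_nonneg (div_nonneg hh.le (by linarith))]
    gcongr
  -- With `θ = ξ h` and `ρ` for `dispRatio`, the choices are `b = i e^{iθ/2} / √ρ`, `b' = 1 / b` and
  -- `g = 1 / (h R₂₂)`.
  refine ⟨.ofNormedAddCommGroup (fun ξ => ((phase s (ξ * h) / h : ℝ) : ℂ)) (by fun_prop) _ hwb,
    .ofNormedAddCommGroup (fun ξ => Complex.I * Complex.exp (Complex.I * ((ξ * h / 2 : ℝ) : ℂ)) /
      (Real.sqrt (dispRatio s (Real.cos (ξ * h))) : ℝ)) ?_ _ hbb,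
    .ofNormedAddCommGroup (fun ξ => (Real.sqrt (dispRatio s (Real.cos (ξ * h))) : ℝ) /
      (Complex.I * Complex.exp (Complex.I * ((ξ * h / 2 : ℝ) : ℂ)))) ?_ _ hbb',
    .ofNormedAddCommGroup (fun ξ => ((h / (s - Real.cos (ξ * h / 2) ^ 2) : ℝ) : ℂ)) ?_ _ hgb,
    fun ξ => rfl, hwb, hbb, hbb', fun ξ => ?_, ?_, ?_, ?_⟩
  · refine Continuous.div (by fun_prop) ?_ fun ξ => by exact_mod_cast hρ0 (ξ * h)
    exact Complex.continuous_ofReal.comp (hcont.comp (by fun_prop : Continuous fun ξ => ξ * h)).sqrt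
  · refine Continuous.div ?_ (by fun_prop) fun ξ =>
      mul_ne_zero Complex.I_ne_zero (Complex.exp_ne_zero _)
    exact Complex.continuous_ofReal.comp (hcont.comp (by fun_prop : Continuous fun ξ => ξ * h)).sqrt
  · refine Complex.continuous_ofReal.comp (Continuous.div (by fun_prop) (by fun_prop) fun ξ => ?_)
    have := hcos (ξ * h / 2)
    linarith
  · have h1 := hcos (ξ * h / 2)
    have h2 : 0 < s - Real.cos (ξ * h / 2) ^ 2 := by linarith
    change ‖((h / (s - Real.cos (ξ * h / 2) ^ 2) : ℝ) : ℂ) * ((phase s (ξ * h) / h : ℝ) : ℂ)‖ ≤ K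
    rw [← Complex.ofReal_mul, Complex.norm_real, Real.norm_eq_abs,
      show h / (s - Real.cos (ξ * h / 2) ^ 2) * (phase s (ξ * h) / h)
        = phase s (ξ * h) / (s - Real.cos (ξ * h / 2) ^ 2) by field_simp,
      abs_div, abs_of_pos h2]
    have : |phase s (ξ * h)| / (s - Real.cos (ξ * h / 2) ^ 2) ≤ 2 * Real.sqrt M / (s - 1) :=
      div_le_div₀ (by positivity) (hphase _) hs1 h1
    linarith
  · ext ξ
    have h2 : ((Real.sqrt (dispRatio s (Real.cos (ξ * h))) : ℝ) : ℂ) ≠ 0 := by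
      exact_mod_cast hρ0 (ξ * h)
    change (1 / h : ℂ) * (wave h 1 ξ - 1) = Complex.I * Complex.exp (Complex.I *
      ((ξ * h / 2 : ℝ) : ℂ)) / (Real.sqrt (dispRatio s (Real.cos (ξ * h))) : ℝ) *
      ((phase s (ξ * h) / h : ℝ) : ℂ)
    rw [wave_one_sub_one, phase]
    generalize Complex.exp (Complex.I * ((ξ * h / 2 : ℝ) : ℂ)) = z
    push_cast
    field_simp
  · ext ξ
    have h2 := Complex.exp_ne_zero (Complex.I * ((ξ * h / 2 : ℝ) : ℂ))
    change ((phase s (ξ * h) / h : ℝ) : ℂ) = (Real.sqrt (dispRatio s (Real.cos (ξ * h))) : ℝ) /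
      (Complex.I * Complex.exp (Complex.I * ((ξ * h / 2 : ℝ) : ℂ))) *
      ((1 / h : ℂ) * (wave h 1 ξ - 1))
    rw [wave_one_sub_one, phase]
    generalize Complex.exp (Complex.I * ((ξ * h / 2 : ℝ) : ℂ)) = z at *
    have := Complex.I_ne_zero
    push_cast
    field_simp
  · ext ξ
    have h1 := hcos (ξ * h / 2)
    have h2 : ((s - Real.cos (ξ * h / 2) ^ 2 : ℝ) : ℂ) ≠ 0 := by
      exact_mod_cast (by linarith : 0 < s - Real.cos (ξ * h / 2) ^ 2).ne'
    change ((h / (s - Real.cos (ξ * h / 2) ^ 2) : ℝ) : ℂ) * mulR₂₂ h s ξ = (1 / h : ℂ) * 1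
    rw [mulR₂₂_apply]
    change ((h / (s - Real.cos (ξ * h / 2) ^ 2) : ℝ) : ℂ) *
      (((s - Real.cos (ξ * h / 2) ^ 2) / h ^ 2 : ℝ) : ℂ) = (1 / h : ℂ) * 1
    rw [Complex.ofReal_div, Complex.ofReal_div]
    generalize ((s - Real.cos (ξ * h / 2) ^ 2 : ℝ) : ℂ) = z at *
    push_cast
    field_simp

theorem norm_mulM₁₂_le (h ξ : ℝ) : ‖mulM₁₂ h ξ‖ ≤ 1 := by
  change ‖(1 / 12 : ℂ) * (wave h 1 ξ - wave h (-1) ξ)‖ ≤ 1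
  have h1 : ∀ n, ‖wave h n ξ‖ = 1 := fun n => norm_exp_I_mul _
  have h2 := norm_sub_le (wave h 1 ξ) (wave h (-1) ξ)
  rw [h1, h1] at h2
  rw [norm_mul]
  norm_num
  linarith

theorem norm_mulM₂₂_le (h ξ : ℝ) : ‖mulM₂₂ h ξ‖ ≤ 1 := by
  change ‖(1 / 6 : ℂ) * 1 - (1 / 24 : ℂ) * (wave h 1 ξ + wave h (-1) ξ)‖ ≤ 1
  have h1 : ∀ n, ‖wave h n ξ‖ = 1 := fun n => norm_exp_I_mul _
  have h2 := norm_add_le (wave h 1 ξ) (wave h (-1) ξ)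
  rw [h1, h1] at h2
  refine (norm_sub_le _ _).trans ?_
  rw [norm_mul, norm_mul]
  norm_num
  linarith

/-! ### Filtered wave packets -/

/-- Functions on `Π_h` supported in `Π_h^δ`. -/
def IsSupported (h δ : ℝ) (f : FreqSpace h) : Prop :=
  ∀ᵐ ξ ∂(freqMeasure h), ξ ∉ freqInterval h δ → f ξ = 0

variable {h δ : ℝ}

theorem IsSupported.smul {f : FreqSpace h} (hf : IsSupported h δ f) (a : ℝ →ᵇ ℂ) :
    IsSupported h δ (a • f) := by
  filter_upwards [hf, bcf_smul_ae a f] with ξ h1 h2 h3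
  rw [h2, h1 h3, mul_zero]

theorem IsSupported.add {f g : FreqSpace h} (hf : IsSupported h δ f) (hg : IsSupported h δ g) :
    IsSupported h δ (f + g) := by
  filter_upwards [hf, hg, Lp.coeFn_add f g] with ξ h1 h2 h3 h4
  rw [h3, Pi.add_apply, h1 h4, h2 h4, add_zero]

/-- Multiplication by `P` cannot enlarge the support, so the normalization of the eigenvectors plays
no role. -/
theorem isSupported_hat (hh : 0 < h) {P : ℝ → Fin 2 → ℂ} {U : State} {u : Seq}
    (hU : IsPhysData h P U u) (hu : IsFiltered h δ u) (i : Fin 2) :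
    IsSupported h δ (hat hh i U) := by
  filter_upwards [hat_ae_eq hh hU i, hu] with ξ h1 h2 h3
  rw [h1, h2 h3, mul_zero]

/-- Superpositions of two filtered half waves of size at most `κ`. -/
def IsWavePacket (h δ : ℝ) (w : ℝ →ᵇ ℂ) (κ : ℝ) (O : ℝ → FreqSpace h) : Prop :=
  ∃ f g : FreqSpace h, IsSupported h δ f ∧ IsSupported h δ g ∧ ‖f‖ ≤ κ ∧ ‖g‖ ≤ κ ∧
    ∀ t, 0 ≤ t → O t = NormedSpace.exp (t • (Complex.I • w)) • f
      + NormedSpace.exp (t • (Complex.I • -w)) • g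

variable {w : ℝ →ᵇ ℂ} {κ κ' : ℝ} {O O' : ℝ → FreqSpace h}

theorem IsWavePacket.congr (hO : IsWavePacket h δ w κ O) (hOO : ∀ t, 0 ≤ t → O' t = O t) :
    IsWavePacket h δ w κ O' := by
  obtain ⟨f, g, h1, h2, h3, h4, h5⟩ := hO
  exact ⟨f, g, h1, h2, h3, h4, fun t ht => (hOO t ht).trans (h5 t ht)⟩

theorem IsWavePacket.add (hO : IsWavePacket h δ w κ O) (hO' : IsWavePacket h δ w κ' O') :
    IsWavePacket h δ w (κ + κ') fun t => O t + O' t := by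
  obtain ⟨f, g, h1, h2, h3, h4, h5⟩ := hO
  obtain ⟨f', g', h1', h2', h3', h4', h5'⟩ := hO'
  refine ⟨f + f', g + g', h1.add h1', h2.add h2', (norm_add_le _ _).trans (add_le_add h3 h3'),
    (norm_add_le _ _).trans (add_le_add h4 h4'), fun t ht => ?_⟩
  simp only [h5 t ht, h5' t ht, smul_add]
  abel

theorem IsWavePacket.smul (hO : IsWavePacket h δ w κ O) {a : ℝ →ᵇ ℂ} {α : ℝ}
    (ha : ∀ ξ, ‖a ξ‖ ≤ α) : IsWavePacket h δ w (α * κ) fun t => a • O t := by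
  have hα : 0 ≤ α := (norm_nonneg _).trans (ha 0)
  obtain ⟨f, g, h1, h2, h3, h4, h5⟩ := hO
  refine ⟨a • f, a • g, h1.smul a, h2.smul a, (norm_bcf_smul_le a ha f).trans (by gcongr),
    (norm_bcf_smul_le a ha g).trans (by gcongr), fun t ht => ?_⟩
  simp only [h5 t ht]
  module

theorem norm_sq_eq_integral {μ : Measure ℝ} (f : Lp ℂ 2 μ) : ‖f‖ ^ 2 = ∫ ξ, ‖f ξ‖ ^ 2 ∂μ := by
  have h1 : ⟪f, f⟫_ℂ = ((‖f‖ ^ 2 : ℝ) : ℂ) := by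
    rw [inner_self_eq_norm_sq_to_K]
    push_cast
    rfl
  rw [L2.inner_def] at h1
  simp_rw [inner_self_eq_norm_sq_to_K] at h1
  have h2 : ∫ ξ, ((‖f ξ‖ : ℝ) : ℂ) ^ 2 ∂μ = ((∫ ξ, ‖f ξ‖ ^ 2 ∂μ : ℝ) : ℂ) := by
    rw [← integral_complex_ofReal]
    push_cast
    rfl
  exact (Complex.ofReal_injective (h2.symm.trans h1)).symm

theorem exp_smul_I_apply {ω : ℝ → ℝ} (hw : ∀ ξ, w ξ = (ω ξ : ℂ)) (t ξ : ℝ) :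
    NormedSpace.exp (t • (Complex.I • w)) ξ = Complex.exp (Complex.I * t * ω ξ) := by
  rw [exp_bcf_apply]
  congr 1
  change (t : ℂ) * (Complex.I * w ξ) = _
  rw [hw]
  ring

theorem freqInterval_subset (hh : 0 < h) (hδ₁ : δ < 1) : freqInterval h δ ⊆ freqInterval h 1 := by
  have : Real.pi * δ / h ≤ Real.pi * 1 / h := by
    have := Real.pi_pos
    gcongr
  exact Icc_subset_Icc (by linarith) this

/-- The value at a node of a half wave is square integrable in time. -/
theorem integral_node_half_wave_le (hh : 0 < h) (hδ₁ : δ < 1) {ω : ℝ → ℝ} (hω : Continuous ω)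
    (hw : ∀ ξ, w ξ = (ω ξ : ℂ)) {c : ℝ} (hc : 0 < c)
    (hexp : ∀ ξ ∈ freqInterval h δ, ∀ η ∈ freqInterval h δ, c * |ξ - η| ≤ |ω ξ - ω η|)
    {f : FreqSpace h} (hf : IsSupported h δ f) (j : ℤ) :
    Continuous (fun t : ℝ =>
      ∫ ξ, wave h j ξ * (NormedSpace.exp (t • (Complex.I • w)) • f) ξ ∂(freqMeasure h)) ∧
    ∀ T, 0 < T → ∫ t in (0 : ℝ)..T,
        ‖∫ ξ, wave h j ξ * (NormedSpace.exp (t • (Complex.I • w)) • f) ξ ∂(freqMeasure h)‖ ^ 2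
      ≤ 2 * Real.pi * Real.exp 1 / c * ‖f‖ ^ 2 := by
  have hsub := freqInterval_subset hh hδ₁
  have hB : IsFiniteMeasure (volume.restrict (freqInterval h δ)) :=
    ⟨by simp [freqInterval]⟩
  have hle : volume.restrict (freqInterval h δ) ≤ freqMeasure h :=
    Measure.restrict_mono hsub le_rfl
  have hmem := memLp_boundedContinuous_mul (wave h j) f
  have hmemB := hmem.mono_measure hle
  have e : ∀ t : ℝ,
      ∫ ξ, wave h j ξ * (NormedSpace.exp (t • (Complex.I • w)) • f) ξ ∂(freqMeasure h)
      = ∫ ξ in freqInterval h δ, Complex.exp (Complex.I * t * ω ξ) * (wave h j ξ * f ξ) := by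
    intro t
    have h1 : ∫ ξ, wave h j ξ * (NormedSpace.exp (t • (Complex.I • w)) • f) ξ ∂(freqMeasure h)
        = ∫ ξ in freqInterval h 1, Complex.exp (Complex.I * t * ω ξ) * (wave h j ξ * f ξ) := by
      refine integral_congr_ae ?_
      filter_upwards [bcf_smul_ae (NormedSpace.exp (t • (Complex.I • w))) f] with ξ h1
      rw [h1, exp_smul_I_apply hw]
      ring
    rw [h1]
    -- The phase is expanding only on the filtered interval, so the integral is restricted to it
    -- first.
    refine setIntegral_eq_of_subset_of_ae_sdiff_eq_zero measurableSet_Icc.nullMeasurableSet hsub ?_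
    filter_upwards [(ae_restrict_iff' measurableSet_Icc).mp hf] with ξ h2 h3
    rw [h2 h3.1 h3.2, mul_zero, mul_zero]
  simp_rw [e]
  refine ⟨continuous_oscillatory hω (hmemB.integrable (by norm_num)), fun T hT => ?_⟩
  refine (integral_norm_sq_oscillatory_le measurableSet_Icc hω hc hexp hmemB hT).trans ?_
  have := Real.pi_pos
  gcongr
  rw [norm_sq_eq_integral]
  have hn : ∀ ξ, ‖wave h j ξ * f ξ‖ = ‖f ξ‖ := fun ξ => by
    rw [norm_mul, wave_apply, norm_exp_I_mul, one_mul]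
  have hint := hmem.integrable_norm_pow (p := 2) (by norm_num)
  simp_rw [hn] at hint ⊢
  exact integral_mono_measure hle (Filter.Eventually.of_forall fun ξ => by
    simp only [Pi.zero_apply]; positivity) hint

/-- The value at a node of a wave packet is square integrable in time. -/
theorem IsWavePacket.integral_node_le (hh : 0 < h) (hδ₁ : δ < 1) {s : ℝ} (hs : 1 < s)
    (hw : ∀ ξ, w ξ = ((phase s (ξ * h) / h : ℝ) : ℂ)) {c : ℝ} (hc : 0 < c)
    (hexp : ∀ θ ∈ Icc (-(Real.pi * δ)) (Real.pi * δ), ∀ η ∈ Icc (-(Real.pi * δ)) (Real.pi * δ),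
      c * |θ - η| ≤ |phase s θ - phase s η|)
    {G : ℝ → Seq} (hG : IsWavePacket h δ w κ fun t => fourierOp hh (G t)) {T : ℝ} (hT : 0 < T)
    (j : ℤ) : ∫ t in (0 : ℝ)..T, ‖G t j‖ ^ 2 ≤ 2 * Real.exp 1 / (Real.pi * c) * κ ^ 2 := by
  obtain ⟨f, g, hf, hg, hfκ, hgκ, hfg⟩ := hG
  have hpi := Real.pi_pos
  set ω : ℝ → ℝ := fun ξ => phase s (ξ * h) / h with hωdef
  have hω : Continuous ω := by
    have := continuous_phase hs
    fun_prop
  have hmem : ∀ ξ ∈ freqInterval h δ, ξ * h ∈ Icc (-(Real.pi * δ)) (Real.pi * δ) := fun ξ hξ => by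
    have h1 := mul_le_mul_of_nonneg_right hξ.1 hh.le
    have h2 := mul_le_mul_of_nonneg_right hξ.2 hh.le
    rw [← neg_div, div_mul_cancel₀ _ hh.ne'] at h1
    rw [div_mul_cancel₀ _ hh.ne'] at h2
    exact ⟨h1, h2⟩
  -- The dilation by `h` inside the phase cancels the division by `h` outside, so the same `c` works
  -- for every mesh size.
  have hexp1 : ∀ ξ ∈ freqInterval h δ, ∀ η ∈ freqInterval h δ, c * |ξ - η| ≤ |ω ξ - ω η| :=
    fun ξ hξ η hη => by
    have h1 := hexp _ (hmem ξ hξ) _ (hmem η hη)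
    rw [← sub_mul, abs_mul, abs_of_pos hh] at h1
    rw [hωdef]
    simp only
    rw [← sub_div, abs_div, abs_of_pos hh, le_div_iff₀ hh]
    linarith
  have hexp2 : ∀ ξ ∈ freqInterval h δ, ∀ η ∈ freqInterval h δ,
      c * |ξ - η| ≤ |(-ω) ξ - (-ω) η| := fun ξ hξ η hη => by
    rw [Pi.neg_apply, Pi.neg_apply, neg_sub_neg]
    exact (hexp1 ξ hξ η hη).trans_eq (abs_sub_comm _ _)
  have hw2 : ∀ ξ, (-w) ξ = (((-ω) ξ : ℝ) : ℂ) := fun ξ => by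
    rw [BoundedContinuousFunction.neg_apply, hw, Pi.neg_apply, Complex.ofReal_neg]
  obtain ⟨c1, b1⟩ := integral_node_half_wave_le hh hδ₁ hω hw hc hexp1 hf j
  obtain ⟨c2, b2⟩ := integral_node_half_wave_le hh hδ₁ hω.neg hw2 hc hexp2 hg j
  have b1' := b1 T hT
  have b2' := b2 T hT
  set F1 : ℝ → ℂ := fun t : ℝ =>
      ∫ ξ, wave h j ξ * (NormedSpace.exp (t • (Complex.I • w)) • f) ξ ∂(freqMeasure h) with hF1
  set F2 : ℝ → ℂ := fun t : ℝ =>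
      ∫ ξ, wave h j ξ * (NormedSpace.exp (t • (Complex.I • -w)) • g) ξ ∂(freqMeasure h) with hF2
  have key : ∀ t, 0 ≤ t → ((2 * Real.pi : ℝ) : ℂ) * G t j = F1 t + F2 t := fun t ht => by
    have hi : ∀ x : FreqSpace h, Integrable (fun ξ => wave h j ξ * x ξ) (freqMeasure h) :=
      fun x => (memLp_boundedContinuous_mul (wave h j) x).integrable (by norm_num)
    have hfgt : fourierOp hh (G t) = _ := hfg t ht
    rw [fourierOp_inversion hh, hfgt, hF1, hF2, ← integral_add (hi _) (hi _)]
    refine integral_congr_ae ?_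
    filter_upwards [Lp.coeFn_add (NormedSpace.exp (t • (Complex.I • w)) • f)
      (NormedSpace.exp (t • (Complex.I • -w)) • g)] with ξ h1
    rw [h1, Pi.add_apply, mul_add]
  have hnorm : ∀ t ∈ Icc 0 T, ‖G t j‖ ^ 2 = 1 / (2 * Real.pi) ^ 2 * ‖F1 t + F2 t‖ ^ 2 :=
    fun t ht => by
    rw [← key t ht.1, norm_mul, Complex.norm_real, Real.norm_of_nonneg (by positivity)]
    field_simp
  calc ∫ t in (0 : ℝ)..T, ‖G t j‖ ^ 2
      = ∫ t in (0 : ℝ)..T, 1 / (2 * Real.pi) ^ 2 * ‖F1 t + F2 t‖ ^ 2 := by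
        refine intervalIntegral.integral_congr fun t ht => ?_
        rw [uIcc_of_le hT.le] at ht
        exact hnorm t ht
    _ ≤ ∫ t in (0 : ℝ)..T, 1 / (2 * Real.pi) ^ 2 * (2 * ‖F1 t‖ ^ 2 + 2 * ‖F2 t‖ ^ 2) := by
        refine intervalIntegral.integral_mono_on hT.le (Continuous.intervalIntegrable
          (by fun_prop) _ _) (Continuous.intervalIntegrable (by fun_prop) _ _) fun t _ => ?_
        refine mul_le_mul_of_nonneg_left ?_ (by positivity)
        have h1 := norm_add_le (F1 t) (F2 t)
        have h2 : ‖F1 t + F2 t‖ ^ 2 ≤ (‖F1 t‖ + ‖F2 t‖) ^ 2 := by gcongr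
        nlinarith [sq_nonneg (‖F1 t‖ - ‖F2 t‖)]
    _ = 1 / (2 * Real.pi) ^ 2 * (2 * (∫ t in (0 : ℝ)..T, ‖F1 t‖ ^ 2)
          + 2 * ∫ t in (0 : ℝ)..T, ‖F2 t‖ ^ 2) := by
        rw [intervalIntegral.integral_const_mul, intervalIntegral.integral_add
          (Continuous.intervalIntegrable (by fun_prop) _ _)
          (Continuous.intervalIntegrable (by fun_prop) _ _),
          intervalIntegral.integral_const_mul, intervalIntegral.integral_const_mul]
    _ ≤ 1 / (2 * Real.pi) ^ 2 * (2 * (2 * Real.pi * Real.exp 1 / c * κ ^ 2)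
          + 2 * (2 * Real.pi * Real.exp 1 / c * κ ^ 2)) := by
        have e1 : ‖f‖ ^ 2 ≤ κ ^ 2 := by gcongr
        have e2 : ‖g‖ ^ 2 ≤ κ ^ 2 := by gcongr
        refine mul_le_mul_of_nonneg_left (add_le_add ?_ ?_) (by positivity)
        · refine mul_le_mul_of_nonneg_left (b1'.trans ?_) (by norm_num)
          gcongr
        · refine mul_le_mul_of_nonneg_left (b2'.trans ?_) (by norm_num)
          gcongr
    _ = _ := by
        field_simp
        ring

end SIPG

namespace SIPG
open scoped BoundedContinuousFunction InnerProductSpace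

/-! ### Comparison of the energy with the size of the half waves -/

/-- The difference quotients of the averages. -/
noncomputable def diffQuot (h : ℝ) (U : State) : Seq :=
  (1 / h : ℂ) • (shift 1 (comp 0 U) - comp 0 U)

/-- The rescaled jumps. -/
noncomputable def jumpQuot (h : ℝ) (U : State) : Seq := (1 / h : ℂ) • comp 1 U

/-- The size of a state `U` with velocity `V` on the Fourier side. -/
noncomputable def waveSize {h : ℝ} (hh : 0 < h) (w : ℝ →ᵇ ℂ) (U V : State) : ℝ :=
  ‖hat hh 0 V‖ + ‖hat hh 1 V‖ + ‖w • hat hh 0 U‖ + ‖w • hat hh 1 U‖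

variable {h s K : ℝ}

theorem waveSize_nonneg (hh : 0 < h) (w : ℝ →ᵇ ℂ) (U V : State) : 0 ≤ waveSize hh w U V := by
  unfold waveSize
  positivity

theorem norm_one_div_smul (hh : 0 < h) (f : Seq) : ‖(1 / h : ℂ) • f‖ = (1 / h) * ‖f‖ := by
  rw [norm_smul, norm_div, norm_one, Complex.norm_real, Real.norm_of_nonneg hh.le]

theorem fourierOp_diffQuot (hh : 0 < h) {w b : ℝ →ᵇ ℂ}
    (hb : (1 / h : ℂ) • (wave h 1 - 1) = b * w) (U : State) :
    fourierOp hh (diffQuot h U) = b • w • hat hh 0 U := by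
  rw [diffQuot, map_smul, map_sub, fourierOp_shift, smul_smul, ← hb, smul_assoc, sub_smul, one_smul]
  rfl

/-- The second row of `R û = w² M û`, solved for the jump. As `R₂₂` is of order `h⁻²`, division by
it gains enough to control even the jump over `h` by `w û`. -/
theorem fourierOp_jumpQuot (hh : 0 < h) {w g : ℝ →ᵇ ℂ}
    (hg : g * mulR₂₂ h s = (1 / h : ℂ) • 1) {U : State}
    (hU : mulR₂₂ h s • hat hh 1 U
      = w ^ 2 • (-mulM₁₂ h • hat hh 0 U + mulM₂₂ h • hat hh 1 U)) :
    fourierOp hh (jumpQuot h U)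
      = (g * w) • (-mulM₁₂ h • w • hat hh 0 U + mulM₂₂ h • w • hat hh 1 U) := by
  have h1 : fourierOp hh (jumpQuot h U) = (g * mulR₂₂ h s) • hat hh 1 U := by
    rw [jumpQuot, map_smul, hg, smul_assoc, one_smul]
    rfl
  rw [h1, mul_smul, hU]
  module

/-- The wave size is controlled by the energy. -/
theorem waveSize_sq_le (hh : 0 < h) (hs : 1 < s) {w b' : ℝ →ᵇ ℂ} (hK : 0 < K)
    (hwK : ∀ ξ, ‖w ξ‖ ≤ K / h) (hbK : ∀ ξ, ‖b' ξ‖ ≤ K)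
    (hb : w = b' * ((1 / h : ℂ) • (wave h 1 - 1))) (U V : State) :
    waveSize hh w U V ^ 2
      ≤ 16 * Real.pi * (12 + K ^ 2 * (1 + 1 / (s - 1))) * energy h s U V := by
  have hpi := Real.pi_pos
  have hs1 : 0 < s - 1 := by linarith
  have hE := le_energy hh hs.le U V
  have hd : w • hat hh 0 U = b' • fourierOp hh (diffQuot h U) := by
    conv_lhs => rw [hb]
    rw [mul_smul, diffQuot, map_smul, map_sub, fourierOp_shift, smul_assoc, sub_smul, one_smul]
    rfl
  have n1 : ‖w • hat hh 0 U‖ ≤ K * ‖fourierOp hh (diffQuot h U)‖ := by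
    rw [hd]
    exact norm_bcf_smul_le b' hbK _
  have n2 : ‖w • hat hh 1 U‖ ≤ K / h * ‖hat hh 1 U‖ := norm_bcf_smul_le w hwK _
  have m1 : ‖w • hat hh 0 U‖ ^ 2 ≤ (K * ‖fourierOp hh (diffQuot h U)‖) ^ 2 := by gcongr
  have m2 : ‖w • hat hh 1 U‖ ^ 2 ≤ (K / h * ‖hat hh 1 U‖) ^ 2 := by gcongr
  rw [mul_pow, norm_fourierOp_sq, diffQuot, norm_one_div_smul hh] at m1
  rw [mul_pow, hat_apply, norm_fourierOp_sq] at m2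
  have m3 : ‖hat hh 0 V‖ ^ 2 = 2 * Real.pi * h * ‖comp 0 V‖ ^ 2 := norm_fourierOp_sq hh _
  have m4 : ‖hat hh 1 V‖ ^ 2 = 2 * Real.pi * h * ‖comp 1 V‖ ^ 2 := norm_fourierOp_sq hh _
  have hsq : waveSize hh w U V ^ 2 ≤ 4 * (‖hat hh 0 V‖ ^ 2 + ‖hat hh 1 V‖ ^ 2
      + ‖w • hat hh 0 U‖ ^ 2 + ‖w • hat hh 1 U‖ ^ 2) := by
    unfold waveSize
    have := sq_sum_le_card_mul_sum_sq (s := Finset.univ)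
      (f := ![‖hat hh 0 V‖, ‖hat hh 1 V‖, ‖w • hat hh 0 U‖, ‖w • hat hh 1 U‖])
    simpa [Fin.sum_univ_four] using this
  rw [← hat_apply] at m2
  generalize ‖shift 1 (comp 0 U) - comp 0 U‖ = X at *
  generalize ‖comp 1 U‖ = Y at *
  generalize ‖comp 0 V‖ = Z at *
  generalize ‖comp 1 V‖ = Q at *
  have e1 : K ^ 2 * (2 * Real.pi * h * (1 / h * X) ^ 2) = 2 * Real.pi * K ^ 2 * (1 / h * X ^ 2) := by
    field_simp
  have e2 : (K / h) ^ 2 * (2 * Real.pi * h * Y ^ 2) = 2 * Real.pi * K ^ 2 * (1 / h * Y ^ 2) := by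
    field_simp
  rw [e1] at m1
  rw [e2] at m2
  have p1 : 0 ≤ 1 / h * X ^ 2 := by positivity
  have p2 : 0 ≤ 1 / h * Y ^ 2 := by positivity
  have p3 : 0 ≤ h * Z ^ 2 := by positivity
  have p4 : 0 ≤ h * Q ^ 2 := by positivity
  have hE2 : 1 / 2 * (1 / h * X ^ 2 + (s - 1) * (1 / h * Y ^ 2) + (h * Z ^ 2) / 3
      + h * Q ^ 2 / 12) ≤ energy h s U V := by
    refine le_trans (le_of_eq ?_) hE
    ring
  have b1 : waveSize hh w U V ^ 2 ≤ 8 * Real.pi * (h * Z ^ 2 + h * Q ^ 2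
      + K ^ 2 * (1 / h * X ^ 2) + K ^ 2 * (1 / h * Y ^ 2)) := by
    refine hsq.trans ?_
    rw [m3, m4]
    linarith
  generalize 1 / h * X ^ 2 = x at *
  generalize 1 / h * Y ^ 2 = y at *
  generalize h * Z ^ 2 = z at *
  generalize h * Q ^ 2 = q at *
  have hE0 : 0 ≤ (s - 1) * y := by positivity
  have b2 : z + q ≤ 12 * (2 * energy h s U V) := by linarith
  have b3 : x ≤ 2 * energy h s U V := by linarith
  have b4 : y ≤ 1 / (s - 1) * (2 * energy h s U V) := by
    rw [div_mul_eq_mul_div, one_mul, le_div_iff₀ hs1]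
    linarith
  have b5 := mul_le_mul_of_nonneg_left (add_le_add b3 b4) (sq_nonneg K)
  refine b1.trans ?_
  calc 8 * Real.pi * (z + q + K ^ 2 * x + K ^ 2 * y)
      ≤ 8 * Real.pi * (12 * (2 * energy h s U V) +
        K ^ 2 * (2 * energy h s U V + 1 / (s - 1) * (2 * energy h s U V))) := by
        refine mul_le_mul_of_nonneg_left ?_ (by positivity)
        linarith
    _ = _ := by ring

/-- The energy is controlled by the wave size for physical states. -/
theorem energy_le_waveSize_sq (hh : 0 < h) (hs : 1 < s) {w b g : ℝ →ᵇ ℂ} (hK : 0 < K)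
    (hbK : ∀ ξ, ‖b ξ‖ ≤ K) (hgK : ∀ ξ, ‖(g * w) ξ‖ ≤ K)
    (hb : (1 / h : ℂ) • (wave h 1 - 1) = b * w) (hg : g * mulR₂₂ h s = (1 / h : ℂ) • 1)
    {U : State} (V : State) (hU : mulR₂₂ h s • hat hh 1 U
      = w ^ 2 • (-mulM₁₂ h • hat hh 0 U + mulM₂₂ h • hat hh 1 U)) :
    energy h s U V ≤ (K ^ 2 * (1 + s) + 2) * waveSize hh w U V ^ 2 := by
  have hpi := Real.pi_gt_three
  have hE := energy_le hh hs.le U V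
  have hν := waveSize_nonneg hh w U V
  set ν := waveSize hh w U V with hνdef
  have q1 := norm_nonneg (hat hh 0 V)
  have q2 := norm_nonneg (hat hh 1 V)
  have q3 := norm_nonneg (w • hat hh 0 U)
  have q4 := norm_nonneg (w • hat hh 1 U)
  have n1 : ‖fourierOp hh (diffQuot h U)‖ ≤ K * ν := by
    rw [fourierOp_diffQuot hh hb]
    refine (norm_bcf_smul_le b hbK _).trans (mul_le_mul_of_nonneg_left ?_ hK.le)
    rw [hνdef, waveSize]
    linarith
  have n2 : ‖fourierOp hh (jumpQuot h U)‖ ≤ K * ν := by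
    rw [fourierOp_jumpQuot hh hg hU]
    refine (norm_bcf_smul_le _ hgK _).trans (mul_le_mul_of_nonneg_left ?_ hK.le)
    have h1 := norm_bcf_smul_le (-mulM₁₂ h) (C := 1) (fun ξ => by
      rw [BoundedContinuousFunction.neg_apply, norm_neg]
      exact norm_mulM₁₂_le h ξ) (w • hat hh 0 U)
    have h2 := norm_bcf_smul_le (mulM₂₂ h) (C := 1) (norm_mulM₂₂_le h) (w • hat hh 1 U)
    refine (norm_add_le _ _).trans ?_
    rw [hνdef, waveSize]
    linarith
  have n3 : ‖hat hh 0 V‖ ≤ ν := by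
    rw [hνdef, waveSize]
    linarith
  have n4 : ‖hat hh 1 V‖ ≤ ν := by
    rw [hνdef, waveSize]
    linarith
  have m1 : ‖fourierOp hh (diffQuot h U)‖ ^ 2 ≤ (K * ν) ^ 2 := by gcongr
  have m2 : ‖fourierOp hh (jumpQuot h U)‖ ^ 2 ≤ (K * ν) ^ 2 := by gcongr
  have m3 : ‖hat hh 0 V‖ ^ 2 ≤ ν ^ 2 := by gcongr
  have m4 : ‖hat hh 1 V‖ ^ 2 ≤ ν ^ 2 := by gcongr
  rw [norm_fourierOp_sq, diffQuot, norm_one_div_smul hh] at m1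
  rw [norm_fourierOp_sq, jumpQuot, norm_one_div_smul hh] at m2
  rw [hat_apply, norm_fourierOp_sq] at m3 m4
  generalize ‖shift 1 (comp 0 U) - comp 0 U‖ = X at *
  generalize ‖comp 1 U‖ = Y at *
  generalize ‖comp 0 V‖ = Z at *
  generalize ‖comp 1 V‖ = Q at *
  have e : ∀ x : ℝ, 2 * Real.pi * h * (1 / h * x) ^ 2 = 2 * Real.pi * (1 / h * x ^ 2) := fun x => by
    field_simp
  have half : ∀ {x y : ℝ}, 0 ≤ x → 2 * Real.pi * x ≤ y → x ≤ y := fun hx hxy => by nlinarith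
  rw [e] at m1 m2
  rw [mul_assoc] at m3 m4
  have r1 := half (by positivity) m1
  have r2 := half (by positivity) m2
  have r3 := half (by positivity) m3
  have r4 := half (by positivity) m4
  have r5 := mul_le_mul_of_nonneg_left r2 (by linarith : 0 ≤ s)
  have : 0 ≤ K ^ 2 * (1 + s) * ν ^ 2 := by
    have : 0 < s := by linarith
    positivity
  refine hE.trans ?_
  calc (1 / 2) * ((1 / h) * (X ^ 2 + s * Y ^ 2) + h * (Z ^ 2 + Q ^ 2))
      = (1 / 2) * ((1 / h * X ^ 2) + s * (1 / h * Y ^ 2) + h * Z ^ 2 + h * Q ^ 2) := by ring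
    _ ≤ (1 / 2) * ((K * ν) ^ 2 + s * (K * ν) ^ 2 + ν ^ 2 + ν ^ 2) := by linarith
    _ ≤ _ := by nlinarith [sq_nonneg ν]

/-! ### Physical solutions as wave packets -/

/-- The multiplier is unimodular because `w` is real; the upper bound at time `-t` supplies the
reverse inequality. -/
theorem norm_exp_smul {w : ℝ →ᵇ ℂ} {ω : ℝ → ℝ} (hw : ∀ ξ, w ξ = (ω ξ : ℂ)) (t : ℝ)
    (f : FreqSpace h) : ‖NormedSpace.exp (t • (Complex.I • w)) • f‖ = ‖f‖ := by
  have hle : ∀ (t : ℝ) (f : FreqSpace h), ‖NormedSpace.exp (t • (Complex.I • w)) • f‖ ≤ ‖f‖ :=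
    fun t f => by
    have := norm_bcf_smul_le (NormedSpace.exp (t • (Complex.I • w))) (C := 1) (fun ξ => by
      rw [exp_smul_I_apply hw, mul_assoc, ← Complex.ofReal_mul, norm_exp_I_mul]) f
    rwa [one_mul] at this
  refine le_antisymm (hle t f) ?_
  have h1 := hle (-t) (NormedSpace.exp (t • (Complex.I • w)) • f)
  have h2 : NormedSpace.exp (-t • (Complex.I • w)) * NormedSpace.exp (t • (Complex.I • w)) = 1 := by
    ext ξ
    rw [BoundedContinuousFunction.mul_apply, exp_smul_I_apply hw, exp_smul_I_apply hw,
      ← Complex.exp_add]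
    push_cast
    rw [show Complex.I * -(t : ℂ) * ω ξ + Complex.I * t * ω ξ = 0 by ring, Complex.exp_zero]
    rfl
  rwa [smul_smul, h2, one_smul] at h1

theorem norm_half_wave_le {μ : Measure ℝ} (w : ℝ →ᵇ ℂ) (x y : Lp ℂ 2 μ) :
    ‖y + (Complex.I • w) • x‖ ≤ ‖y‖ + ‖w • x‖ ∧ ‖y + (Complex.I • -w) • x‖ ≤ ‖y‖ + ‖w • x‖ := by
  have h1 : ‖(Complex.I • w) • x‖ = ‖w • x‖ := by
    rw [smul_assoc, norm_smul, Complex.norm_I, one_mul]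
  have h2 : (Complex.I • -w) • x = -((Complex.I • w) • x) := by
    rw [smul_neg, neg_smul]
  refine ⟨(norm_add_le _ _).trans_eq (by rw [h1]), (norm_add_le _ _).trans_eq ?_⟩
  rw [h2, norm_neg, h1]

/-- Positions come back only as `w û`: since `w` vanishes at `ξ = 0`, no bound on `û` itself is
available. The coefficients have modulus one half, so norms do not grow. -/
theorem half_wave_recover {μ : Measure ℝ} (w : ℝ →ᵇ ℂ) (x y : Lp ℂ 2 μ) :
    y = (1 / 2 : ℂ) • ((y + (Complex.I • w) • x) + (y + (Complex.I • -w) • x)) ∧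
    w • x = (-Complex.I / 2) • (y + (Complex.I • w) • x)
      + (Complex.I / 2) • (y + (Complex.I • -w) • x) := by
  rw [smul_neg, neg_smul, smul_assoc]
  constructor
  · generalize Complex.I • w • x = z
    module
  · have : w • x = (-Complex.I * Complex.I) • (w • x) := by
      rw [neg_mul, Complex.I_mul_I, neg_neg, one_smul]
    rw [this]
    generalize w • x = z
    rw [smul_smul Complex.I, show Complex.I * (-Complex.I * Complex.I) = Complex.I by
      rw [neg_mul, Complex.I_mul_I, neg_neg, mul_one]]
    module

/-- The wave size at time `t` controls the initial one. -/
theorem waveSize_le_two_mul (hh : 0 < h) {w : ℝ →ᵇ ℂ} {ω : ℝ → ℝ} (hw : ∀ ξ, w ξ = (ω ξ : ℂ))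
    {U₀ U₁ U V : State} {t : ℝ}
    (H : ∀ i, hat hh i V + (Complex.I • w) • hat hh i U
        = NormedSpace.exp (t • (Complex.I • w)) • (hat hh i U₁ + (Complex.I • w) • hat hh i U₀) ∧
      hat hh i V + (Complex.I • -w) • hat hh i U
        = NormedSpace.exp (t • (Complex.I • -w)) •
          (hat hh i U₁ + (Complex.I • -w) • hat hh i U₀)) :
    waveSize hh w U₀ U₁ ≤ 2 * waveSize hh w U V := by
  have hw2 : ∀ ξ, (-w) ξ = ((-ω ξ : ℝ) : ℂ) := fun ξ => by
    rw [BoundedContinuousFunction.neg_apply, hw, Complex.ofReal_neg]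
  -- Both initial quantities of a component are bounded by the same sum at time `t`, so adding them
  -- up counts it twice.
  have key : ∀ i, ‖hat hh i U₁‖ ≤ ‖hat hh i V‖ + ‖w • hat hh i U‖ ∧
      ‖w • hat hh i U₀‖ ≤ ‖hat hh i V‖ + ‖w • hat hh i U‖ := fun i => by
    have e1 : ‖hat hh i U₁ + (Complex.I • w) • hat hh i U₀‖ ≤ ‖hat hh i V‖ + ‖w • hat hh i U‖ := by
      rw [← norm_exp_smul hw t, ← (H i).1]
      exact (norm_half_wave_le w _ _).1
    have e2 : ‖hat hh i U₁ + (Complex.I • -w) • hat hh i U₀‖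
        ≤ ‖hat hh i V‖ + ‖w • hat hh i U‖ := by
      rw [← norm_exp_smul hw2 t, ← (H i).2]
      exact (norm_half_wave_le w _ _).2
    obtain ⟨r1, r2⟩ := half_wave_recover w (hat hh i U₀) (hat hh i U₁)
    generalize hat hh i U₁ + (Complex.I • w) • hat hh i U₀ = zp at *
    generalize hat hh i U₁ + (Complex.I • -w) • hat hh i U₀ = zm at *
    have c1 : ‖(1 / 2 : ℂ)‖ = 1 / 2 := by norm_num
    have c2 : ‖-Complex.I / 2‖ = 1 / 2 := by simp
    have c3 : ‖Complex.I / 2‖ = 1 / 2 := by simp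
    constructor
    · rw [r1, norm_smul, c1]
      linarith [norm_add_le zp zm]
    · rw [r2]
      refine (norm_add_le _ _).trans ?_
      rw [norm_smul, norm_smul, c2, c3]
      linarith
  unfold waveSize
  linarith [(key 0).1, (key 0).2, (key 1).1, (key 1).2]

/-- Velocities and positions of a physical solution are filtered wave packets. -/
theorem isWavePacket_hat {δ : ℝ} (hh : 0 < h) {w : ℝ →ᵇ ℂ} {U₀ U₁ : State} {U V : ℝ → State}
    (H : ∀ t, 0 ≤ t → ∀ i, hat hh i (V t) + (Complex.I • w) • hat hh i (U t)
        = NormedSpace.exp (t • (Complex.I • w)) • (hat hh i U₁ + (Complex.I • w) • hat hh i U₀) ∧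
      hat hh i (V t) + (Complex.I • -w) • hat hh i (U t)
        = NormedSpace.exp (t • (Complex.I • -w)) •
          (hat hh i U₁ + (Complex.I • -w) • hat hh i U₀))
    (i : Fin 2) (h₀ : IsSupported h δ (hat hh i U₀)) (h₁ : IsSupported h δ (hat hh i U₁)) :
    IsWavePacket h δ w (waveSize hh w U₀ U₁) (fun t => hat hh i (V t)) ∧
    IsWavePacket h δ w (waveSize hh w U₀ U₁) (fun t => w • hat hh i (U t)) := by
  have q1 := norm_nonneg (hat hh 0 U₁)
  have q2 := norm_nonneg (hat hh 1 U₁)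
  have q3 := norm_nonneg (w • hat hh 0 U₀)
  have q4 := norm_nonneg (w • hat hh 1 U₀)
  have hsz : ‖hat hh i U₁‖ + ‖w • hat hh i U₀‖ ≤ waveSize hh w U₀ U₁ := by
    unfold waveSize
    fin_cases i
    · simp only [Fin.zero_eta]
      linarith
    · simp only [Fin.mk_one]
      linarith
  have sp : IsSupported h δ (hat hh i U₁ + (Complex.I • w) • hat hh i U₀) := h₁.add (h₀.smul _)
  have sm : IsSupported h δ (hat hh i U₁ + (Complex.I • -w) • hat hh i U₀) := h₁.add (h₀.smul _)
  have np := (norm_half_wave_le w (hat hh i U₀) (hat hh i U₁)).1.trans hsz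
  have nm := (norm_half_wave_le w (hat hh i U₀) (hat hh i U₁)).2.trans hsz
  have hcs : ∀ (c : ℂ) {f : FreqSpace h}, IsSupported h δ f → IsSupported h δ (c • f) :=
    fun c f hf => by
    filter_upwards [hf, Lp.coeFn_smul c f] with ξ h1 h2 h3
    rw [h2, Pi.smul_apply, h1 h3, smul_zero]
  have hcn : ∀ {c : ℂ} {f : FreqSpace h}, ‖c‖ = 1 / 2 → ‖f‖ ≤ waveSize hh w U₀ U₁ →
      ‖c • f‖ ≤ waveSize hh w U₀ U₁ := fun hc hf => by
    rw [norm_smul, hc]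
    linarith [waveSize_nonneg hh w U₀ U₁]
  have c1 : ‖(1 / 2 : ℂ)‖ = 1 / 2 := by norm_num
  have c2 : ‖-Complex.I / 2‖ = 1 / 2 := by simp
  have c3 : ‖Complex.I / 2‖ = 1 / 2 := by simp
  constructor
  · refine ⟨_, _, hcs (1 / 2) sp, hcs (1 / 2) sm, hcn c1 np, hcn c1 nm, fun t ht => ?_⟩
    have := (half_wave_recover w (hat hh i (U t)) (hat hh i (V t))).1
    rw [(H t ht i).1, (H t ht i).2, smul_add] at this
    rw [smul_comm (NormedSpace.exp (t • (Complex.I • w))) (1 / 2 : ℂ),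
      smul_comm (NormedSpace.exp (t • (Complex.I • -w))) (1 / 2 : ℂ)]
    exact this
  · refine ⟨_, _, hcs (-Complex.I / 2) sp, hcs (Complex.I / 2) sm, hcn c2 np, hcn c3 nm,
      fun t ht => ?_⟩
    have := (half_wave_recover w (hat hh i (U t)) (hat hh i (V t))).2
    rw [(H t ht i).1, (H t ht i).2] at this
    rw [smul_comm (NormedSpace.exp (t • (Complex.I • w))) (-Complex.I / 2 : ℂ),
      smul_comm (NormedSpace.exp (t • (Complex.I • -w))) (Complex.I / 2 : ℂ)]
    exact this

end SIPG

namespace SIPG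
open scoped BoundedContinuousFunction InnerProductSpace

/-! ### Observability -/

section Observability

variable {h s : ℝ}

/-- The squares of the observables entering the energy at a node. -/
noncomputable def nodeSquares (h : ℝ) (U V : State) (j : ℤ) : ℝ :=
  ‖diffQuot h U j‖ ^ 2 + ‖jumpQuot h U j‖ ^ 2 + ‖jumpQuot h U (j + 1)‖ ^ 2
    + (‖comp 0 V (j - 1)‖ ^ 2 + ‖comp 1 V (j - 1)‖ ^ 2 + ‖comp 0 V j‖ ^ 2
        + ‖comp 1 V j‖ ^ 2 + ‖comp 0 V (j + 1)‖ ^ 2 + ‖comp 1 V (j + 1)‖ ^ 2)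

/-- Rescaling differences and jumps by `1 / h` turns the weight `1 / h` into `h`, which the later
sum over `O(1 / h)` nodes compensates. -/
theorem nodeEnergy_le_nodeSquares (hh : 0 < h) (hs : 1 ≤ s) (U V : State) (j : ℤ) :
    nodeEnergy h s U V j ≤ h * (s + 3) * nodeSquares h U V j := by
  refine (nodeEnergy_le hh hs U V j).trans ?_
  have e : ∀ (f : Seq) (j : ℤ), ‖((1 / h : ℂ) • f) j‖ = (1 / h) * ‖f j‖ := fun f j => by
    rw [seq_smul_apply, norm_mul, norm_div, norm_one, Complex.norm_real,
      Real.norm_of_nonneg hh.le]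
  rw [nodeSquares, diffQuot, jumpQuot, e, e, e]
  generalize ‖(shift 1 (comp 0 U) - comp 0 U) j‖ = x
  generalize ‖comp 1 U j‖ = y
  generalize ‖comp 1 U (j + 1)‖ = z
  have hq : 0 ≤ ‖comp 0 V (j - 1)‖ ^ 2 + ‖comp 1 V (j - 1)‖ ^ 2 + ‖comp 0 V j‖ ^ 2
        + ‖comp 1 V j‖ ^ 2 + ‖comp 0 V (j + 1)‖ ^ 2 + ‖comp 1 V (j + 1)‖ ^ 2 := by positivity
  generalize ‖comp 0 V (j - 1)‖ ^ 2 + ‖comp 1 V (j - 1)‖ ^ 2 + ‖comp 0 V j‖ ^ 2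
        + ‖comp 1 V j‖ ^ 2 + ‖comp 0 V (j + 1)‖ ^ 2 + ‖comp 1 V (j + 1)‖ ^ 2 = q at *
  have e1 : h * (s + 3) * ((1 / h * x) ^ 2 + (1 / h * y) ^ 2 + (1 / h * z) ^ 2 + q)
      = 1 / (2 * h) * ((2 * s + 6) * x ^ 2 + (2 * s + 6) * y ^ 2 + (2 * s + 6) * z ^ 2)
        + (s + 3) * h * q := by
    field_simp
    ring
  rw [e1]
  refine add_le_add (mul_le_mul_of_nonneg_left ?_ (by positivity))
    (mul_le_mul_of_nonneg_right ?_ hq)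
  · nlinarith [sq_nonneg x, sq_nonneg y, sq_nonneg z,
      mul_nonneg (by linarith : 0 ≤ s) (sq_nonneg x), mul_nonneg (by linarith : 0 ≤ s) (sq_nonneg y),
      mul_nonneg (by linarith : 0 ≤ s) (sq_nonneg z)]
  · nlinarith

theorem continuousOn_seq_apply {X : ℝ → Seq} {S : Set ℝ} (hX : ContinuousOn X S) (j : ℤ) :
    ContinuousOn (fun t => X t j) S :=
  (lp.evalCLM ℂ (fun _ : ℤ => ℂ) 2 j).continuous.comp_continuousOn hX

theorem continuousOn_comp_apply {X : ℝ → State} {S : Set ℝ} (hX : ContinuousOn X S) (i : Fin 2)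
    (j : ℤ) : ContinuousOn (fun t => comp i (X t) j) S :=
  continuousOn_seq_apply ((comp i).continuous.comp_continuousOn hX) j

theorem continuousOn_diffQuot_apply {X : ℝ → State} {S : Set ℝ} (hX : ContinuousOn X S) (j : ℤ) :
    ContinuousOn (fun t => diffQuot h (X t) j) S := by
  have : Continuous (diffQuot h) :=
    (((shift 1).continuous.comp (comp 0).continuous).sub (comp 0).continuous).const_smul (1 / h : ℂ)
  exact continuousOn_seq_apply (this.comp_continuousOn hX) j

theorem continuousOn_jumpQuot_apply {X : ℝ → State} {S : Set ℝ} (hX : ContinuousOn X S) (j : ℤ) :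
    ContinuousOn (fun t => jumpQuot h (X t) j) S :=
  (continuousOn_comp_apply hX 1 j).const_smul (1 / h : ℂ)

theorem continuousOn_nodeEnergy (hh : 0 < h) (hs : 1 ≤ s) {U V : ℝ → State} {S : Set ℝ}
    (hU : ContinuousOn U S) (hV : ContinuousOn V S) (j : ℤ) :
    ContinuousOn (fun t => nodeEnergy h s (U t) (V t) j) S := by
  have hu : ∀ i k, ContinuousOn (fun t => coeffs (U t) k i) S := fun i k =>
    continuousOn_comp_apply hU i k
  have hv : ∀ i k, ContinuousOn (fun t => coeffs (V t) k i) S := fun i k =>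
    continuousOn_comp_apply hV i k
  have e : ∀ t, massOp h (coeffs (V t)) j ⬝ᵥ star (coeffs (V t) j)
      = massOp h (coeffs (V t)) j 0 * star (coeffs (V t) j 0)
        + massOp h (coeffs (V t)) j 1 * star (coeffs (V t) j 1) := fun t => by
    rw [dotProduct, Fin.sum_univ_two]
    rfl
  have hm : ∀ i, ContinuousOn (fun t => massOp h (coeffs (V t)) j i) S := fun i => by
    simp only [massOp, stencilApply, Pi.add_apply, Matrix.mulVec, dotProduct, Fin.sum_univ_two]
    have h1 := hv 0 (j - 1)
    have h2 := hv 1 (j - 1)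
    have h3 := hv 0 j
    have h4 := hv 1 j
    have h5 := hv 0 (j + 1)
    have h6 := hv 1 (j + 1)
    fun_prop
  have h1 : ContinuousOn (fun t => massOp h (coeffs (V t)) j ⬝ᵥ star (coeffs (V t) j)) S := by
    simp only [e]
    exact ((hm 0).mul (hv 0 j).star).add ((hm 1).mul (hv 1 j).star)
  have h2 : ContinuousOn (fun t => gradOp h s (coeffs (U t)) j
      ⬝ᵥ star (gradOp h s (coeffs (U t)) j)) S := by
    simp only [gradOp_dot h s hh hs]
    refine Complex.continuous_ofReal.comp_continuousOn ?_
    have h1 := hu 0 j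
    have h2 := hu 1 j
    have h3 := hu 0 (j + 1)
    have h4 := hu 1 (j + 1)
    fun_prop
  exact (Complex.continuous_re.comp_continuousOn (h2.add h1)).const_smul (1 / 2 : ℝ)

/-- The time integral of the observables at a node. -/
theorem integral_nodeSquares_le {T B : ℝ} (hT : 0 < T) {U V : ℝ → State}
    (hU : ContinuousOn U (Icc 0 T)) (hV : ContinuousOn V (Icc 0 T))
    (hd : ∀ j, ∫ t in (0 : ℝ)..T, ‖diffQuot h (U t) j‖ ^ 2 ≤ B)
    (hj : ∀ j, ∫ t in (0 : ℝ)..T, ‖jumpQuot h (U t) j‖ ^ 2 ≤ B)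
    (hv : ∀ i j, ∫ t in (0 : ℝ)..T, ‖comp i (V t) j‖ ^ 2 ≤ B) (j : ℤ) :
    IntervalIntegrable (fun t => nodeSquares h (U t) (V t) j) volume 0 T ∧
    ∫ t in (0 : ℝ)..T, nodeSquares h (U t) (V t) j ≤ 9 * B := by
  have hint : ∀ {f : ℝ → ℂ}, ContinuousOn f (Icc 0 T) →
      IntervalIntegrable (fun t => ‖f t‖ ^ 2) volume 0 T := fun hf =>
    ContinuousOn.intervalIntegrable (by rw [uIcc_of_le hT.le]; fun_prop)
  have i1 := hint (continuousOn_diffQuot_apply (h := h) hU j)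
  have i2 := hint (continuousOn_jumpQuot_apply (h := h) hU j)
  have i3 := hint (continuousOn_jumpQuot_apply (h := h) hU (j + 1))
  have i4 := hint (continuousOn_comp_apply hV 0 (j - 1))
  have i5 := hint (continuousOn_comp_apply hV 1 (j - 1))
  have i6 := hint (continuousOn_comp_apply hV 0 j)
  have i7 := hint (continuousOn_comp_apply hV 1 j)
  have i8 := hint (continuousOn_comp_apply hV 0 (j + 1))
  have i9 := hint (continuousOn_comp_apply hV 1 (j + 1))
  unfold nodeSquares
  refine ⟨((i1.add i2).add i3).add (((((i4.add i5).add i6).add i7).add i8).add i9), ?_⟩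
  rw [intervalIntegral.integral_add ((i1.add i2).add i3)
      (((((i4.add i5).add i6).add i7).add i8).add i9),
    intervalIntegral.integral_add (i1.add i2) i3, intervalIntegral.integral_add i1 i2,
    intervalIntegral.integral_add ((((i4.add i5).add i6).add i7).add i8) i9,
    intervalIntegral.integral_add (((i4.add i5).add i6).add i7) i8,
    intervalIntegral.integral_add ((i4.add i5).add i6) i7,
    intervalIntegral.integral_add (i4.add i5) i6, intervalIntegral.integral_add i4 i5]
  linarith [hd j, hj j, hj (j + 1), hv 0 (j - 1), hv 1 (j - 1), hv 0 j, hv 1 j, hv 0 (j + 1),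
    hv 1 (j + 1)]

/-- Lower bound for the observed energy, given bounds for the observables at the nodes. -/
theorem le_integral_localEnergy {T B E : ℝ} (hh : 0 < h) (h1 : h ≤ 1) (hs : 1 ≤ s) (hT : 0 < T)
    (hB : 0 ≤ B) {U V : ℝ → State}
    (hU : ContinuousOn U (Icc 0 T)) (hV : ContinuousOn V (Icc 0 T))
    (hd : ∀ j, ∫ t in (0 : ℝ)..T, ‖diffQuot h (U t) j‖ ^ 2 ≤ B)
    (hj : ∀ j, ∫ t in (0 : ℝ)..T, ‖jumpQuot h (U t) j‖ ^ 2 ≤ B)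
    (hv : ∀ i j, ∫ t in (0 : ℝ)..T, ‖comp i (V t) j‖ ^ 2 ≤ B)
    (hE : ∀ t ∈ Icc 0 T, E ≤ energy h s (U t) (V t)) :
    T * E - 27 * (s + 3) * B ≤ ∫ t in (0 : ℝ)..T, localEnergy h s (U t) (V t) := by
  have hsq := integral_nodeSquares_le hT hU hV hd hj hv
  have hcont : ContinuousOn (fun t => localEnergy h s (U t) (V t)) (uIcc 0 T) := by
    rw [uIcc_of_le hT.le]
    simp only [localEnergy_eq hh hs]
    exact (continuousOn_energy hh hs hU hV).sub
      (continuousOn_finsetSum _ fun j _ => continuousOn_nodeEnergy hh hs hU hV j)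
  have hsum : IntervalIntegrable (fun t => ∑ j ∈ innerNodes hh,
      h * (s + 3) * nodeSquares h (U t) (V t) j) volume 0 T := by
    have := IntervalIntegrable.sum (innerNodes hh) fun j _ => (hsq j).1.const_mul (h * (s + 3))
    convert! this using 1
    ext t
    rw [Finset.sum_apply]
  have hmono : ∫ t in (0 : ℝ)..T, (E - ∑ j ∈ innerNodes hh,
      h * (s + 3) * nodeSquares h (U t) (V t) j)
      ≤ ∫ t in (0 : ℝ)..T, localEnergy h s (U t) (V t) := by
    refine intervalIntegral.integral_mono_on hT.le (intervalIntegrable_const.sub hsum)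
      hcont.intervalIntegrable fun t ht => ?_
    rw [localEnergy_eq hh hs]
    exact sub_le_sub (hE t ht) (Finset.sum_le_sum fun j _ =>
      nodeEnergy_le_nodeSquares hh hs (U t) (V t) j)
  refine le_trans ?_ hmono
  rw [intervalIntegral.integral_sub intervalIntegrable_const hsum,
    intervalIntegral.integral_const, sub_zero, smul_eq_mul,
    intervalIntegral.integral_finsetSum fun j _ => (hsq j).1.const_mul _]
  refine sub_le_sub_left ?_ _
  -- The constant 27 is 9 observables per node times the bound 3 for `h` times the number of nodes.
  calc ∑ j ∈ innerNodes hh, ∫ t in (0 : ℝ)..T, h * (s + 3) * nodeSquares h (U t) (V t) j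
      ≤ ∑ j ∈ innerNodes hh, h * (s + 3) * (9 * B) := by
        refine Finset.sum_le_sum fun j _ => ?_
        rw [intervalIntegral.integral_const_mul]
        exact mul_le_mul_of_nonneg_left (hsq j).2 (by positivity)
    _ = (h * (innerNodes hh).card) * (9 * (s + 3) * B) := by
        rw [Finset.sum_const, nsmul_eq_mul]
        ring
    _ ≤ 3 * (9 * (s + 3) * B) := by
        refine mul_le_mul_of_nonneg_right (card_innerNodes_le hh h1) (by positivity)
    _ = _ := by ring

end Observability

end SIPG

/-! ### Waiting time, constants and conclusion -/

theorem mainTheorem3 (s : ℝ) (hs : 1 < s) (δ : ℝ) (hδ₀ : 0 < δ) (hδ₁ : δ < 1) :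
    ∃ Tph : ℝ, 0 < Tph ∧ ∀ T : ℝ, Tph < T → ∃ C : ℝ, 0 < C ∧
      ∀ h : ℝ, 0 < h → h ≤ 1 →
      ∀ P : ℝ → Fin 2 → ℂ, IsPhysEigenvector h s P →
      ∀ (U₀ U₁ : State) (u₀ u₁ : lp (fun _ : ℤ => ℂ) 2),
        IsPhysData h P U₀ u₀ → IsPhysData h P U₁ u₁ →
        IsFiltered h δ u₀ → IsFiltered h δ u₁ →
      ∀ U V : ℝ → State, IsSolution h s U₀ U₁ U V →
        energy h s U₀ U₁ ≤ C * ∫ t in (0 : ℝ)..T, localEnergy h s (U t) (V t) := by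
  obtain ⟨K, hK, hmul⟩ := exists_multipliers hs
  obtain ⟨c, hc, hexp⟩ := exists_phase_expanding hs hδ₀ hδ₁
  have hpi := Real.pi_pos
  have hs1 : 0 < s - 1 := by linarith
  have hs0 : 0 < s := by linarith
  set A : ℝ := 16 * Real.pi * (12 + K ^ 2 * (1 + 1 / (s - 1))) with hA
  have hA0 : 0 < A := by positivity
  -- The factor `2 K + 1` dominates the packet sizes `K ν`, `2 K ν` and `ν` of difference quotients,
  -- jumps and velocities.
  set L : ℝ := 2 * Real.exp 1 / (Real.pi * c) * (2 * K + 1) ^ 2 with hL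
  have hL0 : 0 < L := by positivity
  set N : ℝ := 27 * (s + 3) * L with hN
  have hN0 : 0 < N := by positivity
  -- Beyond this time the total energy, at least `T ν² / (4 A)` after integration, exceeds the
  -- unobserved part, at most `N ν²`.
  refine ⟨4 * A * N, by positivity, fun T hT => ?_⟩
  have hT0 : 0 < T := lt_trans (by positivity) hT
  have hgap : 0 < T / (4 * A) - N := by
    rw [sub_pos, lt_div_iff₀ (by positivity)]
    linarith
  refine ⟨(K ^ 2 * (1 + s) + 2) / (T / (4 * A) - N), by positivity, ?_⟩
  intro h hh hh1 P hP U₀ U₁ u₀ u₁ hU₀ hU₁ hu₀ hu₁ U V hUV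
  obtain ⟨w, b, b', g, hw, hwK, hbK, hbK', hgK, hb, hb', hg⟩ := hmul h hh
  have hsol := fun (t : ℝ) (ht : 0 ≤ t) => hat_solution hh hs hP hw hU₀ hU₁ hUV ht
  set ν := waveSize hh w U₀ U₁ with hν
  have hν0 : 0 ≤ ν := waveSize_nonneg hh w U₀ U₁
  have hwp := fun i => isWavePacket_hat hh (fun t ht => (hsol t ht).2) i
    (isSupported_hat hh hU₀ hu₀ i) (isSupported_hat hh hU₁ hu₁ i)
  have hcU : ContinuousOn U (Icc 0 T) := fun t ht =>
    (hUV.deriv_pos t ht.1).continuousWithinAt.mono Icc_subset_Ici_self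
  have hcV : ContinuousOn V (Icc 0 T) := fun t ht => by
    obtain ⟨W, hW, -⟩ := hUV.wave t ht.1
    exact hW.continuousWithinAt.mono Icc_subset_Ici_self
  have hbound : ∀ {κ : ℝ} {G : ℝ → Seq}, 0 ≤ κ → κ ≤ (2 * K + 1) * ν →
      IsWavePacket h δ w κ (fun t => fourierOp hh (G t)) →
      ∀ j, ∫ t in (0 : ℝ)..T, ‖G t j‖ ^ 2 ≤ L * ν ^ 2 := fun hκ0 hκ hG j => by
    refine (hG.integral_node_le hh hδ₁ hs hw hc hexp hT0 j).trans ?_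
    rw [hL, mul_assoc _ ((2 * K + 1) ^ 2), ← mul_pow]
    gcongr
  have hd : ∀ j, ∫ t in (0 : ℝ)..T, ‖diffQuot h (U t) j‖ ^ 2 ≤ L * ν ^ 2 := by
    refine hbound (κ := K * ν) (by positivity) (by nlinarith) ?_
    exact ((hwp 0).2.smul hbK).congr fun t _ => fourierOp_diffQuot hh hb (U t)
  have hj : ∀ j, ∫ t in (0 : ℝ)..T, ‖jumpQuot h (U t) j‖ ^ 2 ≤ L * ν ^ 2 := by
    refine hbound (κ := K * (1 * ν + 1 * ν)) (by positivity) (by nlinarith) ?_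
    refine (IsWavePacket.smul (IsWavePacket.add ((hwp 0).2.smul (a := -mulM₁₂ h) fun ξ => ?_)
      ((hwp 1).2.smul (norm_mulM₂₂_le h))) hgK).congr
      fun t ht => fourierOp_jumpQuot hh hg (hsol t ht).1
    rw [BoundedContinuousFunction.neg_apply, norm_neg]
    exact norm_mulM₁₂_le h ξ
  have hv : ∀ i j, ∫ t in (0 : ℝ)..T, ‖comp i (V t) j‖ ^ 2 ≤ L * ν ^ 2 := fun i =>
    hbound (κ := ν) hν0 (by nlinarith) (hwp i).1
  -- Energy conservation is replaced by the comparison of wave sizes; its factor 2 becomes the 4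
  -- here.
  have hE : ∀ t ∈ Icc 0 T, ν ^ 2 / (4 * A) ≤ energy h s (U t) (V t) := fun t ht => by
    have e1 := waveSize_le_two_mul hh hw (hsol t ht.1).2
    have e2 := waveSize_sq_le hh hs hK hwK hbK' hb' (U t) (V t)
    have e3 : ν ^ 2 ≤ (2 * waveSize hh w (U t) (V t)) ^ 2 := by gcongr
    rw [div_le_iff₀ (by positivity)]
    linarith
  have hfin := le_integral_localEnergy hh hh1 hs.le hT0 (by positivity) hcU hcV hd hj hv hE
  have h0 : energy h s U₀ U₁ ≤ (K ^ 2 * (1 + s) + 2) * ν ^ 2 := by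
    refine energy_le_waveSize_sq hh hs hK hbK hgK hb hg U₁ ?_
    have := (hsol 0 le_rfl).1
    rwa [hUV.init_pos] at this
  refine h0.trans ?_
  rw [div_mul_eq_mul_div, mul_div_assoc]
  refine mul_le_mul_of_nonneg_left ?_ (by positivity)
  rw [le_div_iff₀ hgap]
  refine le_trans (le_of_eq ?_) hfin
  rw [hN]
  ring
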